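/- Let $p$ be an odd prime and $r\ge 1$. Call a prime $q$ admissible if (i) $p\equiv 1 \pmod 4$, $q$ is a nonsquare mod $p$ and $q\equiv 3\pmod 4$; or (ii) $p\equiv 3\pmod 4$, $q$ is a square mod $p$ and $q\equiv 1\pmod 8$. Admissible primes exist. Given an admissible prime $q$, put \[ (a,b)=\begin{cases}(-q,-p) & \text{if } r \text{ is odd and } p\equiv 1 \pmod 4,\\ (-qp,-p) & \text{if } r \text{ is even and } p\equiv 1 \pmod 4,\\ (-p,-q) & \text{if } p\equiv 3 \pmod 4,\end{cases} \] and let $\left(\frac{a,b}{\mathbb Q}\right)$ be the quaternion algebra with $\mathbb Q$-basis $1,i,j,k$ and $i^2=a$, $j^2=b$, $ij=-ji=k$. This algebra is definite of discriminant $p$ (the discriminant is the product of the ramified primes), and every definite quaternion algebra $B$ over $\mathbb Q$ with discriminant $\Delta_B=p$ is isomorphic to $\left(\frac{a,b}{\mathbb Q}\right)$. Put $f=p^n$ and $h=1$ if $r=2n+1$ is odd, and $f=p^{n-1}$ and $h=p^{1-v_p(b)}$ if $r=2n$ is even. There is an integer $x$ with $x^2\equiv -p\pmod q$; let $x$ be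 any such integer. If $p\equiv 1\pmod 4$, let $y,z$ be integers with $y(-q)+z(2x)=1$, and let $0\le z'<2qf$ with $z'\equiv 4z\pmod{2qf}$; put \[\mathcal O=\mathbb Z\left\langle \frac{q+i+2zk}{2q},\ \frac{2i+z'k}{2q},\ \frac{f(j+k)}{2},\ fk\right\rangle .\] If $p\equiv 3\pmod 4$, let $v,w$ be integers with $vq+w(2x)=1$, and let $0\le u<2q$ with $u\equiv vq+2w\pmod{2q}$; put \[\mathcal O=\mathbb Z\left\langle 1,\ \frac{1+i}{2},\ \frac{fh(j+uk)}{2q},\ fk\right\rangle .\] (Here $\mathbb Z\langle\cdots\rangle$ denotes the $\mathbb Z$-span.) Then the four listed elements form a $\mathbb Z$-basis of $\mathcal O$, and $\mathcal O$ is an order of level $N=p^r$. That is: at every prime $\ell\ne p$ the completion $\mathcal O_\ell$ is an Eichler order of level $\ell^{v_\ell(N)}=1$, i.e. conjugate to $M_2(\mathbb Z_\ell)$; and at $p$, the completion is a residually inert order of level $p^r$, i.e. $\mathcal O_p=\mathfrak o_K+\mathfrak P^{r-1}$ for a quadratic extension $K$ of $\mathbb Q_p$ contained in the algebra ($r$ being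 odd if $K$ is unramified), where $\mathfrak P$ is the maximal ideal of the maximal order at $p$. The reduced discriminant of $\mathcal O$ is $p^r$. -/

import Mathlib

open scoped TensorProduct Quaternion

/-- `B` is a quaternion algebra over `ℚ`: a four-dimensional central simple `ℚ`-algebra. -/
def IsQuaternionAlgebra (B : Type*) [Ring B] [Algebra ℚ B] : Prop :=
  Algebra.IsCentral ℚ B ∧ IsSimpleRing B ∧ Module.finrank ℚ B = 4

/-- Every nonzero element is invertible. -/
def IsDivision (D : Type*) [Ring D] : Prop :=
  Nontrivial D ∧ ∀ x : D, x ≠ 0 → IsUnit x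

/-- `B` is definite: it is ramified at the infinite place, i.e. `B ⊗ ℝ` is a division algebra. -/
def IsDefinite (B : Type*) [Ring B] [Algebra ℚ B] : Prop :=
  IsDivision (ℝ ⊗[ℚ] B)

/-- `B` is ramified at the prime `l`: the completion `B ⊗ ℚ_l` is a division algebra. -/
def IsRamifiedAt (B : Type*) [Ring B] [Algebra ℚ B] (l : ℕ) [Fact l.Prime] : Prop :=
  IsDivision (ℚ_[l] ⊗[ℚ] B)

/-- The discriminant `Δ_B` of a quaternion algebra over `ℚ`: the product of the finitely many
primes at which `B` is ramified. -/
noncomputable def discriminant (B : Type*) [Ring B] [Algebra ℚ B] : ℕ :=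
  ∏ᶠ l : {l : Nat.Primes // haveI : Fact (l : ℕ).Prime := ⟨l.2⟩; IsRamifiedAt B (l : ℕ)},
    ((l : Nat.Primes) : ℕ)

/-- The algebra `(a, b / F)` over a field `F`, for integers `a` and `b`: it has the basis
`1, i, j, k` with `i² = a`, `j² = b`, `ij = -ji = k`. The element `⟨s, t, u, v⟩` is
`s + t i + u j + v k`. -/
abbrev Quat (F : Type*) [Field F] (a b : ℤ) : Type _ := ℍ[F, (a : F), (b : F)]

/-- The reduced norm `x x̄`. -/
def Quat.nrd {F : Type*} [Field F] {a b : ℤ} (x : Quat F a b) : F := (x * star x).re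

/-- The reduced trace `x + x̄`. -/
def Quat.trd {F : Type*} [Field F] {a b : ℤ} (x : Quat F a b) : F := (x + star x).re

/-- The embedding of `(a, b / ℚ)` in its completion `(a, b / ℚ_l)` at `l`. -/
noncomputable def Quat.toLocal {a b : ℤ} (l : ℕ) [Fact l.Prime] (x : Quat ℚ a b) : Quat ℚ_[l] a b :=
  ⟨(x.re : ℚ_[l]), (x.imI : ℚ_[l]), (x.imJ : ℚ_[l]), (x.imK : ℚ_[l])⟩

/-- A `ℤ`-submodule `O` of `(a, b / ℚ)` is an order: a subring (with `1`) that is a full lattice. -/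
structure IsOrder {a b : ℤ} (O : Submodule ℤ (Quat ℚ a b)) : Prop where
  one_mem : (1 : Quat ℚ a b) ∈ O
  mul_mem : ∀ x ∈ O, ∀ y ∈ O, x * y ∈ O
  fg : O.FG
  span_eq_top : Submodule.span ℚ (O : Set (Quat ℚ a b)) = ⊤

/-- The completion `O_l = O ⊗ ℤ_l`, as the `ℤ_l`-span of `O` in `(a, b / ℚ_l)`. -/
noncomputable def localization {a b : ℤ} (O : Submodule ℤ (Quat ℚ a b)) (l : ℕ) [Fact l.Prime] :
    Submodule ℤ_[l] (Quat ℚ_[l] a b) :=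
  Submodule.span ℤ_[l] (Quat.toLocal l '' (O : Set (Quat ℚ a b)))

/-- `L` is an Eichler order of level `l ^ v`: under some isomorphism of `(a, b / ℚ_l)` with the
`2 × 2` matrices over `ℚ_l`, it is the ring of matrices over `ℤ_l` whose lower left entry lies
in `l ^ v ℤ_l`. -/
def IsLocalEichler {a b : ℤ} {l : ℕ} [Fact l.Prime] (L : Submodule ℤ_[l] (Quat ℚ_[l] a b))
    (v : ℕ) : Prop :=
  ∃ φ : Quat ℚ_[l] a b ≃ₐ[ℚ_[l]] Matrix (Fin 2) (Fin 2) ℚ_[l],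
    ∀ x, x ∈ L ↔ (∀ m n, ‖φ x m n‖ ≤ 1) ∧ ‖φ x 1 0‖ ≤ ‖(l : ℚ_[l]) ^ v‖

/-- `L` is a residually inert (special) order of level `l ^ v` in the division algebra
`(a, b / ℚ_l)`: one has `v ≥ 1` and `L = 𝔬_K + 𝔓 ^ (v - 1)` for a quadratic field extension `K` of
`ℚ_l` inside the algebra, with `v` odd if `K` is unramified. Here `𝔬_K` consists of the integral
elements of `K`, the maximal order consists of all integral elements, and `𝔓 ^ m` consists of
those whose reduced norm lies in `l ^ m ℤ_l`; the field `K` is ramified iff one of its elements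
has a uniformizer of `ℚ_l` as its norm. -/
def IsLocalResiduallyInert {a b : ℤ} {l : ℕ} [Fact l.Prime]
    (L : Submodule ℤ_[l] (Quat ℚ_[l] a b)) (v : ℕ) : Prop :=
  IsDivision (Quat ℚ_[l] a b) ∧ 1 ≤ v ∧
    ∃ K : Subalgebra ℚ_[l] (Quat ℚ_[l] a b), Module.finrank ℚ_[l] K = 2 ∧
      (Odd v ∨ ∃ x ∈ K, ‖Quat.nrd x‖ = ‖(l : ℚ_[l])‖) ∧
      ∀ x, x ∈ L ↔ ∃ y z : Quat ℚ_[l] a b, y ∈ K ∧ IsIntegral ℤ_[l] y ∧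
        IsIntegral ℤ_[l] z ∧ ‖Quat.nrd z‖ ≤ ‖(l : ℚ_[l]) ^ (v - 1)‖ ∧ x = y + z

/-- The order `O` of `(a, b / ℚ)` has level `N`: with `v = v_l(N)`, its completion at each prime
`l` is residually inert of level `l ^ v` if the algebra is ramified at `l`, and Eichler of level
`l ^ v` if the algebra is split at `l`. -/
def HasLevel {a b : ℤ} (O : Submodule ℤ (Quat ℚ a b)) (N : ℕ) : Prop :=
  IsOrder O ∧ N ≠ 0 ∧ ∀ (l : ℕ) [Fact l.Prime],
    (IsDivision (Quat ℚ_[l] a b) →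
      IsLocalResiduallyInert (localization O l) (padicValNat l N)) ∧
    (¬ IsDivision (Quat ℚ_[l] a b) →
      IsLocalEichler (localization O l) (padicValNat l N))

/-- The family `e` is a `ℤ`-basis of a lattice of reduced discriminant `N`, that is,
`|det (trd (e_m e_n))| = N²`. -/
def IsBasisOfReducedDiscriminant {a b : ℤ} (e : Fin 4 → Quat ℚ a b) (N : ℕ) : Prop :=
  LinearIndependent ℤ e ∧
    |(Matrix.of fun m n : Fin 4 => Quat.trd (e m * e n)).det| = (N : ℚ) ^ 2

/-- The conditions on the auxiliary prime `q`. -/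
def IsAuxiliaryPrime (p q : ℕ) : Prop :=
  q.Prime ∧
    (p % 4 = 1 → ¬ IsSquare (q : ZMod p) ∧ q % 4 = 3) ∧
    (p % 4 = 3 → IsSquare (q : ZMod p) ∧ q % 8 = 1)

/-- The integer `a`. -/
def coeffA (p r q : ℕ) : ℤ :=
  if p % 4 = 1 then (if Odd r then -(q : ℤ) else -((q : ℤ) * p)) else -(p : ℤ)

/-- The integer `b`. -/
def coeffB (p q : ℕ) : ℤ :=
  if p % 4 = 1 then -(p : ℤ) else -(q : ℤ)

/-- `f = p ^ n` if `r = 2 n + 1`, and `f = p ^ (n - 1)` if `r = 2 n`. -/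
def conductorF (p r : ℕ) : ℕ :=
  if Odd r then p ^ ((r - 1) / 2) else p ^ (r / 2 - 1)

/-- `h = 1` if `r` is odd, and `h = p ^ (1 - v_p(b))` if `r` is even. -/
def conductorH (p r q : ℕ) : ℕ :=
  if Odd r then 1 else p ^ (1 - padicValInt p (coeffB p q))

/-- `(q + i + 2zk) / 2q, (2i + z'k) / 2q, f(j + k) / 2, fk`. -/
def basisOne {a b : ℤ} (q f : ℕ) (z z' : ℤ) : Fin 4 → Quat ℚ a b :=
  ![⟨q / (2 * q), 1 / (2 * q), 0, 2 * z / (2 * q)⟩,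
    ⟨0, 2 / (2 * q), 0, z' / (2 * q)⟩,
    ⟨0, 0, f / 2, f / 2⟩,
    ⟨0, 0, 0, f⟩]

/-- `1, (1 + i) / 2, fh(j + uk) / 2q, fk`. -/
def basisThree {a b : ℤ} (q f h : ℕ) (u : ℤ) : Fin 4 → Quat ℚ a b :=
  ![⟨1, 0, 0, 0⟩,
    ⟨1 / 2, 1 / 2, 0, 0⟩,
    ⟨0, 0, f * h / (2 * q), f * h * u / (2 * q)⟩,
    ⟨0, 0, 0, f⟩]

/-! The proof works with lattices throughout and never computes a Hilbert symbol.

The order. After a unimodular change of basis $\mathcal O$ is spanned by $1$, $\tfrac12+\rho(i+tk)$,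
$\sigma j+\tau k$, $\varphi k$ (`triangularFamily`). By Bézout $z$ (respectively $w$) is inverse to
$2x$ modulo $q$, so $x^2\equiv -p$ gives $q\mid 4pz^2+1$ (respectively $q\mid pu^2+1$). Together
with the congruences modulo 4 this makes all traces, norms and structure constants integral
(`isOrderBasis_one`, `isOrderBasis_three`), and the Gram determinant gives reduced discriminant
$p^r$.

Primes $\ell\ne p$. The trace form of $\mathcal O_\ell$ is unimodular. Chevalley–Warning and Hensel
produce a null vector, and unimodularity turns it into matrix units inside $\mathcal O_\ell$, so
$\mathcal O_\ell\cong M_2(\mathbb Z_\ell)$ (`IsUnimodularOrder.isLocalEichler`). In particular the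
algebra splits at $\ell$.

The prime $p$. Since $-q$ is a nonsquare modulo $p$, the norm form is $s^2+qt^2+p(u^2+qv^2)$ in
suitable coordinates, and its terms cannot cancel (`HasDiagonalNorm`). Hence the algebra is division
at $p$, integrality and the powers of $\mathfrak P$ are read off coordinate by coordinate, and
$\mathcal O_p=\mathfrak o_K+\mathfrak P^{r-1}$ with $K=\mathbb Q_p(i+tk)$. With the splitting at all
other primes and $a,b<0$, the algebra is definite of discriminant $p$.

Uniqueness. A definite $B$ has no zero divisors, so it has a presentation $(c,d)$. Among the
integral ternary models of the norm form on its pure quaternions take one of least discriminant.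
Minimality forces discriminant $p^2$ and reduction $Cz^2$ modulo $p$ with $-C$ a nonsquare
(`exists_adapted`). Two such models $f,g$ can be glued along their reductions into a lattice of rank
6 on which $p\mid f-g$. Minkowski's theorem gives a nonzero vector with $f,g<p$, hence $f=g$: the
algebras share an $i$ (`exists_common_norm`). A second application, with cylinders instead of balls,
gives a common $j$ orthogonal to $i$ (`exists_common_norm_orthogonal`), and so an isomorphism. -/

/-! ### Norm forms, division and base change of quaternion algebras -/

/-- The reduced norm form of `(a, b / F)` in the coordinates `1, i, j, k`. -/
def quatNorm {F : Type*} [Field F] {a b : F} (x : ℍ[F, a, b]) : F :=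
  x.re ^ 2 - a * x.imI ^ 2 - b * x.imJ ^ 2 + a * b * x.imK ^ 2

theorem quat_mul_star {F : Type*} [Field F] {a b : F} (x : ℍ[F, a, b]) :
    x * star x = algebraMap F _ (quatNorm x) := by
  ext <;> simp [quatNorm, QuaternionAlgebra.algebraMap_eq] <;> ring

theorem quat_star_mul {F : Type*} [Field F] {a b : F} (x : ℍ[F, a, b]) :
    star x * x = algebraMap F _ (quatNorm x) := by
  ext <;> simp [quatNorm, QuaternionAlgebra.algebraMap_eq] <;> ring

theorem quatNorm_mul {F : Type*} [Field F] {a b : F} (x y : ℍ[F, a, b]) :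
    quatNorm (x * y) = quatNorm x * quatNorm y := by
  simp [quatNorm]; ring

theorem quat_isUnit_of_norm_ne_zero {F : Type*} [Field F] {a b : F} {x : ℍ[F, a, b]}
    (h : quatNorm x ≠ 0) : IsUnit x := by
  refine ⟨⟨x, (quatNorm x)⁻¹ • star x, ?_, ?_⟩, rfl⟩
  · rw [mul_smul_comm, quat_mul_star, Algebra.algebraMap_eq_smul_one, smul_smul,
      inv_mul_cancel₀ h, one_smul]
  · rw [smul_mul_assoc, quat_star_mul, Algebra.algebraMap_eq_smul_one, smul_smul,
      inv_mul_cancel₀ h, one_smul]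

theorem isDivision_quat_iff {F : Type*} [Field F] {a b : F} :
    IsDivision ℍ[F, a, b] ↔ ∀ x : ℍ[F, a, b], quatNorm x = 0 → x = 0 := by
  constructor
  · rintro ⟨-, h⟩ x hx
    by_contra h0
    have h1 := quat_mul_star x
    rw [hx, map_zero] at h1
    have h2 : star x = 0 := by simpa using (h x h0).mul_right_eq_zero.1 h1
    exact h0 (by simpa using h2)
  · intro h
    exact ⟨inferInstance, fun x hx => quat_isUnit_of_norm_ne_zero fun h0 => hx (h x h0)⟩

theorem IsDivision.of_ringEquiv {D E : Type*} [Ring D] [Ring E] (e : D ≃+* E)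
    (h : IsDivision D) : IsDivision E := by
  obtain ⟨h1, h2⟩ := h
  refine ⟨e.symm.toEquiv.nontrivial, fun x hx => ?_⟩
  have := h2 (e.symm x) (by simpa using hx)
  simpa using this.map e

theorem IsDivision.isDomain {D : Type*} [Ring D] (h : IsDivision D) : IsDomain D := by
  have := h.1
  have : NoZeroDivisors D := ⟨fun {x y} hxy => by
    by_cases hx : x = 0
    · exact .inl hx
    · exact .inr ((h.2 x hx).mul_right_eq_zero.1 hxy)⟩
  exact NoZeroDivisors.to_isDomain D

/-- A pair of nonzero anticommuting elements with central squares in a four-dimensional algebra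
without zero divisors identifies it with a quaternion algebra. -/
theorem nonempty_quat_equiv_of_anticommute {F B : Type*} [Field F] [CharZero F] [Ring B]
    [IsDomain B] [Algebra F B] (hB : Module.finrank F B = 4) {c d : F} {i j : B}
    (hi : i * i = algebraMap F B c) (hj : j * j = algebraMap F B d) (hij : i * j = -(j * i))
    (hi0 : i ≠ 0) (hj0 : j ≠ 0) : Nonempty (ℍ[F, c, d] ≃ₐ[F] B) := by
  have : FiniteDimensional F B := Module.finite_of_finrank_pos (by omega)
  have : CharZero B := charZero_of_injective_algebraMap (algebraMap F B).injective
  let q : QuaternionAlgebra.Basis B c 0 d :=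
    { i := i, j := j, k := i * j
      i_mul_i := by rw [hi, Algebra.algebraMap_eq_smul_one]; simp
      j_mul_j := by rw [hj, Algebra.algebraMap_eq_smul_one]
      i_mul_j := rfl
      j_mul_i := by rw [hij]; simp }
  -- Left and right multiplication by `j` differ only in the sign of the `i`-term, so both
  -- coefficients vanish.
  have key : ∀ α β : F, algebraMap F B α + β • i = 0 → α = 0 ∧ β = 0 := by
    intro α β h
    have h1 : j * (algebraMap F B α + β • i) = 0 := by rw [h, mul_zero]
    have h2 : (algebraMap F B α + β • i) * j = 0 := by rw [h, zero_mul]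
    have h3 : j * i = - (i * j) := by rw [hij, neg_neg]
    rw [mul_add, mul_smul_comm, h3, ← Algebra.commutes] at h1
    rw [add_mul, smul_mul_assoc] at h2
    have h4 : (2 * β) • (i * j) = 0 := by
      rw [mul_smul, two_smul]
      calc _ = (algebraMap F B α * j + β • (i * j)) - (algebraMap F B α * j + β • -(i * j)) := by
            rw [smul_neg]; abel
        _ = 0 := by rw [h1, h2, sub_zero]
    have h5 : β = 0 := by
      rcases smul_eq_zero.1 h4 with h | h
      · simpa using h
      · exact absurd h (mul_ne_zero hi0 hj0)
    subst h5
    simpa using h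
  have hinj : Function.Injective q.liftHom := by
    rw [injective_iff_map_eq_zero]
    intro x hx
    have e : q.liftHom x =
        (algebraMap F B x.re + x.imI • i) + (algebraMap F B x.imJ + x.imK • i) * j := by
      change q.lift x = _
      simp only [QuaternionAlgebra.Basis.lift, add_mul, smul_mul_assoc]
      rw [← Algebra.smul_def x.imJ j, ← add_assoc]
    -- `P` and `Q` lie in `F[i]`: `P` commutes with `i`, while `Q * j` anticommutes with it.
    -- Comparing left and right multiplication by `i` separates the two.
    set P := algebraMap F B x.re + x.imI • i with hP
    set Q := algebraMap F B x.imJ + x.imK • i with hQ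
    rw [hx] at e
    have hPi : i * P = P * i := by
      rw [hP, mul_add, add_mul, mul_smul_comm, smul_mul_assoc, Algebra.commutes]
    have hQi : i * Q = Q * i := by
      rw [hQ, mul_add, add_mul, mul_smul_comm, smul_mul_assoc, Algebra.commutes]
    have e1 : i * (P + Q * j) = 0 := by rw [← e, mul_zero]
    have e2 : (P + Q * j) * i = 0 := by rw [← e, zero_mul]
    have h3 : j * i = - (i * j) := by rw [hij, neg_neg]
    have e3 : i * P + Q * i * j = 0 := by have := e1; rwa [mul_add, ← mul_assoc i Q j, hQi] at this
    have e4 : i * P - Q * i * j = 0 := by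
      have := e2
      rwa [add_mul, mul_assoc Q j i, h3, ← hPi, mul_neg, ← mul_assoc, ← sub_eq_add_neg] at this
    have e5 : 2 * (i * P) = 0 := by
      calc _ = (i * P + Q * i * j) + (i * P - Q * i * j) := by rw [two_mul]; abel
        _ = 0 := by rw [e3, e4, add_zero]
    have hP0 : P = 0 := by
      rcases mul_eq_zero.1 e5 with h | h
      · exact absurd h two_ne_zero
      · exact (mul_eq_zero.1 h).resolve_left hi0
    have hQ0 : Q = 0 := by
      rw [hP0, zero_add] at e
      exact (mul_eq_zero.1 e.symm).resolve_right hj0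
    obtain ⟨h1, h2⟩ := key _ _ hP0
    obtain ⟨h4, h5⟩ := key _ _ hQ0
    ext <;> assumption
  exact ⟨AlgEquiv.ofBijective q.liftHom ⟨hinj, (LinearMap.injective_iff_surjective_of_finrank_eq_finrank
    (f := q.liftHom.toLinearMap) (by rw [hB, QuaternionAlgebra.finrank_eq_four])).1 hinj⟩⟩

/-- Base change of a quaternion algebra. -/
theorem nonempty_baseChange_quat_equiv (K : Type*) [Field K] [CharZero K] [Algebra ℚ K] (c d : ℚ) :
    Nonempty (K ⊗[ℚ] ℍ[ℚ, c, d] ≃ₐ[K] ℍ[K, (c : K), (d : K)]) := by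
  have hr : ∀ r : ℚ, algebraMap ℚ K r = (r : K) := fun r => eq_ratCast _ r
  let q : QuaternionAlgebra.Basis ℍ[K, (c : K), (d : K)] c 0 d :=
    { i := ⟨0, 1, 0, 0⟩, j := ⟨0, 0, 1, 0⟩, k := ⟨0, 0, 0, 1⟩
      i_mul_i := by ext <;> simp <;> simp [Algebra.smul_def, hr]
      j_mul_j := by ext <;> simp <;> simp [Algebra.smul_def, hr]
      i_mul_j := by ext <;> simp
      j_mul_i := by ext <;> simp }
  let φ : K ⊗[ℚ] ℍ[ℚ, c, d] →ₐ[K] ℍ[K, (c : K), (d : K)] :=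
    Algebra.TensorProduct.lift (Algebra.ofId K _) q.liftHom (fun x y => Algebra.commutes x _)
  have hs : Function.Surjective φ := by
    intro x
    refine ⟨x.re ⊗ₜ 1 + x.imI ⊗ₜ ⟨0, 1, 0, 0⟩ + x.imJ ⊗ₜ ⟨0, 0, 1, 0⟩ + x.imK ⊗ₜ ⟨0, 0, 0, 1⟩, ?_⟩
    have hφ : ∀ s t, φ (s ⊗ₜ t) = algebraMap K _ s * q.lift t := fun s t =>
      Algebra.TensorProduct.lift_tmul ..
    simp only [map_add, hφ]
    ext <;> simp [q, QuaternionAlgebra.Basis.lift, QuaternionAlgebra.algebraMap_eq]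
  exact ⟨AlgEquiv.ofBijective φ ⟨(LinearMap.injective_iff_surjective_of_finrank_eq_finrank
    (f := φ.toLinearMap) (by rw [Module.finrank_baseChange, QuaternionAlgebra.finrank_eq_four,
      QuaternionAlgebra.finrank_eq_four])).2 hs, hs⟩⟩

theorem isDivision_baseChange_quat_iff (K : Type*) [Field K] [CharZero K] [Algebra ℚ K] (c d : ℚ) :
    IsDivision (K ⊗[ℚ] ℍ[ℚ, c, d]) ↔ IsDivision ℍ[K, (c : K), (d : K)] := by
  obtain ⟨e⟩ := nonempty_baseChange_quat_equiv K c d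
  exact ⟨fun h => h.of_ringEquiv e.toRingEquiv, fun h => h.of_ringEquiv e.symm.toRingEquiv⟩

/-- The norm form on pure quaternions. -/
def pureNorm {F : Type*} [Field F] (a b x y z : F) : F := -a * x ^ 2 - b * y ^ 2 + a * b * z ^ 2

theorem pureNorm_anisotropic_of_isDivision {F : Type*} [Field F] {a b : F}
    (h : IsDivision ℍ[F, a, b]) {x y z : F} (h0 : pureNorm a b x y z = 0) :
    x = 0 ∧ y = 0 ∧ z = 0 := by
  have := isDivision_quat_iff.1 h ⟨0, x, y, z⟩ (by
    simp only [quatNorm, pureNorm] at *; linear_combination h0)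
  simpa [QuaternionAlgebra.ext_iff] using this

theorem exists_pureNorm_eq_zero_of_not_isDivision {F : Type*} [Field F] [CharZero F] {a b : F}
    (hb : b ≠ 0) (h : ¬ IsDivision ℍ[F, a, b]) :
    ∃ x y z : F, (x ≠ 0 ∨ y ≠ 0 ∨ z ≠ 0) ∧ pureNorm a b x y z = 0 := by
  rw [isDivision_quat_iff] at h
  push Not at h
  obtain ⟨w, hw, hw0⟩ := h
  -- products of `w` with elements of the algebra are null; find a nonzero pure one
  have main : ∀ y : ℍ[F, a, b], (w * y).re = 0 → w * y ≠ 0 →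
      ∃ x y z : F, (x ≠ 0 ∨ y ≠ 0 ∨ z ≠ 0) ∧ pureNorm a b x y z = 0 := by
    intro y hy hne
    refine ⟨(w * y).imI, (w * y).imJ, (w * y).imK, ?_, ?_⟩
    · by_contra! hc
      exact hne (by ext <;> simp only [QuaternionAlgebra.re_zero, QuaternionAlgebra.imI_zero,
        QuaternionAlgebra.imJ_zero, QuaternionAlgebra.imK_zero, hy, hc])
    · have : quatNorm (w * y) = 0 := by rw [quatNorm_mul, hw, zero_mul]
      simp only [quatNorm, hy] at this
      simp only [pureNorm]; linear_combination this
  by_cases hre : w.re = 0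
  · exact main 1 (by simpa using hre) (by simpa using hw0)
  by_contra hcon
  -- Both multipliers are chosen to make the product pure. If both products vanish, their
  -- coordinates force `w.re = 0`.
  have h1 : w * ⟨a * w.imI, -w.re, 0, 0⟩ = 0 := by
    by_contra hne; exact hcon (main _ (by simp; ring) hne)
  have h2 : w * ⟨b * w.imJ, 0, -w.re, 0⟩ = 0 := by
    by_contra hne; exact hcon (main _ (by simp; ring) hne)
  simp only [QuaternionAlgebra.ext_iff, QuaternionAlgebra.re_mul, QuaternionAlgebra.imI_mul,
    QuaternionAlgebra.imJ_mul, QuaternionAlgebra.imK_mul, QuaternionAlgebra.re_zero,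
    QuaternionAlgebra.imI_zero, QuaternionAlgebra.imJ_zero, QuaternionAlgebra.imK_zero] at h1 h2
  obtain ⟨-, h11, h12, h13⟩ := h1
  obtain ⟨-, h21, h22, h23⟩ := h2
  have e1 : w.re ^ 2 = a * w.imI ^ 2 := by linear_combination -h11
  have e2 : w.re * w.imK = w.imI * w.imJ :=
    mul_left_cancel₀ hb (by linear_combination -h21)
  have e3 : a * w.imI * w.imK = - w.re * w.imJ := by linear_combination h13
  have e5 : w.imJ * w.re ^ 2 = 0 := by
    linear_combination (1/2) * w.imJ * e1 + (1/2) * w.re * e3 - (1/2) * a * w.imI * e2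
  have e6 : w.re ^ 2 = b * w.imJ ^ 2 := by linear_combination -h22
  have e7 : w.imJ = 0 := by simpa [hre] using e5
  exact hre (by simpa [e7] using e6)

/-! ### Presentations of abstract definite algebras, and the discriminant -/

theorem IsDivision.baseChange_congr {A B : Type*} [Ring A] [Ring B] [Algebra ℚ A] [Algebra ℚ B]
    (e : A ≃ₐ[ℚ] B) (K : Type*) [Field K] [Algebra ℚ K] (h : IsDivision (K ⊗[ℚ] A)) :
    IsDivision (K ⊗[ℚ] B) :=
  h.of_ringEquiv (Algebra.TensorProduct.congr (AlgEquiv.refl (R := ℚ) (A₁ := K)) e).toRingEquiv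

theorem isDomain_of_isDivision_baseChange {B : Type*} [Ring B] [Algebra ℚ B] {K : Type*} [Field K]
    [Algebra ℚ K] (h : IsDivision (K ⊗[ℚ] B)) : IsDomain B := by
  have := h.isDomain
  have hinj : Function.Injective (Algebra.TensorProduct.includeRight : B →ₐ[ℚ] K ⊗[ℚ] B) :=
    Algebra.TensorProduct.includeRight_injective (algebraMap ℚ K).injective
  exact hinj.isDomain (Algebra.TensorProduct.includeRight : B →ₐ[ℚ] K ⊗[ℚ] B).toRingHom

/-- In a four-dimensional central algebra without zero divisors every non-scalar element is
quadratic. -/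
theorem exists_quadratic_of_finrank_four {F B : Type*} [Field F] [Ring B] [IsDomain B] [Algebra F B]
    [Algebra.IsCentral F B] (hB : Module.finrank F B = 4) {x : B}
    (hx : x ∉ (algebraMap F B).range) :
    ∃ s t : F, x * x + s • x + algebraMap F B t = 0 := by
  have : FiniteDimensional F B := Module.finite_of_finrank_pos (by omega)
  have hcomm : ∃ y, x * y ≠ y * x := by
    by_contra! h
    have : x ∈ Subalgebra.center F B := Subalgebra.mem_center_iff.2 fun y => (h y).symm
    exact hx ((Algebra.IsCentral.mem_center_iff F).1 this |>.imp fun a ha => ha.symm)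
  obtain ⟨y, hy⟩ := hcomm
  -- Five elements in dimension four. The relation reads `P + y * Q = 0` with `P`, `Q` polynomials
  -- in `x`; commuting it with `x` leaves `(x * y - y * x) * Q = 0`, so `Q = 0`, and `P = 0` is the
  -- quadratic relation.
  have hdep : ¬ LinearIndependent F ![1, x, x * x, y, y * x] := fun h => by
    have := h.fintype_card_le_finrank
    simp [hB] at this
  rw [Fintype.not_linearIndependent_iff] at hdep
  obtain ⟨g, hg, i, hi⟩ := hdep
  simp only [Fin.sum_univ_five] at hg
  simp only [Matrix.cons_val] at hg
  set P := g 0 • (1 : B) + g 1 • x + g 2 • (x * x) with hP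
  have hPx : x * P = P * x := by
    simp only [hP, mul_add, add_mul, mul_smul_comm, smul_mul_assoc, mul_one, one_mul, mul_assoc]
  have e : P + y * (g 3 • (1 : B) + g 4 • x) = 0 := by
    rw [← hg, hP, mul_add, mul_smul_comm, mul_smul_comm, mul_one]; abel
  set Q := g 3 • (1 : B) + g 4 • x with hQ
  have hQx : x * Q = Q * x := by
    simp only [hQ, mul_add, add_mul, mul_smul_comm, smul_mul_assoc, mul_one, one_mul]
  have hsc : ∀ s t : F, s • (1 : B) + t • x = 0 → s = 0 ∧ t = 0 := by
    intro s t h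
    by_cases ht : t = 0
    · subst ht; simpa using h
    · exfalso; apply hx
      refine ⟨-(t⁻¹ * s), ?_⟩
      have : t • x = -(s • (1 : B)) := by rw [eq_neg_iff_add_eq_zero, add_comm, h]
      rw [map_neg, Algebra.algebraMap_eq_smul_one, mul_smul, ← smul_neg, ← this, smul_smul,
        inv_mul_cancel₀ ht, one_smul]
  have hQ0 : Q = 0 := by
    by_contra hQ0
    apply hy
    have h1 : (x * y - y * x) * Q = 0 := by
      have e1 : x * (P + y * Q) = 0 := by rw [e, mul_zero]
      have e2 : (P + y * Q) * x = 0 := by rw [e, zero_mul]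
      calc _ = x * (P + y * Q) - (P + y * Q) * x := by
            rw [sub_mul, mul_add x, add_mul P, hPx, mul_assoc y Q x, ← hQx, ← mul_assoc x, ← mul_assoc y x]
            abel
        _ = 0 := by rw [e1, e2, sub_zero]
    exact sub_eq_zero.1 ((mul_eq_zero.1 h1).resolve_right hQ0)
  obtain ⟨h3, h4⟩ := hsc _ _ hQ0
  have hP0 : P = 0 := by rwa [hQ0, mul_zero, add_zero] at e
  have h2 : g 2 ≠ 0 := by
    intro h2
    rw [hP, h2, zero_smul, add_zero] at hP0
    obtain ⟨h0, h1⟩ := hsc _ _ hP0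
    fin_cases i
    exacts [hi h0, hi h1, hi h2, hi h3, hi h4]
  refine ⟨(g 2)⁻¹ * g 1, (g 2)⁻¹ * g 0, ?_⟩
  have := congrArg (fun z => (g 2)⁻¹ • z) hP0
  simp only [hP, smul_add, smul_smul, inv_mul_cancel₀ h2, one_smul, smul_zero] at this
  rw [Algebra.algebraMap_eq_smul_one, ← this]; abel

/-- A non-scalar element with scalar square is part of a quaternion basis. -/
theorem exists_quat_equiv_of_sq {B : Type*} [Ring B] [IsDomain B] [Algebra ℚ B]
    [Algebra.IsCentral ℚ B] (hB : Module.finrank ℚ B = 4) {i : B} {c : ℚ}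
    (hi : i * i = algebraMap ℚ B c) (hir : i ∉ (algebraMap ℚ B).range) :
    ∃ d : ℚ, Nonempty (ℍ[ℚ, c, d] ≃ₐ[ℚ] B) := by
  have : FiniteDimensional ℚ B := Module.finite_of_finrank_pos (by omega)
  have hch : CharZero B := charZero_of_injective_algebraMap (algebraMap ℚ B).injective
  have hcomm : ∃ y, i * y ≠ y * i := by
    by_contra! h
    have : i ∈ Subalgebra.center ℚ B := Subalgebra.mem_center_iff.2 fun y => (h y).symm
    exact hir ((Algebra.IsCentral.mem_center_iff ℚ).1 this |>.imp fun a ha => ha.symm)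
  obtain ⟨y, hy⟩ := hcomm
  -- Because `i * i` is central, a commutator with `i` anticommutes with `i`.
  set j := i * y - y * i with hj
  have hj0 : j ≠ 0 := sub_ne_zero.2 hy
  have hi0 : i ≠ 0 := fun h => hir ⟨0, by simp [h]⟩
  have hij : i * j = -(j * i) := by
    rw [hj, mul_sub, sub_mul, ← mul_assoc, hi, mul_assoc y, hi, ← Algebra.commutes c y, mul_assoc]
    abel
  have hjr : j ∉ (algebraMap ℚ B).range := by
    rintro ⟨r, hr⟩
    rw [← hr, ← Algebra.commutes, eq_neg_iff_add_eq_zero, ← two_mul] at hij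
    rcases mul_eq_zero.1 hij with h | h
    · exact two_ne_zero h
    · rcases mul_eq_zero.1 h with h | h
      · exact hj0 (hr ▸ h)
      · exact hi0 h
  obtain ⟨s', t', hst'⟩ := exists_quadratic_of_finrank_four hB hjr
  -- `j * j` commutes with `i` and `j` anticommutes with it, so the linear term in the quadratic
  -- equation of `j` must vanish.
  have hs' : s' = 0 := by
    have h1 : i * (j * j) = (j * j) * i := by
      rw [← mul_assoc, hij, neg_mul, mul_assoc, hij, mul_neg, neg_neg, mul_assoc]
    have h2 : (2 * s') • (i * j) = 0 := by
      have e1 : i * (j * j + s' • j + algebraMap ℚ B t') = 0 := by rw [hst', mul_zero]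
      have e2 : (j * j + s' • j + algebraMap ℚ B t') * i = 0 := by rw [hst', zero_mul]
      have h3 : j * i = - (i * j) := by rw [hij, neg_neg]
      rw [mul_add, mul_add, mul_smul_comm, h1, ← Algebra.commutes] at e1
      rw [add_mul, add_mul, smul_mul_assoc, h3, smul_neg] at e2
      rw [mul_smul, two_smul, ← sub_zero 0]
      nth_rw 1 [← e1]
      rw [← e2]; abel
    rcases smul_eq_zero.1 h2 with h | h
    · simpa using h
    · exact absurd h (mul_ne_zero hi0 hj0)
  refine ⟨-t', nonempty_quat_equiv_of_anticommute hB hi ?_ hij hi0 hj0⟩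
  rw [hs', zero_smul, add_zero] at hst'
  rw [map_neg, eq_neg_iff_add_eq_zero, hst']

theorem exists_quat_equiv_of_isDomain {B : Type*} [Ring B] [IsDomain B] [Algebra ℚ B]
    [Algebra.IsCentral ℚ B] (hB : Module.finrank ℚ B = 4) :
    ∃ c d : ℚ, Nonempty (ℍ[ℚ, c, d] ≃ₐ[ℚ] B) := by
  have : FiniteDimensional ℚ B := Module.finite_of_finrank_pos (by omega)
  obtain ⟨x, hx⟩ : ∃ x : B, x ∉ (algebraMap ℚ B).range := by
    by_contra! h
    have hs : Function.Surjective (Algebra.linearMap ℚ B) := fun x => h x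
    have := LinearMap.finrank_le_finrank_of_surjective hs
    simp [hB] at this
  obtain ⟨s, t, hst⟩ := exists_quadratic_of_finrank_four hB hx
  -- complete the square
  obtain ⟨i, c, hi, hir⟩ : ∃ (i : B) (c : ℚ), i * i = algebraMap ℚ B c ∧
      i ∉ (algebraMap ℚ B).range := by
    refine ⟨x + algebraMap ℚ B (s / 2), s ^ 2 / 4 - t, ?_, fun h => hx ?_⟩
    · have h1 : algebraMap ℚ B (s / 2) * x = (s / 2) • x := (Algebra.smul_def _ _).symm
      have h2 : x * algebraMap ℚ B (s / 2) = (s / 2) • x := by rw [← Algebra.commutes, h1]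
      rw [mul_add, add_mul, add_mul, h1, h2, ← map_mul, map_sub]
      have h3 : x * x = - (s • x) - algebraMap ℚ B t := by
        rw [eq_sub_iff_add_eq, eq_neg_iff_add_eq_zero, ← hst]; abel
      have h4 : s • x = (s / 2) • x + (s / 2) • x := by rw [← add_smul]; congr 1; ring
      have h5 : s ^ 2 / 4 = s / 2 * (s / 2) := by ring
      rw [h3, h4, h5]; abel
    · have := sub_mem h (RingHom.mem_range_self (algebraMap ℚ B) (s / 2))
      simpa using this
  exact ⟨c, exists_quat_equiv_of_sq hB hi hir⟩

theorem neg_of_isDivision_real {c d : ℝ} (h : IsDivision ℍ[ℝ, c, d]) : c < 0 ∧ d < 0 := by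
  rw [isDivision_quat_iff] at h
  constructor
  · by_contra! hc
    have := h ⟨√c, 1, 0, 0⟩ (by simp [quatNorm, Real.sq_sqrt hc])
    simpa using congrArg QuaternionAlgebra.imI this
  · by_contra! hc
    have := h ⟨√d, 0, 1, 0⟩ (by simp [quatNorm, Real.sq_sqrt hc])
    simpa using congrArg QuaternionAlgebra.imJ this

theorem isDivision_real_of_neg {c d : ℝ} (hc : c < 0) (hd : d < 0) : IsDivision ℍ[ℝ, c, d] := by
  rw [isDivision_quat_iff]
  intro x hx
  simp only [quatNorm] at hx
  have hcd := mul_pos_of_neg_of_neg hc hd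
  have h1 := mul_nonneg (neg_nonneg.2 hc.le) (sq_nonneg x.imI)
  have h2 := mul_nonneg (neg_nonneg.2 hd.le) (sq_nonneg x.imJ)
  have h3 := mul_nonneg hcd.le (sq_nonneg x.imK)
  have h0 := sq_nonneg x.re
  ext
  · exact pow_eq_zero_iff two_ne_zero |>.1 (by linarith)
  · have : c * x.imI ^ 2 = 0 := by linarith
    simpa [hc.ne] using this
  · have : d * x.imJ ^ 2 = 0 := by linarith
    simpa [hd.ne] using this
  · have : c * d * x.imK ^ 2 = 0 := by linarith
    simpa [hc.ne, hd.ne] using this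

theorem exists_quat_equiv_of_isDefinite {B : Type*} [Ring B] [Algebra ℚ B]
    (hB : IsQuaternionAlgebra B) (hdef : IsDefinite B) :
    ∃ c d : ℚ, c < 0 ∧ d < 0 ∧ Nonempty (ℍ[ℚ, c, d] ≃ₐ[ℚ] B) := by
  obtain ⟨hc, -, hf⟩ := hB
  have := isDomain_of_isDivision_baseChange hdef
  obtain ⟨c, d, ⟨e⟩⟩ := exists_quat_equiv_of_isDomain hf
  have h1 : IsDivision (ℝ ⊗[ℚ] ℍ[ℚ, c, d]) := IsDivision.baseChange_congr e.symm ℝ hdef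
  obtain ⟨h2, h3⟩ := neg_of_isDivision_real ((isDivision_baseChange_quat_iff ℝ c d).1 h1)
  exact ⟨c, d, by exact_mod_cast h2, by exact_mod_cast h3, ⟨e⟩⟩

theorem isQuaternionAlgebra_quat {c d : ℚ} (hc : c ≠ 0)
    (h : IsDivision ℍ[ℚ, c, d]) : IsQuaternionAlgebra ℍ[ℚ, c, d] := by
  refine ⟨⟨fun x hx => ?_⟩, ⟨⟨fun I => ?_⟩⟩, QuaternionAlgebra.finrank_eq_four _ _ _⟩
  · rw [Subalgebra.mem_center_iff] at hx
    have h1 := hx ⟨0, 1, 0, 0⟩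
    have h2 := hx ⟨0, 0, 1, 0⟩
    simp only [QuaternionAlgebra.ext_iff] at h1 h2
    simp at h1 h2
    refine ⟨x.re, ?_⟩
    have e1 : x.imJ = 0 := by linarith [h1.2]
    have e2 : x.imI = 0 := by linarith [h2]
    have e3 : x.imK = 0 := by
      have : c * x.imK = 0 := by linarith [h1.1]
      simpa [hc] using this
    ext <;> simp [QuaternionAlgebra.algebraMap_eq, e1, e2, e3]
  · by_cases hI : I = ⊥
    · exact .inl hI
    · right
      obtain ⟨x, hx, hx0⟩ : ∃ x ∈ I, x ≠ 0 := by
        by_contra! hcon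
        exact hI (le_bot_iff.1 fun x hx => by simpa using hcon x hx)
      obtain ⟨u, rfl⟩ := h.2 x hx0
      refine le_top.antisymm fun y _ => ?_
      have := I.mul_mem_left (y * ↑u⁻¹) _ hx
      simpa [mul_assoc] using this

theorem isRamifiedAt_quat_iff (c d : ℚ) (l : ℕ) [Fact l.Prime] :
    IsRamifiedAt ℍ[ℚ, c, d] l ↔ IsDivision ℍ[ℚ_[l], (c : ℚ_[l]), (d : ℚ_[l])] :=
  isDivision_baseChange_quat_iff _ c d

/-- Every factor of a finite product of primes equal to `p` is `p`. No ramified prime, or infinitely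
many (where `finprod` takes its default value), would give 1 instead. -/
theorem discriminant_eq_prime_iff {B : Type*} [Ring B] [Algebra ℚ B] {p : ℕ} (hp : p.Prime) :
    discriminant B = p ↔ ∀ (l : ℕ) [Fact l.Prime], IsRamifiedAt B l ↔ l = p := by
  let P : Nat.Primes → Prop := fun l => haveI : Fact (l : ℕ).Prime := ⟨l.2⟩; IsRamifiedAt B (l : ℕ)
  have hdisc : discriminant B = ∏ᶠ l : {l // P l}, ((l : Nat.Primes) : ℕ) := rfl
  constructor
  · intro h
    have hfin : Finite {l // P l} := by
      by_contra hinf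
      rw [not_finite_iff_infinite] at hinf
      have hsup : Function.mulSupport (fun l : {l // P l} => ((l : Nat.Primes) : ℕ)) = Set.univ := by
        ext l; simpa using l.1.2.ne_one
      rw [hdisc, finprod_of_infinite_mulSupport (by rw [hsup]; exact Set.infinite_univ)] at h
      exact hp.ne_one h.symm
    have := Fintype.ofFinite {l // P l}
    rw [hdisc, finprod_eq_prod_of_fintype] at h
    have hdvd : ∀ l : {l // P l}, ((l : Nat.Primes) : ℕ) = p := fun l =>
      (Nat.prime_dvd_prime_iff_eq l.1.2 hp).1 (h ▸ Finset.dvd_prod_of_mem _ (Finset.mem_univ l))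
    intro l hl
    constructor
    · intro hr
      exact hdvd ⟨⟨l, hl.out⟩, hr⟩
    · rintro rfl
      by_contra hr
      have : IsEmpty {l // P l} := ⟨fun m => hr (by
        have e : m.1 = ⟨l, hl.out⟩ := Subtype.ext (hdvd m)
        have := m.2
        rw [e] at this
        exact this)⟩
      simp at h
      exact hp.ne_one h.symm
  · intro h
    have hPp : P ⟨p, hp⟩ := by
      have : Fact p.Prime := ⟨hp⟩
      exact (h p).2 rfl
    have huniq : ∀ l : {l // P l}, l = ⟨⟨p, hp⟩, hPp⟩ := by
      rintro ⟨⟨l, hl⟩, hr⟩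
      have : Fact l.Prime := ⟨hl⟩
      exact Subtype.ext (Subtype.ext ((h l).1 hr))
    have : Unique {l // P l} := ⟨⟨⟨⟨p, hp⟩, hPp⟩⟩, huniq⟩
    rw [hdisc, finprod_unique]
    exact congrArg (fun l : {l // P l} => ((l : Nat.Primes) : ℕ)) (huniq default)

/-! ### Integral ternary models of the norm form and their minimality -/

/-- The integral ternary quadratic form `Ax² + By² + Cz² + Dyz + Exz + Fxy`. -/
structure TernaryForm where
  (A B C D E F : ℤ)

namespace TernaryForm

/-- The value of a form at a vector. -/
def eval {R : Type*} [CommRing R] (f : TernaryForm) (x y z : R) : R :=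
  f.A * x ^ 2 + f.B * y ^ 2 + f.C * z ^ 2 + f.D * (y * z) + f.E * (x * z) + f.F * (x * y)

/-- The half-discriminant. -/
def disc (f : TernaryForm) : ℤ :=
  4 * f.A * f.B * f.C + f.D * f.E * f.F - f.A * f.D ^ 2 - f.B * f.E ^ 2 - f.C * f.F ^ 2

/-- The partial derivatives of a form. -/
def dx {R : Type*} [CommRing R] (f : TernaryForm) (x y z : R) : R := 2 * f.A * x + f.F * y + f.E * z
def dy {R : Type*} [CommRing R] (f : TernaryForm) (x y z : R) : R := f.F * x + 2 * f.B * y + f.D * z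
def dz {R : Type*} [CommRing R] (f : TernaryForm) (x y z : R) : R := f.E * x + f.D * y + 2 * f.C * z

/-- `f` is the norm form of pure quaternions in `(a, b)` on the lattice spanned by the columns of
`M`. -/
def Represents (f : TernaryForm) (a b : ℚ) (M : Matrix (Fin 3) (Fin 3) ℚ) : Prop :=
  M.det ≠ 0 ∧ ∀ x y z : ℚ, f.eval x y z = pureNorm a b
    (M 0 0 * x + M 0 1 * y + M 0 2 * z) (M 1 0 * x + M 1 1 * y + M 1 2 * z)
    (M 2 0 * x + M 2 1 * y + M 2 2 * z)

variable {f g : TernaryForm} {a b : ℚ} {M N : Matrix (Fin 3) (Fin 3) ℚ}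

theorem Represents.coeffs (h : f.Represents a b M) :
    (f.A : ℚ) = pureNorm a b (M 0 0) (M 1 0) (M 2 0) ∧
    (f.B : ℚ) = pureNorm a b (M 0 1) (M 1 1) (M 2 1) ∧
    (f.C : ℚ) = pureNorm a b (M 0 2) (M 1 2) (M 2 2) ∧
    (f.D : ℚ) = -2 * a * M 0 1 * M 0 2 - 2 * b * M 1 1 * M 1 2 + 2 * a * b * M 2 1 * M 2 2 ∧
    (f.E : ℚ) = -2 * a * M 0 0 * M 0 2 - 2 * b * M 1 0 * M 1 2 + 2 * a * b * M 2 0 * M 2 2 ∧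
    (f.F : ℚ) = -2 * a * M 0 0 * M 0 1 - 2 * b * M 1 0 * M 1 1 + 2 * a * b * M 2 0 * M 2 1 := by
  have h1 := h.2 1 0 0
  have h2 := h.2 0 1 0
  have h3 := h.2 0 0 1
  have h4 := h.2 0 1 1
  have h5 := h.2 1 0 1
  have h6 := h.2 1 1 0
  simp only [eval, pureNorm] at *
  refine ⟨?_, ?_, ?_, ?_, ?_, ?_⟩
  · linear_combination h1
  · linear_combination h2
  · linear_combination h3
  · linear_combination h4 - h2 - h3
  · linear_combination h5 - h1 - h3
  · linear_combination h6 - h1 - h2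

/-- The half-discriminant of the diagonal form is $(2ab)^2$, and a change of lattice multiplies it
by a squared determinant. Being always a square, it is divisible by $l^2$ as soon as it is divisible
by $l$. -/
theorem Represents.disc_eq (h : f.Represents a b M) : (f.disc : ℚ) = (2 * a * b * M.det) ^ 2 := by
  obtain ⟨h1, h2, h3, h4, h5, h6⟩ := h.coeffs
  simp only [disc]
  push_cast
  rw [h1, h2, h3, h4, h5, h6, Matrix.det_fin_three]
  simp only [pureNorm]
  ring

theorem Represents.eval_cast (h : f.Represents a b M) {K : Type*} [Field K] [CharZero K]
    (x y z : K) : f.eval x y z = pureNorm (a : K) b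
      (M 0 0 * x + M 0 1 * y + M 0 2 * z) (M 1 0 * x + M 1 1 * y + M 1 2 * z)
      (M 2 0 * x + M 2 1 * y + M 2 2 * z) := by
  obtain ⟨h1, h2, h3, h4, h5, h6⟩ := h.coeffs
  simp only [pureNorm] at h1 h2 h3
  have c1 := congrArg (Rat.cast : ℚ → K) h1
  have c2 := congrArg (Rat.cast : ℚ → K) h2
  have c3 := congrArg (Rat.cast : ℚ → K) h3
  have c4 := congrArg (Rat.cast : ℚ → K) h4
  have c5 := congrArg (Rat.cast : ℚ → K) h5
  have c6 := congrArg (Rat.cast : ℚ → K) h6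
  push_cast at c1 c2 c3 c4 c5 c6
  simp only [eval, pureNorm]
  linear_combination x ^ 2 * c1 + y ^ 2 * c2 + z ^ 2 * c3 + y * z * c4 + x * z * c5 + x * y * c6

theorem Represents.comp (h : f.Represents a b M) (hN : N.det ≠ 0)
    (hg : ∀ x y z : ℚ, g.eval x y z = f.eval
      (N 0 0 * x + N 0 1 * y + N 0 2 * z) (N 1 0 * x + N 1 1 * y + N 1 2 * z)
      (N 2 0 * x + N 2 1 * y + N 2 2 * z)) :
    g.Represents a b (M * N) := by
  refine ⟨by rw [Matrix.det_mul]; exact mul_ne_zero h.1 hN, fun x y z => ?_⟩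
  rw [hg, h.2]
  simp only [Matrix.mul_apply, Fin.sum_univ_three]
  congr 1 <;> ring

theorem disc_eq_mul_det_sq (h : f.Represents a b M) (h' : g.Represents a b (M * N)) :
    (g.disc : ℚ) = f.disc * N.det ^ 2 := by
  rw [h.disc_eq, h'.disc_eq, Matrix.det_mul]; ring

theorem Represents.isSquare_disc (h : f.Represents a b M) : IsSquare f.disc := by
  rw [← Rat.isSquare_intCast_iff, h.disc_eq]
  exact IsSquare.sq _

theorem Represents.disc_pos (h : f.Represents a b M) (ha : a ≠ 0) (hb : b ≠ 0) : 0 < f.disc := by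
  have : (0 : ℚ) < f.disc := by
    rw [h.disc_eq]
    have := h.1
    positivity
  exact_mod_cast this

/-- A form of least discriminant among those representing `(a, b)`. -/
def IsMinimal (f : TernaryForm) (a b : ℚ) : Prop :=
  (∃ M, f.Represents a b M) ∧ ∀ g : TernaryForm, (∃ M, g.Represents a b M) → f.disc ≤ g.disc

theorem exists_represents (a b : ℚ) :
    ∃ (f : TernaryForm) (M : _), f.Represents a b M := by
  have hA : (a.den : ℚ) ≠ 0 := by exact_mod_cast a.den_nz
  have hB : (b.den : ℚ) ≠ 0 := by exact_mod_cast b.den_nz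
  refine ⟨⟨-a.num * a.den * b.den ^ 2, -b.num * b.den * a.den ^ 2,
    a.num * b.num * a.den * b.den, 0, 0, 0⟩, (a.den * b.den : ℚ) • 1, ?_, fun x y z => ?_⟩
  · rw [Matrix.det_smul]; simp [hA, hB]
  · have e1 : a * a.den = a.num := Rat.mul_den_eq_num a
    have e2 : b * b.den = b.num := Rat.mul_den_eq_num b
    simp only [eval, pureNorm, Matrix.smul_apply, smul_eq_mul]
    simp
    rw [← e1, ← e2]; ring

theorem exists_isMinimal (ha : a ≠ 0) (hb : b ≠ 0) : ∃ f : TernaryForm, f.IsMinimal a b := by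
  have hne : {n : ℕ | ∃ f : TernaryForm, (∃ M, f.Represents a b M) ∧ f.disc = n}.Nonempty := by
    obtain ⟨f, M, hf⟩ := exists_represents a b
    exact ⟨f.disc.toNat, f, ⟨M, hf⟩, (Int.toNat_of_nonneg (hf.disc_pos ha hb).le).symm⟩
  obtain ⟨f, hf, hn⟩ := Nat.sInf_mem hne
  refine ⟨f, hf, fun g hg => ?_⟩
  obtain ⟨M, hM⟩ := hg
  have := Nat.sInf_le (s := {n : ℕ | ∃ f : TernaryForm, (∃ M, f.Represents a b M) ∧ f.disc = n})
    ⟨g, ⟨M, hM⟩, (Int.toNat_of_nonneg (hM.disc_pos ha hb).le).symm⟩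
  have h2 := Int.toNat_of_nonneg (hM.disc_pos ha hb).le
  omega

theorem IsMinimal.of_comp (hf : f.IsMinimal a b) (hN : N.det ^ 2 = 1)
    (hg : ∀ x y z : ℚ, g.eval x y z = f.eval
      (N 0 0 * x + N 0 1 * y + N 0 2 * z) (N 1 0 * x + N 1 1 * y + N 1 2 * z)
      (N 2 0 * x + N 2 1 * y + N 2 2 * z)) : g.IsMinimal a b ∧ g.disc = f.disc := by
  obtain ⟨⟨M, hM⟩, hmin⟩ := hf
  have h1 : g.Represents a b (M * N) := hM.comp (by rintro h; simp [h] at hN) hg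
  have h2 : g.disc = f.disc := by
    have := disc_eq_mul_det_sq hM h1
    rw [hN, mul_one] at this
    exact_mod_cast this
  exact ⟨⟨⟨_, h1⟩, h2 ▸ hmin⟩, h2⟩

/-- Exchange the first two coordinates. -/
def swapXY (f : TernaryForm) : TernaryForm := ⟨f.B, f.A, f.C, f.E, f.D, f.F⟩
/-- Exchange the first and third coordinate. -/
def swapXZ (f : TernaryForm) : TernaryForm := ⟨f.C, f.B, f.A, f.F, f.E, f.D⟩

theorem IsMinimal.swapXY (hf : f.IsMinimal a b) :
    f.swapXY.IsMinimal a b ∧ f.swapXY.disc = f.disc := by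
  refine hf.of_comp (N := !![0, 1, 0; 1, 0, 0; 0, 0, 1]) ?_ fun x y z => ?_
  · simp [Matrix.det_fin_three]
  · simp [eval, TernaryForm.swapXY]; ring

theorem IsMinimal.swapXZ (hf : f.IsMinimal a b) :
    f.swapXZ.IsMinimal a b ∧ f.swapXZ.disc = f.disc := by
  refine hf.of_comp (N := !![0, 0, 1; 0, 1, 0; 1, 0, 0]) ?_ fun x y z => ?_
  · simp [Matrix.det_fin_three]
  · simp [eval, TernaryForm.swapXZ]; ring

/-- Replace the first basis vector `e₁` by `e₁ + y e₂ + z e₃`. -/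
def shear (f : TernaryForm) (y z : ℤ) : TernaryForm :=
  ⟨f.eval 1 y z, f.B, f.C, f.D, f.dz 1 y z, f.dy 1 y z⟩

theorem IsMinimal.shear (hf : f.IsMinimal a b) (y z : ℤ) :
    (f.shear y z).IsMinimal a b ∧ (f.shear y z).disc = f.disc := by
  refine hf.of_comp (N := !![1, 0, 0; y, 1, 0; z, 0, 1]) ?_ fun x' y' z' => ?_
  · simp [Matrix.det_fin_three]
  · simp [eval, TernaryForm.shear, dz, dy]; ring

/-- Under these divisibilities $e_1$ may be replaced by $e_1/l$: the form stays integral and its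
discriminant drops by the factor $l^2$. -/
theorem IsMinimal.first_coeff (hf : f.IsMinimal a b) (ha : a ≠ 0) (hb : b ≠ 0) {l : ℤ}
    (hl : 1 < l) (hA : l ^ 2 ∣ f.A) (hE : l ∣ f.E) (hF : l ∣ f.F) : False := by
  obtain ⟨A, hA⟩ := hA
  obtain ⟨E, hE⟩ := hE
  obtain ⟨F, hF⟩ := hF
  obtain ⟨⟨M, hM⟩, hmin⟩ := hf
  have hl0 : (l : ℚ) ≠ 0 := by exact_mod_cast (by omega : l ≠ 0)
  have hdet : (!![(l : ℚ)⁻¹, 0, 0; 0, 1, 0; 0, 0, 1] : Matrix (Fin 3) (Fin 3) ℚ).det = (l : ℚ)⁻¹ := by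
    simp [Matrix.det_fin_three]
  have h1 : (⟨A, f.B, f.C, f.D, E, F⟩ : TernaryForm).Represents a b
      (M * !![(l : ℚ)⁻¹, 0, 0; 0, 1, 0; 0, 0, 1]) := by
    refine hM.comp (by rw [hdet]; exact inv_ne_zero hl0) fun x y z => ?_
    simp [eval, hA, hE, hF]
    field_simp
  have h2 := disc_eq_mul_det_sq hM h1
  have h3 := hmin _ ⟨_, h1⟩
  have h4 := hM.disc_pos ha hb
  rw [hdet] at h2
  have h5 : ((⟨A, f.B, f.C, f.D, E, F⟩ : TernaryForm).disc : ℚ) * l ^ 2 = f.disc := by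
    rw [h2]; field_simp
  have h6 : (⟨A, f.B, f.C, f.D, E, F⟩ : TernaryForm).disc * l ^ 2 = f.disc := by exact_mod_cast h5
  generalize (⟨A, f.B, f.C, f.D, E, F⟩ : TernaryForm).disc = d at h3 h6
  have h7 : 4 ≤ l ^ 2 := by nlinarith
  nlinarith

/-- The vector $(1,ty,tz)$ equals $t(x,y,z)+ls\,e_1$, and this is the Taylor expansion there.
Congruences thus pass from $(x,y,z)$ to the new first basis vector. -/
theorem eval_shear_eq {l x y z t s : ℤ} (h : t * x + l * s = 1) :
    f.eval 1 (t * y) (t * z) =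
      t ^ 2 * f.eval x y z + l * s * t * f.dx x y z + l ^ 2 * s ^ 2 * f.A := by
  simp only [eval, dx]
  have : t * x = 1 - l * s := by linarith
  push_cast
  linear_combination (-f.A * (t * x + l * s + 1) - t * (f.E * z + f.F * y)) * h

theorem dx_shear_eq {l x y z t s : ℤ} (h : t * x + l * s = 1) :
    f.dx 1 (t * y) (t * z) = t * f.dx x y z + l * s * (2 * f.A) := by
  simp only [dx]; push_cast; linear_combination (-2 * f.A) * h

theorem dy_shear_eq {l x y z t s : ℤ} (h : t * x + l * s = 1) :
    f.dy 1 (t * y) (t * z) = t * f.dy x y z + l * s * f.F := by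
  simp only [dy]; push_cast; linear_combination (-f.F) * h

theorem dz_shear_eq {l x y z t s : ℤ} (h : t * x + l * s = 1) :
    f.dz 1 (t * y) (t * z) = t * f.dz x y z + l * s * f.E := by
  simp only [dz]; push_cast; linear_combination (-f.E) * h

/-- A vector violating this could be divided by $l$ and adjoined to the lattice, since its norm over
$l^2$ and its pairings over $l$ are integral. When $l\nmid x$, a shear moves the first basis vector
onto it modulo $l$, up to a unit. -/
theorem IsMinimal.dvd_first (hf : f.IsMinimal a b) (ha : a ≠ 0) (hb : b ≠ 0) {l : ℕ} (hl : l.Prime)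
    {x y z : ℤ} (h : (l : ℤ) ^ 2 ∣ f.eval x y z) (h1 : (l : ℤ) ∣ f.dx x y z)
    (h2 : (l : ℤ) ∣ f.dy x y z) (h3 : (l : ℤ) ∣ f.dz x y z) : (l : ℤ) ∣ x := by
  by_contra hx
  have hcop : IsCoprime x (l : ℤ) := by
    rw [isCoprime_comm]
    exact (Nat.prime_iff_prime_int.1 hl).coprime_iff_not_dvd.2 hx
  obtain ⟨t, s, hts⟩ := hcop
  have hts' : t * x + l * s = 1 := by linarith
  refine (hf.shear (t * y) (t * z)).1.first_coeff ha hb (l := l) (by exact_mod_cast hl.one_lt) ?_ ?_ ?_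
  · simp only [TernaryForm.shear]
    rw [eval_shear_eq hts']
    refine dvd_add (dvd_add (Dvd.dvd.mul_left h _) ?_) ⟨s ^ 2 * f.A, by ring⟩
    obtain ⟨d, hd⟩ := h1
    exact ⟨s * t * d, by rw [hd]; ring⟩
  · simp only [TernaryForm.shear]
    rw [dz_shear_eq hts']
    exact dvd_add (Dvd.dvd.mul_left h3 _) ⟨s * f.E, by ring⟩
  · simp only [TernaryForm.shear]
    rw [dy_shear_eq hts']
    exact dvd_add (Dvd.dvd.mul_left h2 _) ⟨s * f.F, by ring⟩

theorem IsMinimal.dvd (hf : f.IsMinimal a b) (ha : a ≠ 0) (hb : b ≠ 0) {l : ℕ} (hl : l.Prime)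
    {x y z : ℤ} (h : (l : ℤ) ^ 2 ∣ f.eval x y z) (h1 : (l : ℤ) ∣ f.dx x y z)
    (h2 : (l : ℤ) ∣ f.dy x y z) (h3 : (l : ℤ) ∣ f.dz x y z) :
    (l : ℤ) ∣ x ∧ (l : ℤ) ∣ y ∧ (l : ℤ) ∣ z := by
  refine ⟨hf.dvd_first ha hb hl h h1 h2 h3, ?_, ?_⟩
  · refine hf.swapXY.1.dvd_first ha hb hl (x := y) (y := x) (z := z) ?_ ?_ ?_ ?_
    · convert h using 1; simp [eval, TernaryForm.swapXY]; ring
    · convert h2 using 1; simp [dx, dy, TernaryForm.swapXY]; ring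
    · convert h1 using 1; simp [dx, dy, TernaryForm.swapXY]; ring
    · convert h3 using 1; simp [dz, TernaryForm.swapXY]; ring
  · refine hf.swapXZ.1.dvd_first ha hb hl (x := z) (y := y) (z := x) ?_ ?_ ?_ ?_
    · convert h using 1; simp [eval, TernaryForm.swapXZ]; ring
    · convert h3 using 1; simp [dx, dz, TernaryForm.swapXZ]; ring
    · convert h2 using 1; simp [dy, TernaryForm.swapXZ]; ring
    · convert h1 using 1; simp [dx, dz, TernaryForm.swapXZ]; ring

end TernaryForm

/-! ### Zeros modulo l and over the l-adic integers -/

/-- A quadratic form in at least three variables over `𝔽_p` has a nontrivial zero. -/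
theorem exists_ne_zero_quadratic_eq_zero {p : ℕ} [Fact p.Prime] {ι : Type*} [Fintype ι]
    [DecidableEq ι] (hι : 2 < Fintype.card ι) (c : ι → ι → ZMod p) :
    ∃ x : ι → ZMod p, x ≠ 0 ∧ ∑ i, ∑ j, c i j * (x i * x j) = 0 := by
  let f : MvPolynomial ι (ZMod p) :=
    ∑ i, ∑ j, MvPolynomial.C (c i j) * (MvPolynomial.X i * MvPolynomial.X j)
  have hf : f.IsHomogeneous 2 := by
    refine MvPolynomial.IsHomogeneous.sum _ _ _ fun i _ => MvPolynomial.IsHomogeneous.sum _ _ _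
      fun j _ => ?_
    simpa using (MvPolynomial.isHomogeneous_C ι (c i j)).mul
      ((MvPolynomial.isHomogeneous_X (ZMod p) i).mul (MvPolynomial.isHomogeneous_X (ZMod p) j))
  have hev : ∀ x, MvPolynomial.eval x f = ∑ i, ∑ j, c i j * (x i * x j) := by
    intro x; simp [f]
  have hdvd := char_dvd_card_solutions (K := ZMod p) p (f := f) (hf.totalDegree_le.trans_lt hι)
  have h0 : MvPolynomial.eval (0 : ι → ZMod p) f = 0 := by rw [hev]; simp
  have hcard : 1 < Fintype.card {x : ι → ZMod p // MvPolynomial.eval x f = 0} :=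
    lt_of_lt_of_le (Fact.out : p.Prime).one_lt (Nat.le_of_dvd (Fintype.card_pos_iff.2 ⟨⟨0, h0⟩⟩) hdvd)
  obtain ⟨⟨x, hx⟩, hne⟩ := Fintype.exists_ne_of_one_lt_card hcard ⟨0, h0⟩
  exact ⟨x, fun h => hne (Subtype.ext h), by rw [← hev, hx]⟩

/-- Hensel's lemma for quadratic polynomials. -/
theorem exists_root_quadratic {p : ℕ} [Fact p.Prime] (a₀ a₁ a₂ : ℤ_[p]) (h1 : ‖a₁‖ = 1)
    (h0 : ‖a₀‖ < 1) : ∃ t : ℤ_[p], ‖t‖ < 1 ∧ a₀ + t * a₁ + t ^ 2 * a₂ = 0 := by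
  let P : Polynomial ℤ_[p] :=
    Polynomial.C a₀ + Polynomial.X * Polynomial.C a₁ + Polynomial.X ^ 2 * Polynomial.C a₂
  have hd : Polynomial.aeval (0 : ℤ_[p]) (Polynomial.derivative P) = a₁ := by simp [P]
  have hz : Polynomial.aeval (0 : ℤ_[p]) P = a₀ := by simp [P]
  obtain ⟨t, ht, htn, -⟩ := hensels_lemma (F := P) (a := (0 : ℤ_[p]))
    (by rw [hd, hz, h1]; simpa using h0)
  rw [hd, h1, sub_zero] at htn
  exact ⟨t, htn, by rw [← ht]; simp [P]; ring⟩

namespace TernaryForm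

variable {f g : TernaryForm} {a b : ℚ} {M : Matrix (Fin 3) (Fin 3) ℚ}

theorem map_eval {R S : Type*} [CommRing R] [CommRing S] (φ : R →+* S) (x y z : R) :
    φ (f.eval x y z) = f.eval (φ x) (φ y) (φ z) := by
  simp [eval]

theorem map_dx {R S : Type*} [CommRing R] [CommRing S] (φ : R →+* S) (x y z : R) :
    φ (f.dx x y z) = f.dx (φ x) (φ y) (φ z) := by
  simp [dx, map_ofNat]

theorem map_dy {R S : Type*} [CommRing R] [CommRing S] (φ : R →+* S) (x y z : R) :
    φ (f.dy x y z) = f.dy (φ x) (φ y) (φ z) := by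
  simp [dy, map_ofNat]

theorem map_dz {R S : Type*} [CommRing R] [CommRing S] (φ : R →+* S) (x y z : R) :
    φ (f.dz x y z) = f.dz (φ x) (φ y) (φ z) := by
  simp [dz, map_ofNat]

theorem det_mul_x {R : Type*} [CommRing R] (x y z : R) :
    2 * (f.disc : R) * x = (4 * f.B * f.C - f.D ^ 2) * f.dx x y z
      + (f.D * f.E - 2 * f.C * f.F) * f.dy x y z + (f.D * f.F - 2 * f.B * f.E) * f.dz x y z := by
  simp only [disc, dx, dy, dz]; push_cast; ring

theorem det_mul_y {R : Type*} [CommRing R] (x y z : R) :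
    2 * (f.disc : R) * y = (f.D * f.E - 2 * f.C * f.F) * f.dx x y z
      + (4 * f.A * f.C - f.E ^ 2) * f.dy x y z + (f.E * f.F - 2 * f.A * f.D) * f.dz x y z := by
  simp only [disc, dx, dy, dz]; push_cast; ring

theorem det_mul_z {R : Type*} [CommRing R] (x y z : R) :
    2 * (f.disc : R) * z = (f.D * f.F - 2 * f.B * f.E) * f.dx x y z
      + (f.E * f.F - 2 * f.A * f.D) * f.dy x y z + (4 * f.A * f.B - f.F ^ 2) * f.dz x y z := by
  simp only [disc, dx, dy, dz]; push_cast; ring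

theorem exists_zero_mod (f : TernaryForm) (l : ℕ) [Fact l.Prime] :
    ∃ x y z : ZMod l, (x ≠ 0 ∨ y ≠ 0 ∨ z ≠ 0) ∧ f.eval x y z = 0 := by
  obtain ⟨v, hv, h⟩ := exists_ne_zero_quadratic_eq_zero (p := l) (ι := Fin 3) (by simp)
    !![(f.A : ZMod l), f.F, f.E; 0, f.B, f.D; 0, 0, f.C]
  refine ⟨v 0, v 1, v 2, ?_, ?_⟩
  · by_contra! hc
    exact hv (by ext i; fin_cases i <;> simp [hc])
  · simp only [Fin.sum_univ_three] at h
    simp at h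
    simp only [eval]; linear_combination h

section Local

variable {l : ℕ} [Fact l.Prime]

theorem exists_padic_zero_of_unit_dx {x y z : ℤ_[l]} (h : ‖f.eval x y z‖ < 1)
    (h1 : ‖f.dx x y z‖ = 1) : ∃ t : ℤ_[l], ‖t‖ < 1 ∧ f.eval (x + t) y z = 0 := by
  obtain ⟨t, ht, h0⟩ := exists_root_quadratic _ _ (f.A : ℤ_[l]) h1 h
  refine ⟨t, ht, ?_⟩
  rw [← h0]; simp only [eval, dx]; ring

theorem exists_padic_zero_of_unit_dy {x y z : ℤ_[l]} (h : ‖f.eval x y z‖ < 1)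
    (h1 : ‖f.dy x y z‖ = 1) : ∃ t : ℤ_[l], ‖t‖ < 1 ∧ f.eval x (y + t) z = 0 := by
  obtain ⟨t, ht, h0⟩ := exists_root_quadratic _ _ (f.B : ℤ_[l]) h1 h
  refine ⟨t, ht, ?_⟩
  rw [← h0]; simp only [eval, dy]; ring

theorem exists_padic_zero_of_unit_dz {x y z : ℤ_[l]} (h : ‖f.eval x y z‖ < 1)
    (h1 : ‖f.dz x y z‖ = 1) : ∃ t : ℤ_[l], ‖t‖ < 1 ∧ f.eval x y (z + t) = 0 := by
  obtain ⟨t, ht, h0⟩ := exists_root_quadratic _ _ (f.C : ℤ_[l]) h1 h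
  refine ⟨t, ht, ?_⟩
  rw [← h0]; simp only [eval, dz]; ring

theorem norm_lt_one_iff_toZMod (x : ℤ_[l]) : ‖x‖ < 1 ↔ PadicInt.toZMod x = 0 := by
  rw [← RingHom.mem_ker, PadicInt.ker_toZMod, PadicInt.maximalIdeal_eq_span_p,
    PadicInt.norm_lt_one_iff_dvd, Ideal.mem_span_singleton]

/-- A form whose discriminant is prime to the odd prime `l` is isotropic over `ℤ_l`. -/
theorem exists_padic_zero_of_not_dvd_disc (hl2 : l ≠ 2) (h : ¬ (l : ℤ) ∣ f.disc) :
    ∃ x y z : ℤ_[l], (x ≠ 0 ∨ y ≠ 0 ∨ z ≠ 0) ∧ f.eval x y z = 0 := by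
  obtain ⟨x, y, z, hne, h0⟩ := f.exists_zero_mod l
  obtain ⟨x, rfl⟩ := ZMod.ringHom_surjective (PadicInt.toZMod (p := l)) x
  obtain ⟨y, rfl⟩ := ZMod.ringHom_surjective (PadicInt.toZMod (p := l)) y
  obtain ⟨z, rfl⟩ := ZMod.ringHom_surjective (PadicInt.toZMod (p := l)) z
  rw [← map_eval, ← norm_lt_one_iff_toZMod] at h0
  have hprime := (Fact.out : l.Prime)
  have hd : (2 * f.disc : ZMod l) ≠ 0 := by
    refine mul_ne_zero ?_ ?_
    · have : ((2 : ℕ) : ZMod l) ≠ 0 := by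
        rw [Ne, ZMod.natCast_eq_zero_iff, Nat.prime_dvd_prime_iff_eq hprime Nat.prime_two]
        exact hl2
      exact_mod_cast this
    · rwa [Ne, ZMod.intCast_zmod_eq_zero_iff_dvd]
  have hu : ∀ w : ℤ_[l], PadicInt.toZMod w ≠ 0 → ‖w‖ = 1 := fun w hw =>
    le_antisymm (PadicInt.norm_le_one w) (not_lt.1 fun h => hw ((norm_lt_one_iff_toZMod w).1 h))
  have hne' : ∀ w t : ℤ_[l], PadicInt.toZMod w ≠ 0 → ‖t‖ < 1 → w + t ≠ 0 := by
    intro w t hw ht h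
    apply hw
    have := congrArg PadicInt.toZMod h
    rwa [map_add, (norm_lt_one_iff_toZMod t).1 ht, add_zero, map_zero] at this
  have hz : ∀ w t : ℤ_[l], PadicInt.toZMod w ≠ 0 → w ≠ 0 := fun w t hw h => hw (by simp [h])
  -- The gradient is the Hessian applied to the vector, and the Hessian has determinant `2 *
  -- f.disc`, a unit modulo `l`. Every nontrivial zero modulo `l` is therefore nonsingular and lifts
  -- by Hensel.
  have key : f.dx (PadicInt.toZMod x) (PadicInt.toZMod y) (PadicInt.toZMod z) ≠ 0 ∨
      f.dy (PadicInt.toZMod x) (PadicInt.toZMod y) (PadicInt.toZMod z) ≠ 0 ∨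
      f.dz (PadicInt.toZMod x) (PadicInt.toZMod y) (PadicInt.toZMod z) ≠ 0 := by
    by_contra! hc
    have e1 := f.det_mul_x (PadicInt.toZMod x) (PadicInt.toZMod y) (PadicInt.toZMod z)
    have e2 := f.det_mul_y (PadicInt.toZMod x) (PadicInt.toZMod y) (PadicInt.toZMod z)
    have e3 := f.det_mul_z (PadicInt.toZMod x) (PadicInt.toZMod y) (PadicInt.toZMod z)
    rw [hc.1, hc.2.1, hc.2.2] at e1 e2 e3
    simp only [mul_zero, add_zero] at e1 e2 e3
    rcases hne with h | h | h
    · exact h ((mul_eq_zero.1 e1).resolve_left hd)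
    · exact h ((mul_eq_zero.1 e2).resolve_left hd)
    · exact h ((mul_eq_zero.1 e3).resolve_left hd)
  rw [← map_dx, ← map_dy, ← map_dz] at key
  rcases key with h1 | h1 | h1
  · obtain ⟨t, ht, e⟩ := exists_padic_zero_of_unit_dx h0 (hu _ h1)
    exact ⟨_, _, _, hne.imp (hne' x t · ht) (Or.imp (hz y 0) (hz z 0)), e⟩
  · obtain ⟨t, ht, e⟩ := exists_padic_zero_of_unit_dy h0 (hu _ h1)
    exact ⟨_, _, _, hne.imp (hz x 0) (Or.imp (hne' y t · ht) (hz z 0)), e⟩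
  · obtain ⟨t, ht, e⟩ := exists_padic_zero_of_unit_dz h0 (hu _ h1)
    exact ⟨_, _, _, hne.imp (hz x 0) (Or.imp (hz y 0) (hne' z t · ht)), e⟩

theorem cast_det_ne_zero {K : Type*} [Field K] [CharZero K] (hM : M.det ≠ 0) :
    (M.map (Rat.cast : ℚ → K)).det ≠ 0 := by
  have h : (M.map (Rat.cast : ℚ → K)).det = (M.det : K) := by
    have := (RingHom.map_det (Rat.castHom K) M).symm
    simpa using this
  rw [h]
  exact_mod_cast hM

theorem Represents.dvd_disc_of_anisotropic (h : f.Represents a b M) (hl2 : l ≠ 2)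
    (han : ∀ x y z : ℚ_[l], pureNorm (a : ℚ_[l]) b x y z = 0 → x = 0 ∧ y = 0 ∧ z = 0) :
    (l : ℤ) ∣ f.disc := by
  by_contra hd
  obtain ⟨x, y, z, hne, h0⟩ := exists_padic_zero_of_not_dvd_disc hl2 hd
  have h1 : f.eval (x : ℚ_[l]) y z = 0 := by
    have := map_eval (f := f) (PadicInt.Coe.ringHom (p := l)) x y z
    rw [h0, map_zero] at this
    exact this.symm
  rw [h.eval_cast] at h1
  obtain ⟨e1, e2, e3⟩ := han _ _ _ h1
  have := Matrix.eq_zero_of_mulVec_eq_zero (cast_det_ne_zero (K := ℚ_[l]) h.1)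
    (v := ![(x : ℚ_[l]), y, z]) (by
      ext i; fin_cases i <;> simp [Matrix.mulVec, dotProduct, Fin.sum_univ_three, e1, e2, e3])
  rcases hne with h | h | h
  · exact h (by simpa using congrFun this 0)
  · exact h (by simpa using congrFun this 1)
  · exact h (by simpa using congrFun this 2)

/-- Divide by a coordinate of largest norm. -/
theorem exists_padicInt_zero_with_one {x y z : ℚ_[l]} (hne : x ≠ 0 ∨ y ≠ 0 ∨ z ≠ 0)
    (h : f.eval x y z = 0) :
    ∃ x y z : ℤ_[l], (x = 1 ∨ y = 1 ∨ z = 1) ∧ f.eval x y z = 0 := by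
  have scale : ∀ c : ℚ_[l], c ≠ 0 → ∀ hx : ‖x‖ ≤ ‖c‖, ∀ hy : ‖y‖ ≤ ‖c‖, ∀ hz : ‖z‖ ≤ ‖c‖,
      (x = c ∨ y = c ∨ z = c) →
      ∃ x y z : ℤ_[l], (x = 1 ∨ y = 1 ∨ z = 1) ∧ f.eval x y z = 0 := by
    intro c hc hx hy hz hor
    have hc' : 0 < ‖c‖ := norm_pos_iff.2 hc
    refine ⟨⟨x / c, by rw [norm_div]; exact (div_le_one hc').2 hx⟩,
      ⟨y / c, by rw [norm_div]; exact (div_le_one hc').2 hy⟩,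
      ⟨z / c, by rw [norm_div]; exact (div_le_one hc').2 hz⟩, ?_, ?_⟩
    · refine hor.imp ?_ (Or.imp ?_ ?_)
      all_goals rintro rfl; apply Subtype.ext; simp [div_self hc]
    · apply Subtype.ext
      have := map_eval (f := f) (PadicInt.Coe.ringHom (p := l)) ⟨x / c, by rw [norm_div]; exact (div_le_one hc').2 hx⟩
        ⟨y / c, by rw [norm_div]; exact (div_le_one hc').2 hy⟩
        ⟨z / c, by rw [norm_div]; exact (div_le_one hc').2 hz⟩
      refine Eq.trans this ?_
      change f.eval (x / c) (y / c) (z / c) = 0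
      have e : f.eval (x / c) (y / c) (z / c) = f.eval x y z / c ^ 2 := by
        simp only [eval]; field_simp
      rw [e, h, zero_div]
  rcases le_total ‖x‖ ‖y‖ with h1 | h1
  · rcases le_total ‖y‖ ‖z‖ with h2 | h2
    · refine scale z ?_ (h1.trans h2) h2 le_rfl (by simp)
      rintro rfl
      simp_all
    · refine scale y ?_ h1 le_rfl h2 (by simp)
      rintro rfl
      simp_all
  · rcases le_total ‖x‖ ‖z‖ with h2 | h2
    · refine scale z ?_ h2 (h1.trans h2) le_rfl (by simp)
      rintro rfl
      simp_all
    · refine scale x ?_ le_rfl h1 h2 (by simp)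
      rintro rfl
      simp_all

/-- An `l`-adically isotropic form has a primitive integral zero modulo `l²`. -/
theorem Represents.exists_primitive_zero (h : f.Represents a b M)
    (his : ∃ x y z : ℚ_[l], (x ≠ 0 ∨ y ≠ 0 ∨ z ≠ 0) ∧ pureNorm (a : ℚ_[l]) b x y z = 0) :
    ∃ x y z : ℤ, (x = 1 ∨ y = 1 ∨ z = 1) ∧ (l : ℤ) ^ 2 ∣ f.eval x y z := by
  obtain ⟨X, Y, Z, hne, h0⟩ := his
  have hu : IsUnit (M.map (Rat.cast : ℚ → ℚ_[l])).det := (cast_det_ne_zero h.1).isUnit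
  set M' := M.map (Rat.cast : ℚ → ℚ_[l])
  set v := M'⁻¹.mulVec ![X, Y, Z] with hv
  have hMv : M'.mulVec v = ![X, Y, Z] := by
    rw [hv, Matrix.mulVec_mulVec, Matrix.mul_nonsing_inv _ hu, Matrix.one_mulVec]
  have e1 : (M 0 0 : ℚ_[l]) * v 0 + M 0 1 * v 1 + M 0 2 * v 2 = X := by
    simpa [Matrix.mulVec, dotProduct, Fin.sum_univ_three, M'] using congrFun hMv 0
  have e2 : (M 1 0 : ℚ_[l]) * v 0 + M 1 1 * v 1 + M 1 2 * v 2 = Y := by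
    simpa [Matrix.mulVec, dotProduct, Fin.sum_univ_three, M'] using congrFun hMv 1
  have e3 : (M 2 0 : ℚ_[l]) * v 0 + M 2 1 * v 1 + M 2 2 * v 2 = Z := by
    simpa [Matrix.mulVec, dotProduct, Fin.sum_univ_three, M'] using congrFun hMv 2
  have hev : f.eval (v 0) (v 1) (v 2) = 0 := by rw [h.eval_cast, e1, e2, e3, h0]
  have hvne : v 0 ≠ 0 ∨ v 1 ≠ 0 ∨ v 2 ≠ 0 := by
    by_contra! hc
    rw [hc.1, hc.2.1, hc.2.2] at e1 e2 e3
    simp only [mul_zero, add_zero] at e1 e2 e3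
    simp [← e1, ← e2, ← e3] at hne
  obtain ⟨x, y, z, h1, h2⟩ := exists_padicInt_zero_with_one hvne hev
  have hl := (Fact.out : l.Prime).one_lt
  have : Fact (1 < l ^ 2) := ⟨Nat.one_lt_pow two_ne_zero hl⟩
  have hcast : ∀ w : ℤ_[l], (((PadicInt.toZModPow 2 w).val : ℤ) : ZMod (l ^ 2)) =
      PadicInt.toZModPow 2 w := fun w => by rw [Int.cast_natCast, ZMod.natCast_zmod_val]
  refine ⟨(PadicInt.toZModPow 2 x).val, (PadicInt.toZModPow 2 y).val, (PadicInt.toZModPow 2 z).val,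
    ?_, ?_⟩
  · refine h1.imp ?_ (Or.imp ?_ ?_)
    all_goals rintro rfl; simp [ZMod.val_one]
  · have h3 : ((l ^ 2 : ℕ) : ℤ) ∣ f.eval ((PadicInt.toZModPow 2 x).val : ℤ)
        ((PadicInt.toZModPow 2 y).val : ℤ) ((PadicInt.toZModPow 2 z).val : ℤ) := by
      rw [← ZMod.intCast_zmod_eq_zero_iff_dvd]
      have := map_eval (f := f) (Int.castRingHom (ZMod (l ^ 2))) ((PadicInt.toZModPow 2 x).val : ℤ)
        ((PadicInt.toZModPow 2 y).val : ℤ) ((PadicInt.toZModPow 2 z).val : ℤ)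
      simp only [Int.coe_castRingHom, hcast] at this
      rw [this, ← map_eval, h2, map_zero]
    exact_mod_cast h3

end Local

end TernaryForm

/-! ### The minimal form, prime by prime -/

namespace TernaryForm

variable {f g : TernaryForm} {a b : ℚ} {M : Matrix (Fin 3) (Fin 3) ℚ}

theorem IsMinimal.sq_dvd_disc (hf : f.IsMinimal a b) {l : ℕ} (hl : l.Prime) (h : (l : ℤ) ∣ f.disc) :
    (l : ℤ) ^ 2 ∣ f.disc := by
  obtain ⟨⟨M, hM⟩, -⟩ := hf
  obtain ⟨m, hm⟩ := hM.isSquare_disc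
  rw [hm] at h ⊢
  have : (l : ℤ) ∣ m := by
    rcases (Nat.prime_iff_prime_int.1 hl).dvd_or_dvd h with h | h <;> exact h
  rw [sq]
  exact mul_dvd_mul this this

/-- Modulo 2 the polar form is alternating, with $(D,E,F)$ in its radical, and
$f(D,E,F)=4ABC+4DEF-\mathrm{disc}$ is divisible by 4. Minimality makes $D,E,F$ even; then every
gradient is even, and a primitive zero modulo 4 contradicts minimality again. -/
theorem IsMinimal.not_two_dvd_disc (hf : f.IsMinimal a b) (ha : a ≠ 0) (hb : b ≠ 0)
    (his : ∃ x y z : ℚ_[2], (x ≠ 0 ∨ y ≠ 0 ∨ z ≠ 0) ∧ pureNorm (a : ℚ_[2]) b x y z = 0) :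
    ¬ (2 : ℤ) ∣ f.disc := by
  intro h2
  obtain ⟨d, hd⟩ := hf.sq_dvd_disc Nat.prime_two h2
  obtain ⟨⟨D, hD⟩, ⟨E, hE⟩, ⟨F, hF⟩⟩ := hf.dvd ha hb Nat.prime_two (x := f.D) (y := f.E) (z := f.F)
    ⟨f.A * f.B * f.C + f.D * f.E * f.F - d, by
      simp only [eval, disc, Int.cast_id] at hd ⊢; push_cast at hd ⊢; linear_combination -hd⟩
    ⟨f.A * f.D + f.E * f.F, by simp [dx]; ring⟩ ⟨f.B * f.E + f.D * f.F, by simp [dy]; ring⟩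
    ⟨f.C * f.F + f.D * f.E, by simp [dz]; ring⟩
  obtain ⟨M, hM⟩ := hf.1
  obtain ⟨x, y, z, h1, h0⟩ := hM.exists_primitive_zero his
  obtain ⟨h3, h4, h5⟩ := hf.dvd ha hb Nat.prime_two h0
    ⟨f.A * x + F * y + E * z, by simp only [dx, hE, hF]; push_cast; ring⟩
    ⟨F * x + f.B * y + D * z, by simp only [dy, hD, hF]; push_cast; ring⟩
    ⟨E * x + D * y + f.C * z, by simp only [dz, hD, hE]; push_cast; ring⟩
  omega

theorem IsMinimal.exists_kernel_first_aux (hf : f.IsMinimal a b) {l : ℕ} (hl : l.Prime) {x y z : ℤ}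
    (hx : ¬ (l : ℤ) ∣ x) (h1 : (l : ℤ) ∣ f.dx x y z) (h2 : (l : ℤ) ∣ f.dy x y z)
    (h3 : (l : ℤ) ∣ f.dz x y z) :
    ∃ g : TernaryForm, g.IsMinimal a b ∧ g.disc = f.disc ∧ (l : ℤ) ∣ 2 * g.A ∧ (l : ℤ) ∣ g.E ∧
      (l : ℤ) ∣ g.F := by
  have hcop : IsCoprime x (l : ℤ) := by
    rw [isCoprime_comm]
    exact (Nat.prime_iff_prime_int.1 hl).coprime_iff_not_dvd.2 hx
  obtain ⟨t, s, hts⟩ := hcop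
  have hts' : t * x + l * s = 1 := by linarith
  have e1 : (l : ℤ) ∣ f.dx 1 (t * y) (t * z) := by
    rw [dx_shear_eq hts']
    exact dvd_add (Dvd.dvd.mul_left h1 _) ⟨s * (2 * f.A), by ring⟩
  have e2 : (l : ℤ) ∣ f.dy 1 (t * y) (t * z) := by
    rw [dy_shear_eq hts']
    exact dvd_add (Dvd.dvd.mul_left h2 _) ⟨s * f.F, by ring⟩
  have e3 : (l : ℤ) ∣ f.dz 1 (t * y) (t * z) := by
    rw [dz_shear_eq hts']
    exact dvd_add (Dvd.dvd.mul_left h3 _) ⟨s * f.E, by ring⟩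
  refine ⟨_, (hf.shear (t * y) (t * z)).1, (hf.shear (t * y) (t * z)).2, ?_, e3, e2⟩
  -- Euler's relation recovers twice the form from its gradient; hence `2 * g.A` in the conclusion.
  have : 2 * f.eval 1 (t * y) (t * z) = f.dx 1 (t * y) (t * z) + (t * y) * f.dy 1 (t * y) (t * z)
      + (t * z) * f.dz 1 (t * y) (t * z) := by
    simp only [eval, dx, dy, dz]; ring
  simp only [TernaryForm.shear]
  rw [this]
  exact dvd_add (dvd_add e1 (Dvd.dvd.mul_left e2 _)) (Dvd.dvd.mul_left e3 _)

theorem exists_kernel (f : TernaryForm) {l : ℕ} [Fact l.Prime] (h : (l : ℤ) ∣ f.disc) :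
    ∃ x y z : ℤ, (¬ (l : ℤ) ∣ x ∨ ¬ (l : ℤ) ∣ y ∨ ¬ (l : ℤ) ∣ z) ∧ (l : ℤ) ∣ f.dx x y z ∧
      (l : ℤ) ∣ f.dy x y z ∧ (l : ℤ) ∣ f.dz x y z := by
  have hdet : (!![2 * (f.A : ZMod l), f.F, f.E; f.F, 2 * f.B, f.D; f.E, f.D, 2 * f.C]).det = 0 := by
    have h' : ((f.disc : ℤ) : ZMod l) = 0 := (ZMod.intCast_zmod_eq_zero_iff_dvd _ _).2 h
    simp only [disc] at h'
    push_cast at h'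
    simp [Matrix.det_fin_three]
    linear_combination 2 * h'
  obtain ⟨v, hv, hv0⟩ := Matrix.exists_mulVec_eq_zero_iff.2 hdet
  obtain ⟨x, hx⟩ := ZMod.intCast_surjective (v 0)
  obtain ⟨y, hy⟩ := ZMod.intCast_surjective (v 1)
  obtain ⟨z, hz⟩ := ZMod.intCast_surjective (v 2)
  have h0 := congrFun hv0 0
  have h1 := congrFun hv0 1
  have h2 := congrFun hv0 2
  simp [Matrix.mulVec, dotProduct, Fin.sum_univ_three, ← hx, ← hy, ← hz] at h0 h1 h2
  refine ⟨x, y, z, ?_, ?_, ?_, ?_⟩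
  · simp only [← ZMod.intCast_zmod_eq_zero_iff_dvd, hx, hy, hz]
    by_contra! hc
    exact hv (by ext i; fin_cases i <;> simp [hc])
  · rw [← ZMod.intCast_zmod_eq_zero_iff_dvd]; simp only [dx]; push_cast; exact h0
  · rw [← ZMod.intCast_zmod_eq_zero_iff_dvd]; simp only [dy]; push_cast; exact h1
  · rw [← ZMod.intCast_zmod_eq_zero_iff_dvd]; simp only [dz]; push_cast; exact h2

theorem IsMinimal.exists_kernel_first (hf : f.IsMinimal a b) {l : ℕ} [Fact l.Prime]
    (h : (l : ℤ) ∣ f.disc) :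
    ∃ g : TernaryForm, g.IsMinimal a b ∧ g.disc = f.disc ∧ (l : ℤ) ∣ 2 * g.A ∧ (l : ℤ) ∣ g.E ∧
      (l : ℤ) ∣ g.F := by
  have hl := (Fact.out : l.Prime)
  obtain ⟨x, y, z, hne, h1, h2, h3⟩ := f.exists_kernel h
  rcases hne with hx | hy | hz
  · exact hf.exists_kernel_first_aux hl hx h1 h2 h3
  · obtain ⟨g, hg⟩ := hf.swapXY.1.exists_kernel_first_aux hl (x := y) (y := x) (z := z) hy
      (by convert h2 using 1; simp [dx, dy, TernaryForm.swapXY]; ring)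
      (by convert h1 using 1; simp [dx, dy, TernaryForm.swapXY]; ring)
      (by convert h3 using 1; simp [dz, TernaryForm.swapXY]; ring)
    exact ⟨g, hf.swapXY.2 ▸ hg⟩
  · obtain ⟨g, hg⟩ := hf.swapXZ.1.exists_kernel_first_aux hl (x := z) (y := y) (z := x) hz
      (by convert h3 using 1; simp [dx, dz, TernaryForm.swapXZ]; ring)
      (by convert h2 using 1; simp [dy, TernaryForm.swapXZ]; ring)
      (by convert h1 using 1; simp [dx, dz, TernaryForm.swapXZ]; ring)
    exact ⟨g, hf.swapXZ.2 ▸ hg⟩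

/-- Modulo an odd prime dividing the discriminant, a minimal form has rank at most one. -/
theorem IsMinimal.exists_rank_one (hf : f.IsMinimal a b) (ha : a ≠ 0) (hb : b ≠ 0) {l : ℕ}
    [Fact l.Prime] (hl2 : l ≠ 2) (h : (l : ℤ) ∣ f.disc) :
    ∃ g : TernaryForm, g.IsMinimal a b ∧ g.disc = f.disc ∧ (l : ℤ) ∣ g.A ∧ (l : ℤ) ∣ g.B ∧
      (l : ℤ) ∣ g.D ∧ (l : ℤ) ∣ g.E ∧ (l : ℤ) ∣ g.F := by
  have hl := (Fact.out : l.Prime)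
  have hlp := Nat.prime_iff_prime_int.1 hl
  have htwo : ¬ (l : ℤ) ∣ 2 := by
    intro h
    have : l ∣ 2 := by exact_mod_cast h
    exact hl2 ((Nat.prime_dvd_prime_iff_eq hl Nat.prime_two).1 this)
  have hsq := hf.sq_dvd_disc hl h
  obtain ⟨g, hg, hgd, hA, hE, hF⟩ := hf.exists_kernel_first h
  replace hA := (hlp.dvd_or_dvd hA).resolve_left htwo
  -- If the complementary binary form were nondegenerate modulo `l`, then $l^2\mid$ disc would give
  -- $l^2\mid A$, and the first basis vector could be divided by `l`.
  have hbin : (l : ℤ) ∣ 4 * g.B * g.C - g.D ^ 2 := by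
    by_contra hn
    have h1 : (l : ℤ) ^ 2 ∣ g.A * (4 * g.B * g.C - g.D ^ 2) := by
      have e : g.A * (4 * g.B * g.C - g.D ^ 2) = g.disc - g.D * (g.E * g.F) + g.B * g.E ^ 2
        + g.C * g.F ^ 2 := by simp only [disc]; ring
      rw [e, hgd, sq]
      refine dvd_add (dvd_add (dvd_sub (by rwa [← sq]) ?_) ?_) ?_
      · exact Dvd.dvd.mul_left (mul_dvd_mul hE hF) _
      · rw [sq]; exact Dvd.dvd.mul_left (mul_dvd_mul hE hE) _
      · rw [sq]; exact Dvd.dvd.mul_left (mul_dvd_mul hF hF) _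
    have h2 : (l : ℤ) ^ 2 ∣ g.A :=
      (IsCoprime.pow_left ((hlp.coprime_iff_not_dvd).2 hn)).dvd_of_dvd_mul_right h1
    exact hg.first_coeff ha hb (by exact_mod_cast hl.one_lt) h2 hE hF
  by_cases hB : (l : ℤ) ∣ g.B
  · refine ⟨g, hg, hgd, hA, hB, ?_, hE, hF⟩
    refine hlp.dvd_of_dvd_pow (n := 2) ?_
    have := dvd_sub (Dvd.dvd.mul_right (Dvd.dvd.mul_left hB 4) g.C) hbin
    simpa using this
  · have hcop : IsCoprime (2 * g.B) (l : ℤ) := by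
      rw [isCoprime_comm, hlp.coprime_iff_not_dvd]
      intro h
      rcases hlp.dvd_or_dvd h with h | h
      exacts [htwo h, hB h]
    obtain ⟨r, s, hrs⟩ := hcop
    -- Here `r` inverts `2 * g.B` modulo `l`, so $(0,t,1)$ spans the radical of the degenerate
    -- binary form. It becomes the second basis vector.
    set t := -(g.D * r) with ht
    have hdt : (l : ℤ) ∣ 2 * g.B * t + g.D := ⟨g.D * s, by rw [ht]; linear_combination -g.D * hrs⟩
    have hev : (l : ℤ) ∣ g.eval 0 t 1 := by
      have h4 : (l : ℤ) ∣ (2 * (2 * g.B)) * g.eval 0 t 1 := by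
        have e : (2 * (2 * g.B)) * g.eval 0 t 1 =
            (2 * g.B * t + g.D) ^ 2 + (4 * g.B * g.C - g.D ^ 2) := by
          simp only [eval]; push_cast; ring
        rw [e]
        exact dvd_add (Dvd.dvd.pow hdt two_ne_zero) hbin
      have h5 : ¬ (l : ℤ) ∣ 2 * (2 * g.B) := by
        intro h
        rcases hlp.dvd_or_dvd h with h | h
        · exact htwo h
        · rcases hlp.dvd_or_dvd h with h | h
          exacts [htwo h, hB h]
      exact (hlp.dvd_or_dvd h4).resolve_left h5
    obtain ⟨h1, h2⟩ := hg.of_comp (g := ⟨g.A, g.eval 0 t 1, g.B, 2 * g.B * t + g.D, g.F,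
        g.E + t * g.F⟩) (N := !![1, 0, 0; 0, t, 1; 0, 1, 0])
      (by simp [Matrix.det_fin_three]) (fun x y z => by simp [eval]; ring)
    exact ⟨_, h1, h2.trans hgd, hA, hev, hdt, hF, dvd_add hE (Dvd.dvd.mul_left hF _)⟩

theorem exists_int_zero_mod (f : TernaryForm) (l : ℕ) [Fact l.Prime] :
    ∃ x y z : ℤ, ¬ ((l : ℤ) ∣ x ∧ (l : ℤ) ∣ y ∧ (l : ℤ) ∣ z) ∧ (l : ℤ) ∣ f.eval x y z := by
  obtain ⟨x, y, z, hne, h⟩ := f.exists_zero_mod l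
  obtain ⟨x, rfl⟩ := ZMod.intCast_surjective x
  obtain ⟨y, rfl⟩ := ZMod.intCast_surjective y
  obtain ⟨z, rfl⟩ := ZMod.intCast_surjective z
  refine ⟨x, y, z, ?_, ?_⟩
  · simp only [← ZMod.intCast_zmod_eq_zero_iff_dvd]
    tauto
  · rw [← ZMod.intCast_zmod_eq_zero_iff_dvd]
    exact (map_eval (Int.castRingHom (ZMod l)) x y z).trans h

section RankOne

variable {l : ℕ} {A B C D E F : ℤ}

/-- A zero of the binary form modulo $l$ gives the vector $(x,y,0)$, with norm divisible by $l^2$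
and gradient divisible by $l$; minimality forbids it to be primitive. -/
theorem IsMinimal.binary_anisotropic (hf : (⟨l * A, l * B, C, l * D, l * E, l * F⟩ :
    TernaryForm).IsMinimal a b) (ha : a ≠ 0) (hb : b ≠ 0) (hl : l.Prime) {x y : ℤ}
    (h : (l : ℤ) ∣ A * x ^ 2 + F * (x * y) + B * y ^ 2) : (l : ℤ) ∣ x ∧ (l : ℤ) ∣ y := by
  obtain ⟨d, hd⟩ := h
  have := hf.dvd ha hb hl (x := x) (y := y) (z := 0)
    ⟨d, by simp only [eval]; push_cast; linear_combination l * hd⟩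
    ⟨2 * A * x + F * y, by simp only [dx]; push_cast; ring⟩
    ⟨F * x + 2 * B * y, by simp only [dy]; push_cast; ring⟩
    ⟨E * x + D * y, by simp only [dz]; push_cast; ring⟩
  exact ⟨this.1, this.2.1⟩

/-- Otherwise the form is $l$ times an integral ternary form, and a zero of the latter modulo $l$
contradicts minimality. -/
theorem IsMinimal.not_dvd_last (hf : (⟨l * A, l * B, C, l * D, l * E, l * F⟩ :
    TernaryForm).IsMinimal a b) (ha : a ≠ 0) (hb : b ≠ 0) [Fact l.Prime] : ¬ (l : ℤ) ∣ C := by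
  rintro ⟨C, rfl⟩
  obtain ⟨x, y, z, hne, d, hd⟩ := (⟨A, B, C, D, E, F⟩ : TernaryForm).exists_int_zero_mod l
  simp only [eval] at hd
  push_cast at hd
  exact hne (hf.dvd ha hb Fact.out
    ⟨d, by simp only [eval]; push_cast; linear_combination l * hd⟩
    ⟨2 * A * x + F * y + E * z, by simp only [dx]; push_cast; ring⟩
    ⟨F * x + 2 * B * y + D * z, by simp only [dy]; push_cast; ring⟩
    ⟨E * x + D * y + 2 * C * z, by simp only [dz]; push_cast; ring⟩)

/-- In a primitive zero modulo $l^2$ the term $Cz^2$ forces $l\mid z$; dividing by $l$ leaves a zero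
of the anisotropic binary form. So rank one modulo $l$ can occur only where the algebra ramifies. -/
theorem IsMinimal.not_isotropic (hf : (⟨l * A, l * B, C, l * D, l * E, l * F⟩ :
    TernaryForm).IsMinimal a b) (ha : a ≠ 0) (hb : b ≠ 0) [Fact l.Prime] :
    ¬ ∃ x y z : ℚ_[l], (x ≠ 0 ∨ y ≠ 0 ∨ z ≠ 0) ∧ pureNorm (a : ℚ_[l]) b x y z = 0 := by
  intro his
  have hl := (Fact.out : l.Prime)
  have hlp := Nat.prime_iff_prime_int.1 hl
  obtain ⟨M, hM⟩ := hf.1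
  obtain ⟨x, y, z, h1, d, hd⟩ := hM.exists_primitive_zero his
  simp only [eval] at hd
  push_cast at hd
  have hz : (l : ℤ) ∣ z := by
    have : (l : ℤ) ∣ C * z ^ 2 := ⟨l * d - A * x ^ 2 - B * y ^ 2 - D * (y * z) - E * (x * z)
      - F * (x * y), by linear_combination hd⟩
    exact hlp.dvd_of_dvd_pow ((hlp.dvd_or_dvd this).resolve_left (hf.not_dvd_last ha hb))
  obtain ⟨z, rfl⟩ := hz
  have hl0 : (l : ℤ) ≠ 0 := hlp.ne_zero
  obtain ⟨hx, hy⟩ := hf.binary_anisotropic ha hb hl (x := x) (y := y)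
    ⟨d - D * (y * z) - E * (x * z) - C * z ^ 2, mul_left_cancel₀ hl0 (by linear_combination hd)⟩
  have hn : ¬ (l : ℤ) ∣ 1 := hlp.not_dvd_one
  rcases h1 with h1 | h1 | h1
  · exact hn (h1 ▸ hx)
  · exact hn (h1 ▸ hy)
  · exact hn (h1 ▸ ⟨z, rfl⟩)

theorem IsMinimal.not_isSquare_binary_disc (hf : (⟨l * A, l * B, C, l * D, l * E, l * F⟩ :
    TernaryForm).IsMinimal a b) (ha : a ≠ 0) (hb : b ≠ 0) [Fact l.Prime] (hl2 : l ≠ 2) :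
    ¬ IsSquare ((-(4 * A * B - F ^ 2) : ℤ) : ZMod l) := by
  rintro ⟨s, hs⟩
  have hl := (Fact.out : l.Prime)
  have hlp := Nat.prime_iff_prime_int.1 hl
  have htwo : ¬ (l : ℤ) ∣ 2 := by
    intro h
    have : l ∣ 2 := by exact_mod_cast h
    exact hl2 ((Nat.prime_dvd_prime_iff_eq hl Nat.prime_two).1 this)
  obtain ⟨s, rfl⟩ := ZMod.intCast_surjective s
  have h1 : (l : ℤ) ∣ s * s + (4 * A * B - F ^ 2) := by
    rw [← ZMod.intCast_zmod_eq_zero_iff_dvd]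
    push_cast at hs ⊢
    linear_combination -hs
  -- The quadratic formula: a square root `s` of the binary discriminant gives the zero $(s-F,2A)$.
  have h2 : (l : ℤ) ∣ A * (s - F) ^ 2 + F * ((s - F) * (2 * A)) + B * (2 * A) ^ 2 := by
    have e : A * (s - F) ^ 2 + F * ((s - F) * (2 * A)) + B * (2 * A) ^ 2 =
        A * (s * s + (4 * A * B - F ^ 2)) := by ring
    rw [e]
    exact Dvd.dvd.mul_left h1 A
  have h3 := (hf.binary_anisotropic ha hb hl h2).2
  have h4 : (l : ℤ) ∣ A := (hlp.dvd_or_dvd h3).resolve_left htwo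
  have h5 := hf.binary_anisotropic ha hb hl (x := 1) (y := 0) (by simpa using h4)
  exact hlp.not_dvd_one h5.1

end RankOne

/-- The trace-zero norm form of a quaternion algebra ramified exactly at the odd prime `p` has an
integral model of discriminant `p²` that reduces to `C z²` modulo `p`, with `-C` a nonsquare. -/
theorem exists_adapted {p : ℕ} [Fact p.Prime] (hp2 : p ≠ 2) (ha : a ≠ 0) (hb : b ≠ 0)
    (his : ∀ (l : ℕ) [Fact l.Prime], l ≠ p →
      ∃ x y z : ℚ_[l], (x ≠ 0 ∨ y ≠ 0 ∨ z ≠ 0) ∧ pureNorm (a : ℚ_[l]) b x y z = 0)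
    (han : ∀ x y z : ℚ_[p], pureNorm (a : ℚ_[p]) b x y z = 0 → x = 0 ∧ y = 0 ∧ z = 0) :
    ∃ (A B C D E F : ℤ) (M : Matrix (Fin 3) (Fin 3) ℚ),
      (⟨p * A, p * B, C, p * D, p * E, p * F⟩ : TernaryForm).Represents a b M ∧
      (⟨p * A, p * B, C, p * D, p * E, p * F⟩ : TernaryForm).disc = p ^ 2 ∧
      ¬ IsSquare (-(C : ZMod p)) := by
  have hp := (Fact.out : p.Prime)
  have hpp := Nat.prime_iff_prime_int.1 hp
  obtain ⟨f, hf⟩ := exists_isMinimal ha hb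
  obtain ⟨M, hM⟩ := hf.1
  have hpos := hM.disc_pos ha hb
  -- A prime dividing the discriminant is 2, which isotropy excludes unless `p = 2`, or odd; then
  -- the form has rank one modulo it and is anisotropic there.
  have honly : ∀ l : ℕ, l.Prime → (l : ℤ) ∣ f.disc → l = p := by
    intro l hl hd
    by_contra hne
    have : Fact l.Prime := ⟨hl⟩
    by_cases hl2 : l = 2
    · subst hl2
      exact hf.not_two_dvd_disc ha hb (his 2 hne) hd
    · obtain ⟨g, hg, -, ⟨A, hA⟩, ⟨B, hB⟩, ⟨D, hD⟩, ⟨E, hE⟩, ⟨F, hF⟩⟩ := hf.exists_rank_one ha hb hl2 hd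
      obtain ⟨_, _, C, _, _, _⟩ := g
      simp only at hA hB hD hE hF
      subst hA hB hD hE hF
      exact hg.not_isotropic ha hb (his l hne)
  have hpd : (p : ℤ) ∣ f.disc := hM.dvd_disc_of_anisotropic hp2 han
  obtain ⟨g, hg, hgd, ⟨A, hA⟩, ⟨B, hB⟩, ⟨D, hD⟩, ⟨E, hE⟩, ⟨F, hF⟩⟩ := hf.exists_rank_one ha hb hp2 hpd
  obtain ⟨_, _, C, _, _, _⟩ := g
  simp only at hA hB hD hE hF
  subst hA hB hD hE hF
  have hC := hg.not_dvd_last ha hb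
  have hδ := hg.not_isSquare_binary_disc ha hb hp2
  obtain ⟨M', hM'⟩ := hg.1
  have hdisc : f.disc = p ^ 2 * (C * (4 * A * B - F ^ 2)
      + p * (D * E * F - A * D ^ 2 - B * E ^ 2)) := by
    rw [← hgd]; simp only [disc]; ring
  have hδ0 : ¬ (p : ℤ) ∣ 4 * A * B - F ^ 2 := by
    intro h
    apply hδ
    rw [Int.cast_neg, (ZMod.intCast_zmod_eq_zero_iff_dvd _ _).2 h]
    simp
  -- The cofactor of $p^2$ in the discriminant is positive, prime to $p$, and has no other prime
  -- divisor.
  have hcof : C * (4 * A * B - F ^ 2) + p * (D * E * F - A * D ^ 2 - B * E ^ 2) = 1 := by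
    set m := C * (4 * A * B - F ^ 2) + p * (D * E * F - A * D ^ 2 - B * E ^ 2) with hm
    have hp0 : (0 : ℤ) < p ^ 2 := by have := hp.pos; positivity
    have hmpos : 0 < m := by
      rw [hdisc] at hpos
      exact (mul_pos_iff_of_pos_left hp0).1 hpos
    have hpm : ¬ (p : ℤ) ∣ m := by
      intro h
      have : (p : ℤ) ∣ C * (4 * A * B - F ^ 2) := by
        have := dvd_sub h (Dvd.intro (D * E * F - A * D ^ 2 - B * E ^ 2) rfl)
        rwa [hm, add_sub_cancel_right] at this
      rcases hpp.dvd_or_dvd this with h | h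
      exacts [hC h, hδ0 h]
    by_contra hm1
    have hn1 : m.natAbs ≠ 1 := by omega
    obtain ⟨l, hl, hlm⟩ := Nat.exists_prime_and_dvd hn1
    have hlm' : (l : ℤ) ∣ m := Int.natCast_dvd.2 hlm
    have := honly l hl (hdisc ▸ Dvd.dvd.mul_left hlm' _)
    subst this
    exact hpm hlm'
  refine ⟨A, B, C, D, E, F, M', hM', by rw [hgd, hdisc, hcof, mul_one], ?_⟩
  -- Modulo `p` the cofactor identity says that `C` and the determinant `4 * A * B - F ^ 2` are
  -- inverse to each other, so their negatives have the same quadratic character.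
  rintro ⟨s, hs⟩
  have hone : (C : ZMod p) * ((4 * A * B - F ^ 2 : ℤ) : ZMod p) = 1 := by
    have := congrArg (Int.cast : ℤ → ZMod p) hcof
    push_cast at this ⊢
    simpa using this
  have hs0 : s ≠ 0 := by
    rintro rfl
    have : (C : ZMod p) = 0 := by simpa using hs
    rw [this, zero_mul] at hone
    exact zero_ne_one hone
  apply hδ
  refine ⟨s⁻¹, ?_⟩
  rw [Int.cast_neg]
  rw [← mul_inv]
  refine eq_inv_of_mul_eq_one_left ?_
  rw [← hs]
  linear_combination hone

end TernaryForm

/-! ### Minkowski's theorem for products of balls and cylinders -/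

open MeasureTheory in
/-- Minkowski's theorem for a linear image of `ℤ³ × ℤ³` and a product of two convex bodies. -/
theorem exists_int_mem_prod_convexBody (T : Matrix (Fin 3 ⊕ Fin 3) (Fin 3 ⊕ Fin 3) ℝ)
    (hT : T.det ≠ 0) {S₁ S₂ : Set (Fin 3 → ℝ)} (h1 : Convex ℝ S₁) (h2 : Convex ℝ S₂)
    (s1 : ∀ x ∈ S₁, -x ∈ S₁) (s2 : ∀ x ∈ S₂, -x ∈ S₂) {V₁ V₂ : ℝ} (hV₁ : 0 ≤ V₁)
    (v1 : volume S₁ = ENNReal.ofReal V₁) (v2 : volume S₂ = ENNReal.ofReal V₂)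
    (hvol : 64 * |T.det| < V₁ * V₂) :
    ∃ n : Fin 3 ⊕ Fin 3 → ℤ, n ≠ 0 ∧
      (fun i => T.mulVec (fun j => (n j : ℝ)) (.inl i)) ∈ S₁ ∧
      (fun i => T.mulVec (fun j => (n j : ℝ)) (.inr i)) ∈ S₂ := by
  let K : Set (Fin 3 ⊕ Fin 3 → ℝ) := MeasurableEquiv.sumPiEquivProdPi (fun _ => ℝ) ⁻¹' (S₁ ×ˢ S₂)
  have hK : ∀ w, w ∈ K ↔ (fun i => w (.inl i)) ∈ S₁ ∧ (fun i => w (.inr i)) ∈ S₂ := fun w => Iff.rfl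
  have hKv : volume K = ENNReal.ofReal (V₁ * V₂) := by
    rw [(volume_measurePreserving_sumPiEquivProdPi (fun _ : Fin 3 ⊕ Fin 3 => ℝ)).measure_preimage_equiv]
    rw [Measure.volume_eq_prod, Measure.prod_prod, v1, v2, ENNReal.ofReal_mul hV₁]
  let f := Matrix.toLin' T
  have hf : LinearMap.det f = T.det := LinearMap.det_toLin' T
  have hpre : volume (f ⁻¹' K) = ENNReal.ofReal (|T.det|⁻¹ * (V₁ * V₂)) := by
    rw [Measure.addHaar_preimage_linearMap _ (by rwa [hf]), hf, hKv, abs_inv,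
      ← ENNReal.ofReal_mul (by positivity)]
  let b := Pi.basisFun ℝ (Fin 3 ⊕ Fin 3)
  have hfund : volume (ZSpan.fundamentalDomain b) = 1 := by
    rw [ZSpan.fundamentalDomain_pi_basisFun, Real.volume_pi_Ico]
    simp
  have hcount : Countable (Submodule.span ℤ (Set.range b)).toAddSubgroup := by
    change Countable (Submodule.span ℤ (Set.range b))
    infer_instance
  obtain ⟨⟨x, hx⟩, hne, hxm⟩ := exists_ne_zero_mem_lattice_of_measure_mul_two_pow_lt_measure
    (E := Fin 3 ⊕ Fin 3 → ℝ) (μ := volume) (L := (Submodule.span ℤ (Set.range b)).toAddSubgroup)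
    (s := f ⁻¹' K) (ZSpan.isAddFundamentalDomain' b volume)
    (by
      intro x hx
      rw [Set.mem_preimage, hK] at hx ⊢
      rw [map_neg]
      exact ⟨s1 _ hx.1, s2 _ hx.2⟩)
    (by
      refine Convex.linear_preimage ?_ f
      exact (h1.linear_preimage (LinearMap.funLeft ℝ ℝ Sum.inl)).inter
        (h2.linear_preimage (LinearMap.funLeft ℝ ℝ Sum.inr)))
    (by
      rw [hfund, hpre, one_mul]
      simp only [Module.finrank_fintype_fun_eq_card, Fintype.card_sum, Fintype.card_fin]
      have : (2 : ENNReal) ^ (3 + 3) = ENNReal.ofReal 64 := by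
        rw [← ENNReal.ofReal_ofNat 2, ← ENNReal.ofReal_pow (by norm_num)]; norm_num
      rw [this]
      have hd : 0 < |T.det| := abs_pos.2 hT
      refine (ENNReal.ofReal_lt_ofReal_iff ?_).2 ?_
      · have : 0 < V₁ * V₂ := lt_trans (by positivity) hvol
        positivity
      · rw [inv_mul_eq_div, lt_div_iff₀ hd]; exact hvol)
  have hx' : ∀ i, ∃ n : ℤ, (n : ℝ) = x i := by
    have := (b.mem_span_iff_repr_mem ℤ x).1 hx
    intro i
    obtain ⟨n, hn⟩ := this i
    exact ⟨n, by simpa [b] using hn⟩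
  choose n hn using hx'
  have hnx : (fun j => (n j : ℝ)) = x := funext hn
  refine ⟨n, ?_, ?_⟩
  · rintro rfl
    apply hne
    refine Subtype.ext (hnx.symm.trans ?_)
    ext; simp
  · rw [hnx]
    exact (hK _).1 hxm

/-- The open ball of radius `√r` in `ℝ³`. -/
def ballThree (r : ℝ) : Set (Fin 3 → ℝ) := {x | x 0 ^ 2 + x 1 ^ 2 + x 2 ^ 2 < r}

/-- The open cylinder over the disc of radius `√r`. -/
def cylinderThree (α r : ℝ) : Set (Fin 3 → ℝ) := {x | |x 0| < α ∧ x 1 ^ 2 + x 2 ^ 2 < r}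

theorem ballThree_eq {r : ℝ} (hr : 0 ≤ r) :
    ballThree r = (WithLp.toLp 2) ⁻¹' Metric.ball (0 : EuclideanSpace ℝ (Fin 3)) √r := by
  rw [EuclideanSpace.ball_zero_eq _ (Real.sqrt_nonneg r)]
  ext x
  simp [ballThree, Fin.sum_univ_three, Real.sq_sqrt hr]

theorem convex_ballThree {r : ℝ} (hr : 0 ≤ r) : Convex ℝ (ballThree r) := by
  rw [ballThree_eq hr]
  exact (convex_ball _ _).linear_preimage (WithLp.linearEquiv 2 ℝ (Fin 3 → ℝ)).symm.toLinearMap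

open MeasureTheory in
theorem volume_ballThree {r : ℝ} (hr : 0 ≤ r) :
    volume (ballThree r) = ENNReal.ofReal (√r ^ 3 * (Real.pi * 4 / 3)) := by
  rw [ballThree_eq hr, (PiLp.volume_preserving_toLp (Fin 3)).measure_preimage
    measurableSet_ball.nullMeasurableSet, EuclideanSpace.volume_ball_fin_three,
    ENNReal.ofReal_mul (by positivity), ENNReal.ofReal_pow (by positivity)]

/-- The open disc of radius `√r`. -/
def discTwo (r : ℝ) : Set (Fin 2 → ℝ) := {x | x 0 ^ 2 + x 1 ^ 2 < r}

theorem discTwo_eq {r : ℝ} (hr : 0 ≤ r) :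
    discTwo r = (WithLp.toLp 2) ⁻¹' Metric.ball (0 : EuclideanSpace ℝ (Fin 2)) √r := by
  rw [EuclideanSpace.ball_zero_eq _ (Real.sqrt_nonneg r)]
  ext x
  simp [discTwo, Real.sq_sqrt hr]

theorem convex_cylinderThree {α r : ℝ} (hr : 0 ≤ r) : Convex ℝ (cylinderThree α r) := by
  have h1 : Convex ℝ (discTwo r) := by
    rw [discTwo_eq hr]
    exact (convex_ball _ _).linear_preimage (WithLp.linearEquiv 2 ℝ (Fin 2 → ℝ)).symm.toLinearMap
  have h2 : Convex ℝ (Set.Ioo (-α) α) := convex_Ioo _ _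
  have : cylinderThree α r = (LinearMap.proj (R := ℝ) (φ := fun _ : Fin 3 => ℝ) 0) ⁻¹' Set.Ioo (-α) α ∩
      (LinearMap.funLeft ℝ ℝ (Fin.succ : Fin 2 → Fin 3)) ⁻¹' discTwo r := by
    ext x
    simp [cylinderThree, discTwo, abs_lt, LinearMap.funLeft]
  rw [this]
  exact (h2.linear_preimage _).inter (h1.linear_preimage _)

open MeasureTheory in
theorem volume_cylinderThree {α r : ℝ} (hα : 0 ≤ α) (hr : 0 ≤ r) :
    volume (cylinderThree α r) = ENNReal.ofReal (2 * α * (r * Real.pi)) := by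
  have h1 : volume (discTwo r) = ENNReal.ofReal (r * Real.pi) := by
    rw [discTwo_eq hr, (PiLp.volume_preserving_toLp (Fin 2)).measure_preimage
      measurableSet_ball.nullMeasurableSet, EuclideanSpace.volume_ball_fin_two,
      ENNReal.ofReal_mul hr, ← ENNReal.ofReal_pow (by positivity), Real.sq_sqrt hr]
  have : cylinderThree α r = (MeasurableEquiv.piFinSuccAbove (fun _ : Fin 3 => ℝ) 0) ⁻¹'
      (Set.Ioo (-α) α ×ˢ discTwo r) := by
    ext x
    simp [cylinderThree, discTwo, abs_lt, MeasurableEquiv.piFinSuccAbove, Fin.insertNthEquiv,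
      Fin.tail]
  rw [this, (volume_preserving_piFinSuccAbove (fun _ : Fin 3 => ℝ) 0).measure_preimage_equiv,
    Measure.volume_eq_prod, Measure.prod_prod, h1, Real.volume_Ioo,
    ← ENNReal.ofReal_mul (by linarith)]
  congr 1; ring

theorem neg_mem_ballThree {r : ℝ} {x : Fin 3 → ℝ} (h : x ∈ ballThree r) : -x ∈ ballThree r := by
  simpa [ballThree] using h

theorem neg_mem_cylinderThree {α r : ℝ} {x : Fin 3 → ℝ} (h : x ∈ cylinderThree α r) :
    -x ∈ cylinderThree α r := by
  simpa [cylinderThree] using h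

/-! ### Gluing two adapted forms -/

namespace TernaryForm

variable {f g : TernaryForm} {a b c d : ℚ} {M N : Matrix (Fin 3) (Fin 3) ℚ} {p : ℕ}

/-- An integral model of discriminant `p²` of the norm form on pure quaternions that reduces to
`C z²` modulo `p`, with `-C` a nonsquare. -/
structure IsAdapted (p : ℕ) (f : TernaryForm) (a b : ℚ) (M : Matrix (Fin 3) (Fin 3) ℚ) : Prop where
  rep : f.Represents a b M
  disc : f.disc = (p : ℤ) ^ 2
  A : (p : ℤ) ∣ f.A
  B : (p : ℤ) ∣ f.B
  D : (p : ℤ) ∣ f.D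
  E : (p : ℤ) ∣ f.E
  F : (p : ℤ) ∣ f.F
  nonsquare : ¬ IsSquare (-(f.C : ZMod p))

theorem IsAdapted.abs_det (h : f.IsAdapted p a b M) : |a * b * M.det| = p / 2 := by
  have h1 := h.rep.disc_eq
  rw [h.disc] at h1
  push_cast at h1
  have h2 := abs_eq_abs.2 (sq_eq_sq_iff_eq_or_eq_neg.1 h1)
  rw [abs_of_nonneg (by positivity : (0 : ℚ) ≤ p)] at h2
  rw [h2, show 2 * a * b * M.det = 2 * (a * b * M.det) by ring, abs_mul 2, abs_two]
  ring

/-- Two adapted lattices can be glued along their reductions modulo `p`. -/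
theorem IsAdapted.exists_glue [Fact p.Prime] (hf : f.IsAdapted p a b M)
    (hg : g.IsAdapted p c d N) :
    ∃ t : ℤ, ∀ x y z x' y' z' : ℤ, (p : ℤ) ∣ f.eval x y (t * z' + p * z) - g.eval x' y' z' := by
  have hC : (f.C : ZMod p) ≠ 0 := fun h => hf.nonsquare (by rw [h]; simp)
  -- A product of two nonsquares is a square, so the two reductions $Cz^2$ and $C'z'^2$ agree after
  -- scaling by `s`. The gluing condition is $z\equiv tz' \pmod p$, of index $p$.
  obtain ⟨s, hs⟩ : ∃ s : ZMod p, (f.C : ZMod p) * s ^ 2 = g.C := by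
    have hsq : IsSquare (-(f.C : ZMod p) * -(g.C : ZMod p)) := by
      have hg0 : -(g.C : ZMod p) ≠ 0 := fun h => hg.nonsquare (by rw [h]; simp)
      have h1 := quadraticChar_neg_one_iff_not_isSquare.2 hf.nonsquare
      have h2 := quadraticChar_neg_one_iff_not_isSquare.2 hg.nonsquare
      refine (quadraticChar_one_iff_isSquare (mul_ne_zero (neg_ne_zero.2 hC) hg0)).1 ?_
      rw [map_mul, h1, h2]; norm_num
    obtain ⟨r, hr⟩ := hsq
    refine ⟨r / f.C, ?_⟩
    field_simp
    rw [sq, ← hr]; ring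
  obtain ⟨t, rfl⟩ := ZMod.intCast_surjective s
  refine ⟨t, fun x y z x' y' z' => ?_⟩
  rw [← ZMod.intCast_zmod_eq_zero_iff_dvd]
  simp only [eval]
  push_cast
  simp only [(ZMod.intCast_zmod_eq_zero_iff_dvd _ _).2 hf.A,
    (ZMod.intCast_zmod_eq_zero_iff_dvd _ _).2 hf.B, (ZMod.intCast_zmod_eq_zero_iff_dvd _ _).2 hf.D,
    (ZMod.intCast_zmod_eq_zero_iff_dvd _ _).2 hf.E, (ZMod.intCast_zmod_eq_zero_iff_dvd _ _).2 hf.F,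
    (ZMod.intCast_zmod_eq_zero_iff_dvd _ _).2 hg.A, (ZMod.intCast_zmod_eq_zero_iff_dvd _ _).2 hg.B,
    (ZMod.intCast_zmod_eq_zero_iff_dvd _ _).2 hg.D, (ZMod.intCast_zmod_eq_zero_iff_dvd _ _).2 hg.E,
    (ZMod.intCast_zmod_eq_zero_iff_dvd _ _).2 hg.F, CharP.cast_eq_zero]
  linear_combination (z' : ZMod p) ^ 2 * hs

/-- The matrix of the inclusion of a glued lattice. -/
def glueMatrix {R : Type*} [CommRing R] (M N : Matrix (Fin 3) (Fin 3) R) (p t : R) :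
    Matrix (Fin 3 ⊕ Fin 3) (Fin 3 ⊕ Fin 3) R :=
  Matrix.fromBlocks (M * Matrix.diagonal ![1, 1, p]) (M * Matrix.diagonal ![0, 0, t]) 0 N

theorem det_glueMatrix {R : Type*} [CommRing R] (M N : Matrix (Fin 3) (Fin 3) R) (p t : R) :
    (glueMatrix M N p t).det = M.det * p * N.det := by
  rw [glueMatrix, Matrix.det_fromBlocks_zero₂₁, Matrix.det_mul, Matrix.det_diagonal]
  simp [Fin.prod_univ_three]

theorem glueMatrix_mulVec_inl {R : Type*} [CommRing R] (M N : Matrix (Fin 3) (Fin 3) R) (p t : R)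
    (n : Fin 3 ⊕ Fin 3 → R) (i : Fin 3) :
    (glueMatrix M N p t).mulVec n (.inl i) = M i 0 * n (.inl 0) + M i 1 * n (.inl 1)
      + M i 2 * (t * n (.inr 2) + p * n (.inl 2)) := by
  simp [glueMatrix, Matrix.mulVec, dotProduct, Fin.sum_univ_three]
  ring

theorem glueMatrix_mulVec_inr {R : Type*} [CommRing R] (M N : Matrix (Fin 3) (Fin 3) R) (p t : R)
    (n : Fin 3 ⊕ Fin 3 → R) (i : Fin 3) :
    (glueMatrix M N p t).mulVec n (.inr i) = N i 0 * n (.inr 0) + N i 1 * n (.inr 1)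
      + N i 2 * n (.inr 2) := by
  simp [glueMatrix, Matrix.mulVec, dotProduct, Fin.sum_univ_three]

theorem pureNorm_nonneg {a b x y z : ℚ} (ha : a < 0) (hb : b < 0) : 0 ≤ pureNorm a b x y z := by
  have h1 := mul_nonneg (neg_nonneg.2 ha.le) (sq_nonneg x)
  have h2 := mul_nonneg (neg_nonneg.2 hb.le) (sq_nonneg y)
  have h3 := mul_nonneg (mul_pos_of_neg_of_neg ha hb).le (sq_nonneg z)
  simp only [pureNorm]; linarith

theorem eq_zero_of_pureNorm {a b x y z : ℚ} (ha : a < 0) (hb : b < 0)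
    (h : pureNorm a b x y z = 0) : x = 0 ∧ y = 0 ∧ z = 0 := by
  have hab := mul_pos_of_neg_of_neg ha hb
  have h1 := mul_nonneg (neg_nonneg.2 ha.le) (sq_nonneg x)
  have h2 := mul_nonneg (neg_nonneg.2 hb.le) (sq_nonneg y)
  have h3 := mul_nonneg hab.le (sq_nonneg z)
  simp only [pureNorm] at h
  have e1 : a * x ^ 2 = 0 := by linarith
  have e2 : b * y ^ 2 = 0 := by linarith
  have e3 : a * b * z ^ 2 = 0 := by linarith
  simpa [ha.ne, hb.ne] using And.intro e1 (And.intro e2 e3)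

theorem int_eq_zero_of_dvd_of_abs_lt {p : ℕ} {n : ℤ} (h : (p : ℤ) ∣ n) (h' : |n| < p) : n = 0 :=
  Int.eq_zero_of_abs_lt_dvd h h'

/-- The vector of the first algebra attached to an element of a glued lattice. -/
def glueFst (M : Matrix (Fin 3) (Fin 3) ℚ) (p : ℕ) (t : ℤ) (n : Fin 3 ⊕ Fin 3 → ℤ) (i : Fin 3) : ℚ :=
  M i 0 * n (.inl 0) + M i 1 * n (.inl 1) + M i 2 * (t * n (.inr 2) + p * n (.inl 2))

/-- The vector of the second algebra attached to an element of a glued lattice. -/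
def glueSnd (N : Matrix (Fin 3) (Fin 3) ℚ) (n : Fin 3 ⊕ Fin 3 → ℤ) (i : Fin 3) : ℚ :=
  N i 0 * n (.inr 0) + N i 1 * n (.inr 1) + N i 2 * n (.inr 2)

theorem glueMatrix_mulVec_cast_inl (M N : Matrix (Fin 3) (Fin 3) ℚ) (p : ℕ) (t : ℤ)
    (n : Fin 3 ⊕ Fin 3 → ℤ) (i : Fin 3) :
    (glueMatrix (M.map (Rat.cast : ℚ → ℝ)) (N.map (Rat.cast : ℚ → ℝ)) p t).mulVec
      (fun j => (n j : ℝ)) (.inl i) = (glueFst M p t n i : ℝ) := by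
  rw [glueMatrix_mulVec_inl, glueFst]; push_cast; rfl

theorem glueMatrix_mulVec_cast_inr (M N : Matrix (Fin 3) (Fin 3) ℚ) (p : ℕ) (t : ℤ)
    (n : Fin 3 ⊕ Fin 3 → ℤ) (i : Fin 3) :
    (glueMatrix (M.map (Rat.cast : ℚ → ℝ)) (N.map (Rat.cast : ℚ → ℝ)) p t).mulVec
      (fun j => (n j : ℝ)) (.inr i) = (glueSnd N n i : ℝ) := by
  rw [glueMatrix_mulVec_inr, glueSnd]; push_cast; rfl

/-- The difference of the norms on a glued lattice. -/
def glueForm (f g : TernaryForm) (p : ℕ) (t : ℤ) (n : Fin 3 ⊕ Fin 3 → ℤ) : ℤ :=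
  f.eval (n (.inl 0)) (n (.inl 1)) (t * n (.inr 2) + p * n (.inl 2))
    - g.eval (n (.inr 0)) (n (.inr 1)) (n (.inr 2))

theorem glueForm_eq (hf : f.Represents a b M) (hg : g.Represents c d N) (t : ℤ)
    (n : Fin 3 ⊕ Fin 3 → ℤ) :
    (glueForm f g p t n : ℚ) =
      pureNorm a b (glueFst M p t n 0) (glueFst M p t n 1) (glueFst M p t n 2)
      - pureNorm c d (glueSnd N n 0) (glueSnd N n 1) (glueSnd N n 2) := by
  have h1 := hf.2 (n (.inl 0)) (n (.inl 1)) (t * n (.inr 2) + p * n (.inl 2))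
  have h2 := hg.2 (n (.inr 0)) (n (.inr 1)) (n (.inr 2))
  have h3 := map_eval (f := f) (Int.castRingHom ℚ) (n (.inl 0)) (n (.inl 1))
    (t * n (.inr 2) + p * n (.inl 2))
  have h4 := map_eval (f := g) (Int.castRingHom ℚ) (n (.inr 0)) (n (.inr 1)) (n (.inr 2))
  simp only [eq_intCast] at h3 h4
  push_cast at h3
  simp only [glueForm, glueFst, glueSnd]
  rw [← h1, ← h2, ← h3, ← h4]
  push_cast; rfl

theorem glue_injective (hM : M.det ≠ 0) (hN : N.det ≠ 0) (hp : p ≠ 0) {t : ℤ}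
    {n : Fin 3 ⊕ Fin 3 → ℤ} (h1 : ∀ i, glueFst M p t n i = 0) (h2 : ∀ i, glueSnd N n i = 0) :
    n = 0 := by
  have hdet : (glueMatrix M N (p : ℚ) t).det ≠ 0 := by
    rw [det_glueMatrix]
    exact mul_ne_zero (mul_ne_zero hM (by exact_mod_cast hp)) hN
  have := Matrix.eq_zero_of_mulVec_eq_zero hdet (v := fun j => (n j : ℚ)) (by
    ext (i | i)
    · rw [glueMatrix_mulVec_inl]; exact h1 i
    · rw [glueMatrix_mulVec_inr]; exact h2 i)
  ext j
  simpa using congrFun this j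

theorem cast_det {K : Type*} [Field K] [CharZero K] (M : Matrix (Fin 3) (Fin 3) ℚ) :
    (M.map (Rat.cast : ℚ → K)).det = (M.det : K) := by
  simpa using (RingHom.map_det (Rat.castHom K) M).symm

/-- Two definite quaternion algebras ramified at the same prime have pure quaternions of equal
nonzero norm. -/
theorem exists_common_norm [Fact p.Prime] (ha : a < 0) (hb : b < 0) (hc : c < 0) (hd : d < 0)
    (hf : f.IsAdapted p a b M) (hg : g.IsAdapted p c d N) :
    ∃ x y z x' y' z' : ℚ, pureNorm a b x y z = pureNorm c d x' y' z' ∧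
      pureNorm a b x y z ≠ 0 := by
  have hp := (Fact.out : p.Prime)
  obtain ⟨t, ht⟩ := hf.exists_glue hg
  have haR : (0 : ℝ) < -(a : ℝ) := by exact_mod_cast neg_pos.2 ha
  have hbR : (0 : ℝ) < -(b : ℝ) := by exact_mod_cast neg_pos.2 hb
  have hcR : (0 : ℝ) < -(c : ℝ) := by exact_mod_cast neg_pos.2 hc
  have hdR : (0 : ℝ) < -(d : ℝ) := by exact_mod_cast neg_pos.2 hd
  have habR : (0 : ℝ) < a * b := by nlinarith
  have hcdR : (0 : ℝ) < c * d := by nlinarith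
  have hpR : (0 : ℝ) < p := by exact_mod_cast hp.pos
  set T := glueMatrix (M.map (Rat.cast : ℚ → ℝ)) (N.map (Rat.cast : ℚ → ℝ)) (p : ℝ) (t : ℝ) with hT
  set P : Matrix (Fin 3 ⊕ Fin 3) (Fin 3 ⊕ Fin 3) ℝ := Matrix.fromBlocks
    (Matrix.diagonal ![√(-a), √(-b), √(a * b)]) 0 0 (Matrix.diagonal ![√(-c), √(-d), √(c * d)]) with hP
  have hPdet : P.det = (a * b) * (c * d) := by
    rw [hP, Matrix.det_fromBlocks_zero₂₁, Matrix.det_diagonal, Matrix.det_diagonal]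
    simp only [Fin.prod_univ_three, Matrix.cons_val]
    rw [← Real.sqrt_mul haR.le, ← Real.sqrt_mul hcR.le]
    simp only [neg_mul_neg]
    rw [Real.mul_self_sqrt habR.le, Real.mul_self_sqrt hcdR.le]
  -- Each lattice has covolume $p/2$ for its norm, because its discriminant is $p^2$; the gluing has
  -- index $p$. Minkowski then needs $16p^3<(16\pi^2/9)p^3$, that is, $\pi>3$.
  have hdet : |(P * T).det| = p ^ 3 / 4 := by
    have e1 : |(a : ℝ) * b * M.det| = p / 2 := by
      simpa using congrArg (Rat.cast : ℚ → ℝ) hf.abs_det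
    have e2 : |(c : ℝ) * d * N.det| = p / 2 := by
      simpa using congrArg (Rat.cast : ℚ → ℝ) hg.abs_det
    rw [Matrix.det_mul, hPdet, hT, det_glueMatrix, cast_det, cast_det,
      show (a : ℝ) * b * (c * d) * (M.det * p * N.det) = (a * b * M.det) * (c * d * N.det) * p by ring,
      abs_mul, abs_mul, e1, e2, abs_of_pos hpR]
    ring
  have hvol := volume_ballThree hpR.le
  obtain ⟨n, hn, h1, h2⟩ := exists_int_mem_prod_convexBody (P * T)
    (by rw [← abs_pos, hdet]; positivity)
    (convex_ballThree hpR.le) (convex_ballThree hpR.le) (fun _ => neg_mem_ballThree)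
    (fun _ => neg_mem_ballThree) (by positivity) hvol hvol (by
      rw [hdet]
      have h3 : √(p : ℝ) ^ 3 * (Real.pi * 4 / 3) * (√(p : ℝ) ^ 3 * (Real.pi * 4 / 3)) =
          p ^ 3 * (Real.pi ^ 2 * 16 / 9) := by
        have : √(p : ℝ) ^ 2 = p := Real.sq_sqrt hpR.le
        calc _ = (√(p : ℝ) ^ 2) ^ 3 * (Real.pi ^ 2 * 16 / 9) := by ring
          _ = _ := by rw [this]
      rw [h3]
      have h4 : 9 < Real.pi ^ 2 := by nlinarith [Real.pi_gt_three]
      have h5 : (0 : ℝ) < p ^ 3 := by positivity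
      nlinarith)
  set X := glueFst M p t n with hX
  set Y := glueSnd N n with hY
  have k1 : pureNorm a b (X 0) (X 1) (X 2) < p := by
    have : ((pureNorm a b (X 0) (X 1) (X 2) : ℚ) : ℝ) < p := by
      refine lt_of_eq_of_lt ?_ h1
      simp only [← Matrix.mulVec_mulVec, hP, Matrix.fromBlocks_mulVec, Sum.elim_inl,
        Matrix.mulVec_diagonal, Matrix.zero_mulVec, add_zero, Function.comp_apply, hT,
        glueMatrix_mulVec_cast_inl, Matrix.cons_val, mul_pow, Real.sq_sqrt haR.le,
        Real.sq_sqrt hbR.le, Real.sq_sqrt habR.le, ← hX, pureNorm]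
      push_cast; ring
    exact_mod_cast this
  have k2 : pureNorm c d (Y 0) (Y 1) (Y 2) < p := by
    have : ((pureNorm c d (Y 0) (Y 1) (Y 2) : ℚ) : ℝ) < p := by
      refine lt_of_eq_of_lt ?_ h2
      simp only [← Matrix.mulVec_mulVec, hP, Matrix.fromBlocks_mulVec, Sum.elim_inr,
        Matrix.mulVec_diagonal, Matrix.zero_mulVec, zero_add, Function.comp_apply, hT,
        glueMatrix_mulVec_cast_inr, Matrix.cons_val, mul_pow, Real.sq_sqrt hcR.le,
        Real.sq_sqrt hdR.le, Real.sq_sqrt hcdR.le, ← hY, pureNorm]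
      push_cast; ring
    exact_mod_cast this
  have hform := glueForm_eq (p := p) hf.rep hg.rep t n
  -- Both norms lie in $[0,p)$ and their difference is a multiple of $p$.
  have hzero : glueForm f g p t n = 0 := by
    refine int_eq_zero_of_dvd_of_abs_lt (ht _ _ _ _ _ _) ?_
    have : |(glueForm f g p t n : ℚ)| < p := by
      rw [hform, abs_lt]
      have := pureNorm_nonneg (x := X 0) (y := X 1) (z := X 2) ha hb
      have := pureNorm_nonneg (x := Y 0) (y := Y 1) (z := Y 2) hc hd
      constructor <;> linarith
    exact_mod_cast this
  rw [hzero, Int.cast_zero] at hform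
  have heq := (sub_eq_zero.1 hform.symm)
  refine ⟨_, _, _, _, _, _, heq, fun h0 => hn ?_⟩
  obtain ⟨x0, x1, x2⟩ := eq_zero_of_pureNorm ha hb h0
  obtain ⟨y0, y1, y2⟩ := eq_zero_of_pureNorm hc hd (heq ▸ h0)
  refine glue_injective hf.rep.1 hg.rep.1 hp.ne_zero (t := t) ?_ ?_
  · intro i; fin_cases i <;> assumption
  · intro i; fin_cases i <;> assumption

end TernaryForm

/-! ### A common second generator -/

namespace TernaryForm

variable {f g : TernaryForm} {a b c d : ℚ} {M N : Matrix (Fin 3) (Fin 3) ℚ} {p : ℕ}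

/-- The image of `n` is a nonzero multiple of the diagonal vector `(i, i)`. -/
def IsDiagonalPoint (M N : Matrix (Fin 3) (Fin 3) ℚ) (p : ℕ) (t : ℤ) (s : ℚ)
    (n : Fin 3 ⊕ Fin 3 → ℤ) : Prop :=
  s ≠ 0 ∧ (glueMatrix M N (p : ℚ) t).mulVec (fun j => (n j : ℚ)) = Sum.elim ![s, 0, 0] ![s, 0, 0]

theorem exists_isDiagonalPoint (hM : M.det ≠ 0) (hN : N.det ≠ 0) (hp : p ≠ 0) (t : ℤ) :
    ∃ s n, IsDiagonalPoint M N p t s n := by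
  set T := glueMatrix M N (p : ℚ) (t : ℚ) with hT
  have hdet : IsUnit T.det := by
    rw [hT, det_glueMatrix]
    exact (mul_ne_zero (mul_ne_zero hM (by exact_mod_cast hp)) hN).isUnit
  obtain ⟨k, hk⟩ := IsLocalization.exist_integer_multiples_of_finite (nonZeroDivisors ℤ)
    (T⁻¹.mulVec (Sum.elim ![1, 0, 0] ![1, 0, 0]))
  choose n hn using hk
  have hk0 : ((k : ℤ) : ℚ) ≠ 0 := by exact_mod_cast nonZeroDivisors.coe_ne_zero k
  refine ⟨(k : ℤ), n, hk0, ?_⟩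
  have : (fun j => (n j : ℚ)) = ((k : ℤ) : ℚ) • T⁻¹.mulVec (Sum.elim ![1, 0, 0] ![1, 0, 0]) := by
    ext j
    have := hn j
    simp only [algebraMap_int_eq, eq_intCast, zsmul_eq_mul] at this
    rw [this]; rfl
  rw [this, Matrix.mulVec_smul, Matrix.mulVec_mulVec, Matrix.mul_nonsing_inv _ hdet,
    Matrix.one_mulVec]
  ext (i | i) <;> fin_cases i <;> simp

/-- Some nonzero point on the diagonal line has least coefficient. -/
theorem exists_minimal_isDiagonalPoint (hM : M.det ≠ 0) (hN : N.det ≠ 0) (hp : p ≠ 0) (t : ℤ) :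
    ∃ s n, IsDiagonalPoint M N p t s n ∧
      ∀ s' n', IsDiagonalPoint M N p t s' n' → |s| ≤ |s'| := by
  set T := glueMatrix M N (p : ℚ) (t : ℚ) with hT
  have hdet : T.det ≠ 0 := by
    rw [hT, det_glueMatrix]
    exact mul_ne_zero (mul_ne_zero hM (by exact_mod_cast hp)) hN
  -- The diagonal points lie on a line, so $|s|$ is proportional to the integer $\sum_j|n_j|$, which
  -- attains its minimum.
  have hne : {k : ℕ | ∃ s n, IsDiagonalPoint M N p t s n ∧ ∑ j, (n j).natAbs = k}.Nonempty := by
    obtain ⟨s, n, h⟩ := exists_isDiagonalPoint hM hN hp t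
    exact ⟨_, s, n, h, rfl⟩
  obtain ⟨s, n, h, hk⟩ := Nat.sInf_mem hne
  refine ⟨s, n, h, fun s' n' h' => ?_⟩
  by_contra! hlt
  have hmin := Nat.sInf_le (s := {k : ℕ | ∃ s n, IsDiagonalPoint M N p t s n ∧ ∑ j, (n j).natAbs = k})
    ⟨s', n', h', rfl⟩
  rw [← hk] at hmin
  have hz := Matrix.eq_zero_of_mulVec_eq_zero hdet
    (v := s • (fun j => (n' j : ℚ)) - s' • (fun j => (n j : ℚ))) (by
      rw [Matrix.mulVec_sub, Matrix.mulVec_smul, Matrix.mulVec_smul, hT, h.2, h'.2]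
      ext (i | i) <;> fin_cases i <;> simp <;> ring)
  have hj : ∀ j, |s| * ((n' j).natAbs : ℚ) = |s'| * ((n j).natAbs : ℚ) := by
    intro j
    have := congrFun hz j
    simp only [Pi.sub_apply, Pi.smul_apply, smul_eq_mul, Pi.zero_apply, sub_eq_zero] at this
    have := congrArg abs this
    rw [abs_mul, abs_mul] at this
    simpa [Nat.cast_natAbs] using this
  have hsum : |s| * (∑ j, ((n' j).natAbs : ℚ)) = |s'| * ∑ j, ((n j).natAbs : ℚ) := by
    rw [Finset.mul_sum, Finset.mul_sum]; exact Finset.sum_congr rfl fun j _ => hj j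
  have hmin' : (∑ j, ((n j).natAbs : ℚ)) ≤ ∑ j, ((n' j).natAbs : ℚ) := by exact_mod_cast hmin
  have hpos : 0 < ∑ j, ((n j).natAbs : ℚ) := by
    have : 0 < ∑ j, (n j).natAbs := by
      rw [Nat.pos_iff_ne_zero, Ne, Finset.sum_eq_zero_iff]
      intro h0
      have hn0 : (fun j => (n j : ℚ)) = 0 := by
        ext j; simpa using h0 j (Finset.mem_univ j)
      have := h.2
      rw [hn0, Matrix.mulVec_zero] at this
      exact h.1 (by simpa using (congrFun this (.inl 0)).symm)
    exact_mod_cast this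
  have hs : 0 < |s| := abs_pos.2 h.1
  nlinarith [abs_nonneg s']

theorem norm_two_nonneg {a b y z : ℚ} (ha : a < 0) (hb : b < 0) : 0 ≤ -b * y ^ 2 + a * b * z ^ 2 := by
  have := pureNorm_nonneg (x := 0) (y := y) (z := z) ha hb
  simp only [pureNorm] at this; linarith

/-- Two definite quaternion algebras ramified at the same prime and with a common pure quaternion
`i` have elements of equal nonzero norm that anticommute with `i`. -/
theorem exists_common_norm_orthogonal [Fact p.Prime] (ha : a < 0) (hb : b < 0) (hd : d < 0)
    (hf : f.IsAdapted p a b M) (hg : g.IsAdapted p a d N) :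
    ∃ y z y' z' : ℚ, pureNorm a b 0 y z = pureNorm a d 0 y' z' ∧ pureNorm a b 0 y z ≠ 0 := by
  have hp := (Fact.out : p.Prime)
  obtain ⟨t, ht⟩ := hf.exists_glue hg
  obtain ⟨s, n₀, hs, hmin⟩ := exists_minimal_isDiagonalPoint hf.rep.1 hg.rep.1 hp.ne_zero t
  have haR : (0 : ℝ) < -(a : ℝ) := by exact_mod_cast neg_pos.2 ha
  have hbR : (0 : ℝ) < -(b : ℝ) := by exact_mod_cast neg_pos.2 hb
  have hdR : (0 : ℝ) < -(d : ℝ) := by exact_mod_cast neg_pos.2 hd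
  have habR : (0 : ℝ) < a * b := by nlinarith
  have hadR : (0 : ℝ) < a * d := by nlinarith
  have hpR : (0 : ℝ) < p := by exact_mod_cast hp.pos
  have hsR : (0 : ℝ) < |(s : ℝ)| := abs_pos.2 (by exact_mod_cast hs.1)
  set T := glueMatrix (M.map (Rat.cast : ℚ → ℝ)) (N.map (Rat.cast : ℚ → ℝ)) (p : ℝ) (t : ℝ) with hT
  set E : Matrix (Fin 3) (Fin 3) ℝ := Matrix.diagonal ![1, 0, 0] with hE
  -- `S * P` sends the first coordinates $(X_0,Y_0)$ to $(X_0+Y_0,\,X_0-Y_0)$ and normalizes the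
  -- remaining ones. The factorization into block triangular matrices makes the determinant
  -- computable.
  set P : Matrix (Fin 3 ⊕ Fin 3) (Fin 3 ⊕ Fin 3) ℝ := Matrix.fromBlocks
    (Matrix.diagonal ![1, √(-b), √(a * b)]) E 0 (Matrix.diagonal ![-2, √(-d), √(a * d)]) with hP
  set S : Matrix (Fin 3 ⊕ Fin 3) (Fin 3 ⊕ Fin 3) ℝ := Matrix.fromBlocks 1 0 E 1 with hS
  have hSdet : S.det = 1 := by
    rw [hS, Matrix.det_fromBlocks_zero₁₂]; simp
  have hPdet : P.det = -2 * (-a * (b * d)) := by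
    rw [hP, Matrix.det_fromBlocks_zero₂₁, Matrix.det_diagonal, Matrix.det_diagonal]
    simp only [Fin.prod_univ_three, Matrix.cons_val]
    have h1 : √(a * b : ℝ) = √(-a) * √(-b) := by rw [← Real.sqrt_mul haR.le, neg_mul_neg]
    have h2 : √(a * d : ℝ) = √(-a) * √(-d) := by rw [← Real.sqrt_mul haR.le, neg_mul_neg]
    rw [h1, h2]
    calc _ = -2 * (√(-a : ℝ) ^ 2 * √(-b : ℝ) ^ 2 * √(-d : ℝ) ^ 2) := by ring
      _ = _ := by rw [Real.sq_sqrt haR.le, Real.sq_sqrt hbR.le, Real.sq_sqrt hdR.le]; ring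
  have hdet : |(S * P * T).det| = p ^ 3 / (2 * -a) := by
    have e1 : |(a : ℝ) * b * M.det| = p / 2 := by
      simpa using congrArg (Rat.cast : ℚ → ℝ) hf.abs_det
    have e2 : |(a : ℝ) * d * N.det| = p / 2 := by
      simpa using congrArg (Rat.cast : ℚ → ℝ) hg.abs_det
    have e3 : (-2 * (-a * (b * d)) * (M.det * p * N.det) : ℝ) =
        (a * b * M.det) * (a * d * N.det) * p * 2 / a := by
      have : (a : ℝ) ≠ 0 := by linarith [haR]
      field_simp
    rw [Matrix.det_mul, Matrix.det_mul, hSdet, hPdet, hT, det_glueMatrix, cast_det, cast_det, one_mul,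
      e3, abs_div, abs_mul, abs_mul, abs_mul, e1, e2, abs_of_pos hpR, abs_of_neg (neg_pos.1 haR),
      abs_two]
    field_simp
  -- This bound on $|X_0-Y_0|$ makes the pairing with the base point smaller than $p$; the bound
  -- $2|s|$ on $|X_0+Y_0|$ is what minimality of $|s|$ can exclude. The factor $|s|$ cancels from
  -- the volume, and Minkowski needs only $64<8\pi^2$.
  have hα₂ : 0 < (p : ℝ) / (2 * -a * |(s : ℝ)|) := by positivity
  obtain ⟨n, hn, h1, h2⟩ := exists_int_mem_prod_convexBody (S * P * T)
    (by rw [← abs_pos, hdet]; positivity)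
    (convex_cylinderThree hpR.le) (convex_cylinderThree hpR.le) (fun _ => neg_mem_cylinderThree)
    (fun _ => neg_mem_cylinderThree) (by positivity)
    (volume_cylinderThree (α := 2 * |(s : ℝ)|) (by positivity) hpR.le)
    (volume_cylinderThree hα₂.le hpR.le) (by
      rw [hdet]
      have h3 : 2 * (2 * |(s : ℝ)|) * (p * Real.pi) * (2 * (p / (2 * -a * |(s : ℝ)|)) * (p * Real.pi)) =
          p ^ 3 / (2 * -a) * (8 * Real.pi ^ 2) := by
        field_simp
        ring
      rw [h3, mul_comm (64 : ℝ)]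
      have h4 : 9 < Real.pi ^ 2 := by nlinarith [Real.pi_gt_three]
      exact mul_lt_mul_of_pos_left (by linarith) (by positivity))
  set X := glueFst M p t n with hX
  set Y := glueSnd N n with hY
  simp only [← Matrix.mulVec_mulVec, hP, hS, hE, Matrix.fromBlocks_mulVec, Sum.elim_inl,
    Matrix.mulVec_diagonal, Matrix.zero_mulVec, add_zero, Function.comp_apply, hT,
    glueMatrix_mulVec_cast_inl, glueMatrix_mulVec_cast_inr, Matrix.cons_val, ← hX, ← hY,
    cylinderThree, Set.mem_ofPred_eq, Matrix.one_mulVec, Pi.add_apply, Sum.elim_inr, Sum.elim_comp_inl,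
    Sum.elim_comp_inr, zero_mul, one_mul, zero_add, mul_pow,
    Real.sq_sqrt hbR.le, Real.sq_sqrt hdR.le, Real.sq_sqrt habR.le, Real.sq_sqrt hadR.le] at h1 h2
  obtain ⟨h1, k1⟩ := h1
  obtain ⟨h2, k2⟩ := h2
  have h1' : |X 0 + Y 0| < 2 * |s| := by exact_mod_cast h1
  have k1' : -b * X 1 ^ 2 + a * b * X 2 ^ 2 < p := by exact_mod_cast k1
  have k2' : -d * Y 1 ^ 2 + a * d * Y 2 ^ 2 < p := by exact_mod_cast k2
  have h2' : |X 0 - Y 0| * (2 * -a * |s|) < p := by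
    rw [lt_div_iff₀ (by positivity)] at h2
    have e : (X 0 : ℝ) + Y 0 + -2 * Y 0 = X 0 - Y 0 := by ring
    rw [e] at h2
    exact_mod_cast h2
  -- the image of the base point
  have hs1 : ∀ i, glueFst M p t n₀ i = ![s, 0, 0] i := fun i => by
    have := congrFun hs.2 (.inl i)
    rw [glueMatrix_mulVec_inl] at this
    exact this
  have hs2 : ∀ i, glueSnd N n₀ i = ![s, 0, 0] i := fun i => by
    have := congrFun hs.2 (.inr i)
    rw [glueMatrix_mulVec_inr] at this
    exact this
  have hadd1 : ∀ i, glueFst M p t (n + n₀) i = X i + ![s, 0, 0] i := fun i => by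
    rw [← hs1, hX]; simp only [glueFst, Pi.add_apply]; push_cast; ring
  have hadd2 : ∀ i, glueSnd N (n + n₀) i = Y i + ![s, 0, 0] i := fun i => by
    rw [← hs2, hY]; simp only [glueSnd, Pi.add_apply]; push_cast; ring
  have hform := glueForm_eq (p := p) hf.rep hg.rep t n
  have hform₀ := glueForm_eq (p := p) hf.rep hg.rep t n₀
  have hform₁ := glueForm_eq (p := p) hf.rep hg.rep t (n + n₀)
  rw [← hX, ← hY] at hform
  rw [hs1, hs1, hs1, hs2, hs2, hs2] at hform₀
  rw [hadd1, hadd1, hadd1, hadd2, hadd2, hadd2] at hform₁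
  simp only [pureNorm, Matrix.cons_val] at hform hform₀ hform₁
  -- Polarizing against the diagonal point isolates $X_0-Y_0$. The value is a multiple of $p$ and
  -- smaller than $p$, so $X_0=Y_0$, and the form becomes the difference of the two orthogonal
  -- norms.
  have hpolar : ((glueForm f g p t (n + n₀) - glueForm f g p t n - glueForm f g p t n₀ : ℤ) : ℚ) =
      (X 0 - Y 0) * (2 * -a * s) := by
    push_cast
    rw [hform, hform₀, hform₁]; ring
  have hzero₁ : glueForm f g p t (n + n₀) - glueForm f g p t n - glueForm f g p t n₀ = 0 := by
    refine int_eq_zero_of_dvd_of_abs_lt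
      (dvd_sub (dvd_sub (ht _ _ _ _ _ _) (ht _ _ _ _ _ _)) (ht _ _ _ _ _ _)) ?_
    have : |((glueForm f g p t (n + n₀) - glueForm f g p t n - glueForm f g p t n₀ : ℤ) : ℚ)| < p := by
      rw [hpolar, abs_mul, abs_mul, abs_mul, abs_two, abs_of_pos (neg_pos.2 ha)]
      exact h2'
    exact_mod_cast this
  have hXY : X 0 = Y 0 := by
    rw [hzero₁, Int.cast_zero] at hpolar
    have h3 : (2 * -a * s) ≠ 0 := mul_ne_zero (mul_ne_zero two_ne_zero (neg_ne_zero.2 ha.ne)) hs.1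
    exact sub_eq_zero.1 ((mul_eq_zero.1 hpolar.symm).resolve_right h3)
  have hzero : glueForm f g p t n = 0 := by
    refine int_eq_zero_of_dvd_of_abs_lt (ht _ _ _ _ _ _) ?_
    have : |(glueForm f g p t n : ℚ)| < p := by
      rw [hform, hXY, abs_lt]
      have := norm_two_nonneg (y := X 1) (z := X 2) ha hb
      have := norm_two_nonneg (y := Y 1) (z := Y 2) ha hd
      constructor <;> linarith
    exact_mod_cast this
  rw [hzero, Int.cast_zero, hXY] at hform
  have heq : pureNorm a b 0 (X 1) (X 2) = pureNorm a d 0 (Y 1) (Y 2) := by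
    simp only [pureNorm]; linarith
  refine ⟨_, _, _, _, heq, fun h0 => hn ?_⟩
  obtain ⟨-, x1, x2⟩ := eq_zero_of_pureNorm ha hb h0
  obtain ⟨-, y1, y2⟩ := eq_zero_of_pureNorm ha hd (heq ▸ h0)
  -- With vanishing orthogonal parts, `n` would be a diagonal point with $|X_0|<|s|$.
  have hX0 : X 0 = 0 := by
    by_contra hne
    have := hmin (X 0) n ⟨hne, by
      ext (i | i)
      · rw [glueMatrix_mulVec_inl]
        change X i = _
        fin_cases i
        exacts [rfl, x1, x2]
      · rw [glueMatrix_mulVec_inr]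
        change Y i = _
        fin_cases i
        exacts [hXY.symm, y1, y2]⟩
    rw [← hXY, ← two_mul, abs_mul, abs_two] at h1'
    linarith
  refine glue_injective hf.rep.1 hg.rep.1 hp.ne_zero (t := t) ?_ ?_
  · intro i; fin_cases i
    exacts [hX0, x1, x2]
  · intro i; fin_cases i
    exacts [hXY.symm.trans hX0, y1, y2]

end TernaryForm

/-! ### Uniqueness of the definite algebra of discriminant p -/

/-- The quaternion algebra `(a, b / ℚ)` is definite and ramified exactly at the finite prime `p`. -/
structure IsDefiniteRamifiedAt (p : ℕ) (a b : ℚ) : Prop where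
  neg_left : a < 0
  neg_right : b < 0
  ramified : ∀ (l : ℕ) [Fact l.Prime], IsDivision ℍ[ℚ_[l], (a : ℚ_[l]), (b : ℚ_[l])] ↔ l = p

theorem IsDefiniteRamifiedAt.isDivision {p : ℕ} {a b : ℚ} (h : IsDefiniteRamifiedAt p a b) :
    IsDivision ℍ[ℚ, a, b] := by
  rw [isDivision_quat_iff]
  intro x hx
  have hR := isDivision_real_of_neg (c := a) (d := b) (by exact_mod_cast h.neg_left)
    (by exact_mod_cast h.neg_right)
  have := isDivision_quat_iff.1 hR ⟨x.re, x.imI, x.imJ, x.imK⟩ (by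
    simp only [quatNorm] at hx ⊢
    exact_mod_cast hx)
  simp only [QuaternionAlgebra.ext_iff, QuaternionAlgebra.re_zero, QuaternionAlgebra.imI_zero,
    QuaternionAlgebra.imJ_zero, QuaternionAlgebra.imK_zero, Rat.cast_eq_zero] at this
  ext
  exacts [this.1, this.2.1, this.2.2.1, this.2.2.2]

theorem IsDefiniteRamifiedAt.congr {p : ℕ} {a b c d : ℚ} (h : IsDefiniteRamifiedAt p a b)
    (e : ℍ[ℚ, a, b] ≃ₐ[ℚ] ℍ[ℚ, c, d]) : IsDefiniteRamifiedAt p c d := by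
  have hR := isDivision_real_of_neg (c := a) (d := b) (by exact_mod_cast h.neg_left)
    (by exact_mod_cast h.neg_right)
  have hR' := neg_of_isDivision_real ((isDivision_baseChange_quat_iff ℝ c d).1
    (((isDivision_baseChange_quat_iff ℝ a b).2 hR).baseChange_congr e))
  refine ⟨by exact_mod_cast hR'.1, by exact_mod_cast hR'.2, fun l _ => ?_⟩
  rw [← h.ramified l, ← isDivision_baseChange_quat_iff, ← isDivision_baseChange_quat_iff]
  exact ⟨fun h => h.baseChange_congr e.symm, fun h => h.baseChange_congr e⟩

theorem IsDefiniteRamifiedAt.exists_isAdapted {p : ℕ} [Fact p.Prime] (hp2 : p ≠ 2) {a b : ℚ}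
    (h : IsDefiniteRamifiedAt p a b) :
    ∃ (f : TernaryForm) (M : Matrix (Fin 3) (Fin 3) ℚ), f.IsAdapted p a b M := by
  obtain ⟨A, B, C, D, E, F, M, h1, h2, h3⟩ := TernaryForm.exists_adapted hp2 h.neg_left.ne
    h.neg_right.ne
    (fun l _ hl => exists_pureNorm_eq_zero_of_not_isDivision
      (by exact_mod_cast h.neg_right.ne) (fun hd => hl ((h.ramified l).1 hd)))
    (fun x y z h0 => pureNorm_anisotropic_of_isDivision ((h.ramified p).2 rfl) h0)
  exact ⟨_, M, h1, h2, ⟨A, rfl⟩, ⟨B, rfl⟩, ⟨D, rfl⟩, ⟨E, rfl⟩, ⟨F, rfl⟩, h3⟩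

theorem quat_pure_sq {F : Type*} [Field F] {a b x y z : F} :
    (⟨0, x, y, z⟩ : ℍ[F, a, b]) * ⟨0, x, y, z⟩ = algebraMap F _ (-pureNorm a b x y z) := by
  ext <;> simp [pureNorm, QuaternionAlgebra.algebraMap_eq] <;> ring

theorem IsDefiniteRamifiedAt.exists_equiv_of_pureNorm {p : ℕ} {a b : ℚ}
    (h : IsDefiniteRamifiedAt p a b) {x y z : ℚ} (h0 : pureNorm a b x y z ≠ 0) :
    ∃ d : ℚ, Nonempty (ℍ[ℚ, -pureNorm a b x y z, d] ≃ₐ[ℚ] ℍ[ℚ, a, b]) := by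
  have := h.isDivision.isDomain
  obtain ⟨hc, -, hf⟩ := isQuaternionAlgebra_quat h.neg_left.ne h.isDivision
  refine exists_quat_equiv_of_sq hf quat_pure_sq ?_
  rintro ⟨r, hr⟩
  simp only [QuaternionAlgebra.ext_iff, QuaternionAlgebra.algebraMap_eq] at hr
  apply h0
  simp [pureNorm, ← hr.2.1, ← hr.2.2.1, ← hr.2.2.2]

theorem IsDefiniteRamifiedAt.equiv_of_orthogonal {p : ℕ} {a b : ℚ}
    (h : IsDefiniteRamifiedAt p a b) {y z : ℚ} (h0 : pureNorm a b 0 y z ≠ 0) :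
    Nonempty (ℍ[ℚ, a, -pureNorm a b 0 y z] ≃ₐ[ℚ] ℍ[ℚ, a, b]) := by
  have := h.isDivision.isDomain
  refine nonempty_quat_equiv_of_anticommute (QuaternionAlgebra.finrank_eq_four _ _ _)
    (i := ⟨0, 1, 0, 0⟩) (j := ⟨0, 0, y, z⟩) ?_ quat_pure_sq ?_ ?_ ?_
  · ext <;> simp [QuaternionAlgebra.algebraMap_eq]
  · ext <;> simp
  · simp [QuaternionAlgebra.ext_iff]
  · intro hj
    simp only [QuaternionAlgebra.ext_iff, QuaternionAlgebra.imJ_zero,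
      QuaternionAlgebra.imK_zero] at hj
    apply h0
    simp [pureNorm, hj.2.2.1, hj.2.2.2]

/-- A common pure norm lets both algebras be rewritten with the same first parameter `m`. Adapted
forms are then chosen afresh for these presentations, and a common orthogonal norm equalizes the
second parameter. -/
theorem IsDefiniteRamifiedAt.nonempty_equiv {p : ℕ} [Fact p.Prime] (hp2 : p ≠ 2) {a b c d : ℚ}
    (h : IsDefiniteRamifiedAt p a b) (h' : IsDefiniteRamifiedAt p c d) :
    Nonempty (ℍ[ℚ, a, b] ≃ₐ[ℚ] ℍ[ℚ, c, d]) := by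
  obtain ⟨f, M, hf⟩ := h.exists_isAdapted hp2
  obtain ⟨g, N, hg⟩ := h'.exists_isAdapted hp2
  obtain ⟨x, y, z, x', y', z', heq, h0⟩ := TernaryForm.exists_common_norm h.neg_left h.neg_right
    h'.neg_left h'.neg_right hf hg
  obtain ⟨b₁, ⟨e⟩⟩ := h.exists_equiv_of_pureNorm h0
  obtain ⟨d₁, ⟨e'⟩⟩ := h'.exists_equiv_of_pureNorm (heq ▸ h0)
  rw [← heq] at e'
  set m := -pureNorm a b x y z
  have h₁ := h.congr e.symm
  have h₁' := h'.congr e'.symm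
  obtain ⟨f₁, M₁, hf₁⟩ := h₁.exists_isAdapted hp2
  obtain ⟨g₁, N₁, hg₁⟩ := h₁'.exists_isAdapted hp2
  obtain ⟨y, z, y', z', heq₁, h0₁⟩ := TernaryForm.exists_common_norm_orthogonal h₁.neg_left
    h₁.neg_right h₁'.neg_right hf₁ hg₁
  obtain ⟨e₁⟩ := h₁.equiv_of_orthogonal h0₁
  obtain ⟨e₁'⟩ := h₁'.equiv_of_orthogonal (heq₁ ▸ h0₁)
  rw [← heq₁] at e₁'
  exact ⟨((e.symm.trans e₁.symm).trans e₁').trans e'⟩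

/-- A definite quaternion algebra over `ℚ` of prime discriminant `p ≠ 2` is determined by `p`. -/
theorem IsDefiniteRamifiedAt.nonempty_equiv_of_discriminant {p : ℕ} [Fact p.Prime] (hp2 : p ≠ 2)
    {a b : ℚ} (h : IsDefiniteRamifiedAt p a b) {B : Type*} [Ring B] [Algebra ℚ B]
    (hB : IsQuaternionAlgebra B) (hdef : IsDefinite B) (hdisc : discriminant B = p) :
    Nonempty (B ≃ₐ[ℚ] ℍ[ℚ, a, b]) := by
  obtain ⟨c, d, hc, hd, ⟨e⟩⟩ := exists_quat_equiv_of_isDefinite hB hdef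
  have h' : IsDefiniteRamifiedAt p c d := by
    refine ⟨hc, hd, fun l _ => ?_⟩
    rw [← (discriminant_eq_prime_iff Fact.out).1 hdisc l, ← isRamifiedAt_quat_iff]
    exact ⟨fun h => IsDivision.baseChange_congr e _ h,
      fun h => IsDivision.baseChange_congr e.symm _ h⟩
  obtain ⟨e'⟩ := h'.nonempty_equiv hp2 h
  exact ⟨e.symm.trans e'⟩

theorem IsDefiniteRamifiedAt.isDefinite {p : ℕ} {a b : ℚ} (h : IsDefiniteRamifiedAt p a b) :
    IsDefinite ℍ[ℚ, a, b] :=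
  (isDivision_baseChange_quat_iff ℝ a b).2 (isDivision_real_of_neg
    (by exact_mod_cast h.neg_left) (by exact_mod_cast h.neg_right))

theorem IsDefiniteRamifiedAt.discriminant_eq {p : ℕ} (hp : p.Prime) {a b : ℚ}
    (h : IsDefiniteRamifiedAt p a b) : discriminant ℍ[ℚ, a, b] = p := by
  rw [discriminant_eq_prime_iff hp]
  intro l _
  rw [isRamifiedAt_quat_iff, h.ramified]

/-! ### Trace and norm identities, matrix units -/

namespace Quat

section Basic

variable {F : Type*} [Field F] {a b : ℤ}

theorem trd_eq (x : Quat F a b) : trd x = 2 * x.re := by simp [trd]; ring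

theorem nrd_eq (x : Quat F a b) : nrd x = quatNorm x := by simp [nrd, quatNorm]; ring

theorem trd_add (x y : Quat F a b) : trd (x + y) = trd x + trd y := by simp [trd_eq]; ring
theorem trd_sub (x y : Quat F a b) : trd (x - y) = trd x - trd y := by simp [trd_eq]; ring
theorem trd_smul (c : F) (x : Quat F a b) : trd (c • x) = c * trd x := by simp [trd_eq]; ring
theorem trd_one : trd (1 : Quat F a b) = 2 := by simp [trd_eq]
theorem trd_zero : trd (0 : Quat F a b) = 0 := by simp [trd_eq]
theorem trd_mul_comm (x y : Quat F a b) : trd (x * y) = trd (y * x) := by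
  simp only [trd_eq, QuaternionAlgebra.re_mul]; ring

theorem nrd_mul (x y : Quat F a b) : nrd (x * y) = nrd x * nrd y := by
  rw [nrd_eq, nrd_eq, nrd_eq, quatNorm_mul]

theorem star_eq (x : Quat F a b) : star x = trd x • (1 : Quat F a b) - x := by
  ext <;> simp [trd_eq]; ring

theorem nrd_add (x y : Quat F a b) : nrd (x + y) = nrd x + trd (x * star y) + nrd y := by
  simp [nrd_eq, quatNorm, trd_eq]; ring

theorem nrd_smul (c : F) (x : Quat F a b) : nrd (c • x) = c ^ 2 * nrd x := by
  simp [nrd_eq, quatNorm]; ring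

theorem star_mul_self (x : Quat F a b) : star x * x = nrd x • (1 : Quat F a b) := by
  rw [quat_star_mul, nrd_eq, Algebra.algebraMap_eq_smul_one]

theorem mul_self_eq (x : Quat F a b) : x * x = trd x • x - nrd x • (1 : Quat F a b) := by
  rw [← star_mul_self, star_eq, sub_mul, smul_mul_assoc, one_mul, sub_sub_cancel]

/-- For null `e` one has `star (e * x) * e = star x * (star e * e) = 0`; expand `star (e * x)` as
trace minus element. -/
theorem mul_mul_self_of_nrd_eq_zero {e : Quat F a b} (he : nrd e = 0) (x : Quat F a b) :
    e * x * e = trd (e * x) • e := by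
  have h := star_eq (e * x)
  have h2 : star (e * x) * e = 0 := by
    rw [star_mul, mul_assoc, star_mul_self, he, zero_smul, mul_zero]
  rw [h, sub_mul, smul_mul_assoc, one_mul, sub_eq_zero] at h2
  exact h2.symm

theorem linearIndependent_of_det_ne_zero {e : Fin 4 → Quat F a b}
    (h : (Matrix.of fun m n => trd (e m * e n)).det ≠ 0) : LinearIndependent F e := by
  rw [Fintype.linearIndependent_iff]
  intro c hc
  have : Matrix.vecMul c (Matrix.of fun m n => trd (e m * e n)) = 0 := by
    ext n
    have h2 : trd ((∑ m, c m • e m) * e n) = 0 := by rw [hc, zero_mul, trd_zero]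
    simpa [Matrix.vecMul, dotProduct, Fin.sum_univ_four, add_mul, trd_add, smul_mul_assoc, trd_smul]
      using h2
  exact congrFun (Matrix.eq_zero_of_vecMul_eq_zero h this)

/-- An element whose one-sided multiples by `i` and `j` are scalar multiples of it vanishes. -/
theorem eq_zero_of_mul_eq_smul [CharZero F] (ha : (a : F) ≠ 0) (hb : (b : F) ≠ 0) {x : Quat F a b}
    {s t : F} (h1 : x * ⟨0, 1, 0, 0⟩ = s • x) (h2 : x * ⟨0, 0, 1, 0⟩ = t • x) : x = 0 := by
  -- Computing `x * k` through `k = i * j` and through `k = -(j * i)` gives opposite scalar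
  -- multiples of `x`; hence `x * k = 0`, with `k` invertible.
  have h3 : x * ⟨0, 0, 0, 1⟩ = (s * t) • x := by
    have : (⟨0, 0, 0, 1⟩ : Quat F a b) = ⟨0, 1, 0, 0⟩ * ⟨0, 0, 1, 0⟩ := by ext <;> simp
    rw [this, ← mul_assoc, h1, smul_mul_assoc, h2, smul_smul]
  have h4 : x * ⟨0, 0, 0, 1⟩ = -((s * t) • x) := by
    have : (⟨0, 0, 0, 1⟩ : Quat F a b) = -(⟨0, 0, 1, 0⟩ * ⟨0, 1, 0, 0⟩) := by ext <;> simp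
    rw [this, mul_neg, ← mul_assoc, h2, smul_mul_assoc, h1, smul_smul, mul_comm]
  have h5 : x * ⟨0, 0, 0, 1⟩ = 0 := by
    have : x * ⟨0, 0, 0, 1⟩ + x * ⟨0, 0, 0, 1⟩ = 0 := by nth_rw 1 [h3]; rw [h4]; abel
    rw [← two_smul F] at this
    exact (smul_eq_zero.1 this).resolve_left two_ne_zero
  have hu : IsUnit (⟨0, 0, 0, 1⟩ : Quat F a b) := quat_isUnit_of_norm_ne_zero (by
    simp [quatNorm, ha, hb])
  exact hu.mul_left_eq_zero.1 h5

end Basic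

/-- A system of `2 × 2` matrix units. -/
structure MatrixUnits {F : Type*} [Field F] {a b : ℤ} (e s t e' : Quat F a b) : Prop where
  add : e + e' = 1
  ee : e * e = e
  ss : s * s = 0
  tt : t * t = 0
  st : s * t = e
  ts : t * s = e'
  trd_e : trd e = 1

namespace MatrixUnits

variable {F : Type*} [Field F] {a b : ℤ} {e s t e' : Quat F a b}

theorem eq_sub (h : MatrixUnits e s t e') : e' = 1 - e := eq_sub_of_add_eq' h.add
theorem ee' (h : MatrixUnits e s t e') : e * e' = 0 := by rw [h.eq_sub, mul_sub, mul_one, h.ee, sub_self]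
theorem e'e (h : MatrixUnits e s t e') : e' * e = 0 := by rw [h.eq_sub, sub_mul, one_mul, h.ee, sub_self]
theorem e'e' (h : MatrixUnits e s t e') : e' * e' = e' := by
  nth_rw 1 [h.eq_sub]; rw [sub_mul, one_mul, h.ee', sub_zero]
theorem te' (h : MatrixUnits e s t e') : t * e' = 0 := by rw [← h.ts, ← mul_assoc, h.tt, zero_mul]
theorem se (h : MatrixUnits e s t e') : s * e = 0 := by rw [← h.st, ← mul_assoc, h.ss, zero_mul]
theorem e's (h : MatrixUnits e s t e') : e' * s = 0 := by rw [← h.ts, mul_assoc, h.ss, mul_zero]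
theorem et (h : MatrixUnits e s t e') : e * t = 0 := by rw [← h.st, mul_assoc, h.tt, mul_zero]
theorem es (h : MatrixUnits e s t e') : e * s = s := by
  have := h.e's; rwa [h.eq_sub, sub_mul, one_mul, sub_eq_zero, eq_comm] at this
theorem se' (h : MatrixUnits e s t e') : s * e' = s := by
  rw [h.eq_sub, mul_sub, mul_one, h.se, sub_zero]
theorem te (h : MatrixUnits e s t e') : t * e = t := by
  have := h.te'; rwa [h.eq_sub, mul_sub, mul_one, sub_eq_zero, eq_comm] at this
theorem e't (h : MatrixUnits e s t e') : e' * t = t := by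
  rw [h.eq_sub, sub_mul, one_mul, h.et, sub_zero]
theorem trd_s (h : MatrixUnits e s t e') : trd s = 0 := by
  rw [← h.es, trd_mul_comm, h.se, trd_zero]
theorem trd_t (h : MatrixUnits e s t e') : trd t = 0 := by
  rw [← h.te, trd_mul_comm, h.et, trd_zero]
theorem trd_e' (h : MatrixUnits e s t e') : trd e' = 1 := by
  rw [h.eq_sub, trd_sub, trd_one, h.trd_e]; norm_num

/-- The linear map from matrices defined by matrix units. -/
def toLinear (e s t e' : Quat F a b) : Matrix (Fin 2) (Fin 2) F →ₗ[F] Quat F a b where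
  toFun M := M 0 0 • e + M 0 1 • s + M 1 0 • t + M 1 1 • e'
  map_add' M N := by simp only [Matrix.add_apply, add_smul]; abel
  map_smul' c M := by simp only [Matrix.smul_apply, smul_eq_mul, mul_smul, smul_add]; rfl

theorem toLinear_apply (M : Matrix (Fin 2) (Fin 2) F) :
    toLinear e s t e' M = M 0 0 • e + M 0 1 • s + M 1 0 • t + M 1 1 • e' := rfl

theorem toLinear_mul (h : MatrixUnits e s t e') (M N : Matrix (Fin 2) (Fin 2) F) :
    toLinear e s t e' (M * N) = toLinear e s t e' M * toLinear e s t e' N := by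
  simp only [toLinear_apply, Matrix.mul_apply, Fin.sum_univ_two, add_mul, mul_add, smul_mul_assoc,
    mul_smul_comm, h.ee, h.es, h.et, h.ee', h.se, h.ss, h.st, h.se', h.te, h.ts, h.tt, h.te', h.e'e,
    h.e's, h.e't, h.e'e', smul_zero, add_zero, zero_add, add_smul]
  module

theorem trd_e_mul (h : MatrixUnits e s t e') (M : Matrix (Fin 2) (Fin 2) F) :
    trd (e * toLinear e s t e' M) = M 0 0 := by
  simp [toLinear_apply, mul_add, h.ee, h.es, h.et, h.ee', trd_add, trd_smul,
    h.trd_e, h.trd_s]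
theorem trd_t_mul (h : MatrixUnits e s t e') (M : Matrix (Fin 2) (Fin 2) F) :
    trd (t * toLinear e s t e' M) = M 0 1 := by
  simp [toLinear_apply, mul_add, h.te, h.ts, h.tt, h.te', trd_add, trd_smul,
    h.trd_e', h.trd_t]
theorem trd_s_mul (h : MatrixUnits e s t e') (M : Matrix (Fin 2) (Fin 2) F) :
    trd (s * toLinear e s t e' M) = M 1 0 := by
  simp [toLinear_apply, mul_add, h.se, h.ss, h.st, h.se', trd_add, trd_smul,
    h.trd_e, h.trd_s]
theorem trd_e'_mul (h : MatrixUnits e s t e') (M : Matrix (Fin 2) (Fin 2) F) :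
    trd (e' * toLinear e s t e' M) = M 1 1 := by
  simp [toLinear_apply, mul_add, h.e'e, h.e's, h.e't, h.e'e', trd_add, trd_smul,
    h.trd_e', h.trd_t]

/-- The matrix entries are traces against the matrix units, so elements of an order containing the
units have integral entries. -/
theorem exists_equiv (h : MatrixUnits e s t e') :
    ∃ φ : Quat F a b ≃ₐ[F] Matrix (Fin 2) (Fin 2) F, ∀ x,
      φ x 0 0 = trd (e * x) ∧ φ x 0 1 = trd (t * x) ∧ φ x 1 0 = trd (s * x) ∧
      φ x 1 1 = trd (e' * x) ∧ x = φ x 0 0 • e + φ x 0 1 • s + φ x 1 0 • t + φ x 1 1 • e' := by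
  let ψ : Matrix (Fin 2) (Fin 2) F →ₐ[F] Quat F a b :=
    AlgHom.ofLinearMap (toLinear e s t e') (by simp [toLinear_apply, h.add]) h.toLinear_mul
  have hinj : Function.Injective ψ := by
    intro M N hMN
    have hMN' : toLinear e s t e' M = toLinear e s t e' N := hMN
    ext i j
    fin_cases i <;> fin_cases j
    · exact (h.trd_e_mul M).symm.trans (hMN' ▸ h.trd_e_mul N)
    · exact (h.trd_t_mul M).symm.trans (hMN' ▸ h.trd_t_mul N)
    · exact (h.trd_s_mul M).symm.trans (hMN' ▸ h.trd_s_mul N)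
    · exact (h.trd_e'_mul M).symm.trans (hMN' ▸ h.trd_e'_mul N)
  have hsurj : Function.Surjective ψ :=
    (LinearMap.injective_iff_surjective_of_finrank_eq_finrank (f := ψ.toLinearMap)
      (by rw [QuaternionAlgebra.finrank_eq_four, Module.finrank_matrix]; simp)).1 hinj
  let Ψ := AlgEquiv.ofBijective ψ ⟨hinj, hsurj⟩
  refine ⟨Ψ.symm, fun x => ?_⟩
  obtain ⟨M, rfl⟩ := Ψ.surjective x
  rw [Ψ.symm_apply_apply]
  have hM : Ψ M = toLinear e s t e' M := rfl
  rw [hM]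
  exact ⟨(h.trd_e_mul M).symm, (h.trd_t_mul M).symm, (h.trd_s_mul M).symm, (h.trd_e'_mul M).symm, rfl⟩

end MatrixUnits

end Quat

/-! ### Local orders of unit discriminant are maximal and split -/

namespace Quat

variable {a b : ℤ} {l : ℕ} [Fact l.Prime]

theorem padicInt_smul_eq (c : ℤ_[l]) (x : Quat ℚ_[l] a b) : c • x = (c : ℚ_[l]) • x := by
  ext <;> exact Algebra.smul_def _ _

/-- `L` is an order in `(a, b / ℚ_l)` with basis `E`, with unit discriminant. -/
structure IsUnimodularOrder (L : Submodule ℤ_[l] (Quat ℚ_[l] a b))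
    (E : Fin 4 → Quat ℚ_[l] a b) : Prop where
  span : Submodule.span ℤ_[l] (Set.range E) = L
  one_mem : 1 ∈ L
  mul_mem : ∀ x ∈ L, ∀ y ∈ L, x * y ∈ L
  trd_le : ∀ m, ‖trd (E m)‖ ≤ 1
  nrd_le : ∀ m, ‖nrd (E m)‖ ≤ 1
  det : ‖(Matrix.of fun m n => trd (E m * E n)).det‖ = 1

namespace IsUnimodularOrder

variable {L : Submodule ℤ_[l] (Quat ℚ_[l] a b)} {E : Fin 4 → Quat ℚ_[l] a b}

theorem mem_iff (h : IsUnimodularOrder L E) (x : Quat ℚ_[l] a b) :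
    x ∈ L ↔ ∃ c : Fin 4 → ℤ_[l], x = ∑ m, (c m : ℚ_[l]) • E m := by
  rw [← h.span, Submodule.mem_span_range_iff_exists_fun]
  simp only [padicInt_smul_eq, eq_comm]

theorem basis_mem (h : IsUnimodularOrder L E) (m : Fin 4) : E m ∈ L := by
  rw [← h.span]; exact Submodule.subset_span ⟨m, rfl⟩

theorem smul_mem (_h : IsUnimodularOrder L E) {c : ℚ_[l]} (hc : ‖c‖ ≤ 1) {x : Quat ℚ_[l] a b}
    (hx : x ∈ L) : c • x ∈ L := by
  obtain ⟨d, rfl⟩ : ∃ d : ℤ_[l], (d : ℚ_[l]) = c := ⟨⟨c, hc⟩, rfl⟩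
  rw [← padicInt_smul_eq]
  exact L.smul_mem d hx

theorem norm_trd_le (h : IsUnimodularOrder L E) {x : Quat ℚ_[l] a b} (hx : x ∈ L) :
    ‖trd x‖ ≤ 1 := by
  rw [← h.span] at hx
  induction hx using Submodule.span_induction with
  | mem x hx => obtain ⟨m, rfl⟩ := hx; exact h.trd_le m
  | zero => simp [trd_zero]
  | add x y _ _ hx hy =>
    rw [trd_add]
    exact (Padic.nonarchimedean _ _).trans (max_le hx hy)
  | smul c x _ hx =>
    rw [padicInt_smul_eq, trd_smul, norm_mul]
    exact mul_le_one₀ (PadicInt.norm_le_one c) (norm_nonneg _) hx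

theorem star_mem (h : IsUnimodularOrder L E) {x : Quat ℚ_[l] a b} (hx : x ∈ L) : star x ∈ L := by
  rw [star_eq]
  exact L.sub_mem (h.smul_mem (h.norm_trd_le hx) h.one_mem) hx

theorem norm_nrd_le (h : IsUnimodularOrder L E) {x : Quat ℚ_[l] a b} (hx : x ∈ L) :
    ‖nrd x‖ ≤ 1 := by
  have hx' := hx
  rw [← h.span] at hx
  induction hx using Submodule.span_induction with
  | mem x hx => obtain ⟨m, rfl⟩ := hx; exact h.nrd_le m
  | zero => simp [nrd_eq, quatNorm]
  | add x y hx hy ihx ihy =>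
    rw [h.span] at hx hy
    rw [nrd_add]
    refine (Padic.nonarchimedean _ _).trans (max_le ?_ (ihy hy))
    exact (Padic.nonarchimedean _ _).trans
      (max_le (ihx hx) (h.norm_trd_le (h.mul_mem _ hx _ (h.star_mem hy))))
  | smul c x hx ih =>
    rw [h.span] at hx
    rw [padicInt_smul_eq, nrd_smul, norm_mul, norm_pow]
    exact mul_le_one₀ (pow_le_one₀ (norm_nonneg _) (PadicInt.norm_le_one c)) (norm_nonneg _) (ih hx)

/-- The Gram matrix of the trace form over `ℤ_l`. -/
noncomputable def gram (h : IsUnimodularOrder L E) : Matrix (Fin 4) (Fin 4) ℤ_[l] :=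
  Matrix.of fun m n => ⟨trd (E m * E n), h.norm_trd_le (h.mul_mem _ (h.basis_mem m) _ (h.basis_mem n))⟩

theorem isUnit_det_gram (h : IsUnimodularOrder L E) : IsUnit h.gram.det := by
  rw [PadicInt.isUnit_iff, ← h.det]
  have := RingHom.map_det (PadicInt.Coe.ringHom (p := l)) h.gram
  change ‖((h.gram.det : ℤ_[l]) : ℚ_[l])‖ = _
  exact congrArg norm this

theorem trd_sum_mul (c : Fin 4 → ℚ_[l]) (y : Quat ℚ_[l] a b) :
    trd ((∑ m, c m • E m) * y) = ∑ m, c m * trd (E m * y) := by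
  simp only [Fin.sum_univ_four, add_mul, trd_add, smul_mul_assoc, trd_smul]

/-- The Gram matrix is invertible over $\mathbb Z_l$, so a primitive vector pairs with some basis
element to a unit, by which one divides. -/
theorem exists_trd_eq_one_of_primitive (h : IsUnimodularOrder L E) (c : Fin 4 → ℤ_[l])
    (hc : ∃ m, ‖c m‖ = 1) : ∃ y ∈ L, trd ((∑ m, (c m : ℚ_[l]) • E m) * y) = 1 := by
  obtain ⟨m₀, hm₀⟩ := hc
  obtain ⟨n, hn⟩ : ∃ n, ‖Matrix.vecMul c h.gram n‖ = 1 := by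
    by_contra! hcon
    have hlt : ∀ n, ‖Matrix.vecMul c h.gram n‖ < 1 := fun n =>
      lt_of_le_of_ne (PadicInt.norm_le_one _) (hcon n)
    have hmem : ∀ n, Matrix.vecMul c h.gram n ∈ IsLocalRing.maximalIdeal ℤ_[l] := fun n => by
      rw [IsLocalRing.mem_maximalIdeal, PadicInt.mem_nonunits]; exact hlt n
    have hcg : Matrix.vecMul (Matrix.vecMul c h.gram) h.gram⁻¹ = c := by
      rw [Matrix.vecMul_vecMul, Matrix.mul_nonsing_inv _ h.isUnit_det_gram, Matrix.vecMul_one]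
    have : c m₀ ∈ IsLocalRing.maximalIdeal ℤ_[l] := by
      rw [← hcg]
      generalize Matrix.vecMul c h.gram = d at hmem ⊢
      simp only [Matrix.vecMul, dotProduct]
      exact Ideal.sum_mem _ fun n _ => Ideal.mul_mem_right _ _ (hmem n)
    rw [IsLocalRing.mem_maximalIdeal, PadicInt.mem_nonunits, hm₀] at this
    exact lt_irrefl _ this
  have hval : trd ((∑ m, (c m : ℚ_[l]) • E m) * E n) = (Matrix.vecMul c h.gram n : ℤ_[l]) := by
    rw [trd_sum_mul]
    simp only [Matrix.vecMul, dotProduct, gram, Fin.sum_univ_four]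
    push_cast
    rfl
  have hne : trd ((∑ m, (c m : ℚ_[l]) • E m) * E n) ≠ 0 := by
    rw [hval]
    intro h0
    have : ‖((Matrix.vecMul c h.gram n : ℤ_[l]) : ℚ_[l])‖ = 1 := hn
    rw [h0, norm_zero] at this
    exact zero_ne_one this
  refine ⟨(trd ((∑ m, (c m : ℚ_[l]) • E m) * E n))⁻¹ • E n, h.smul_mem ?_ (h.basis_mem n), ?_⟩
  · rw [norm_inv, hval]
    have : ‖((Matrix.vecMul c h.gram n : ℤ_[l]) : ℚ_[l])‖ = 1 := hn
    rw [this, inv_one]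
  · rw [mul_smul_comm, trd_smul, inv_mul_cancel₀ hne]

theorem linearIndependent (h : IsUnimodularOrder L E) : LinearIndependent ℚ_[l] E :=
  linearIndependent_of_det_ne_zero fun h0 => by
    have := h.det
    rw [h0, norm_zero] at this
    exact zero_ne_one this

theorem exists_primitive_smul (h : IsUnimodularOrder L E) {x : Quat ℚ_[l] a b} (hx : x ≠ 0) :
    ∃ t : ℚ_[l], t ≠ 0 ∧ t • x ∈ L ∧ ∃ y ∈ L, trd ((t • x) * y) = 1 := by
  have hspan : x ∈ Submodule.span ℚ_[l] (Set.range E) := by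
    rw [h.linearIndependent.span_eq_top_of_card_eq_finrank
      (by rw [QuaternionAlgebra.finrank_eq_four]; rfl)]
    trivial
  obtain ⟨c, rfl⟩ := (Submodule.mem_span_range_iff_exists_fun _).1 hspan
  obtain ⟨m, -, hm⟩ := Finset.exists_max_image Finset.univ (fun m => ‖c m‖) ⟨0, Finset.mem_univ 0⟩
  have hm0 : c m ≠ 0 := by
    intro h0
    apply hx
    refine Finset.sum_eq_zero fun n _ => ?_
    have := hm n (Finset.mem_univ n)
    rw [h0, norm_zero, norm_le_zero_iff] at this
    rw [this, zero_smul]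
  have hpos : 0 < ‖c m‖ := norm_pos_iff.2 hm0
  let c' : Fin 4 → ℤ_[l] := fun n => ⟨(c m)⁻¹ * c n, by
    rw [norm_mul, norm_inv, inv_mul_le_iff₀ hpos, mul_one]; exact hm n (Finset.mem_univ n)⟩
  have e : (c m)⁻¹ • ∑ n, c n • E n = ∑ n, (c' n : ℚ_[l]) • E n := by
    rw [Finset.smul_sum]
    exact Finset.sum_congr rfl fun n _ => smul_smul _ _ _
  refine ⟨(c m)⁻¹, inv_ne_zero hm0, ?_, ?_⟩
  · rw [e, h.mem_iff]; exact ⟨c', rfl⟩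
  · rw [e]
    refine h.exists_trd_eq_one_of_primitive c' ⟨m, ?_⟩
    change ‖(c m)⁻¹ * c m‖ = 1
    rw [inv_mul_cancel₀ hm0, norm_one]

theorem nrd_sum (c : Fin 4 → ℚ_[l]) :
    nrd (∑ m, c m • E m) = ∑ m, ∑ n, (if m = n then nrd (E m) else
      if m < n then trd (E m * star (E n)) else 0) * (c m * c n) := by
  simp only [Fin.sum_univ_four, nrd_add, nrd_smul, add_mul, smul_mul_assoc, mul_smul_comm,
    trd_add, trd_smul, QuaternionAlgebra.star_smul]
  simp
  ring

/-- Chevalley–Warning gives a primitive $x$ with $\mathrm{nrd}\,x\equiv0$. If $\mathrm{trd}(xy)=1$,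
then $\mathrm{nrd}(x+t\bar y)=\mathrm{nrd}\,x+t+t^2\,\mathrm{nrd}\,y$ has a small root $t$ by
Hensel. The result is nonzero, since its trace against $y$ is congruent to 1. -/
theorem exists_nrd_eq_zero (h : IsUnimodularOrder L E) :
    ∃ x : Quat ℚ_[l] a b, x ≠ 0 ∧ nrd x = 0 := by
  have hle : ∀ m n, ‖(if m = n then nrd (E m) else
      if m < n then trd (E m * star (E n)) else 0)‖ ≤ 1 := fun m n => by
    split_ifs
    · exact h.nrd_le m
    · exact h.norm_trd_le (h.mul_mem _ (h.basis_mem m) _ (h.star_mem (h.basis_mem n)))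
    · simp
  obtain ⟨C, hC⟩ : ∃ C : Fin 4 → Fin 4 → ℤ_[l], ∀ m n, (C m n : ℚ_[l]) =
      if m = n then nrd (E m) else if m < n then trd (E m * star (E n)) else 0 :=
    ⟨fun m n => ⟨_, hle m n⟩, fun m n => rfl⟩
  obtain ⟨v, hv, hv0⟩ := exists_ne_zero_quadratic_eq_zero (p := l) (ι := Fin 4) (by simp)
    (fun m n => PadicInt.toZMod (C m n))
  choose c hc using fun m => ZMod.ringHom_surjective (PadicInt.toZMod (p := l)) (v m)
  have hnorm : ‖∑ m, ∑ n, C m n * (c m * c n)‖ < 1 := by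
    rw [TernaryForm.norm_lt_one_iff_toZMod]
    simpa [hc] using hv0
  have hprim : ∃ m, ‖c m‖ = 1 := by
    by_contra! hcon
    apply hv
    ext m
    rw [← hc m]
    exact (TernaryForm.norm_lt_one_iff_toZMod _).1
      (lt_of_le_of_ne (PadicInt.norm_le_one _) (hcon m))
  set x := ∑ m, (c m : ℚ_[l]) • E m with hx
  have hxL : x ∈ L := (h.mem_iff x).2 ⟨c, rfl⟩
  obtain ⟨y, hy, hxy⟩ := h.exists_trd_eq_one_of_primitive c hprim
  rw [← hx] at hxy
  have hnx : nrd x = ((∑ m, ∑ n, C m n * (c m * c n) : ℤ_[l]) : ℚ_[l]) := by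
    rw [hx, nrd_sum]
    simp only [PadicInt.coe_sum, PadicInt.coe_mul, hC]
  obtain ⟨t, ht, h0⟩ := exists_root_quadratic (∑ m, ∑ n, C m n * (c m * c n)) 1
    ⟨nrd y, h.norm_nrd_le hy⟩ (norm_one) hnorm
  have h0' : nrd x + (t : ℚ_[l]) * 1 + (t : ℚ_[l]) ^ 2 * nrd y = 0 := by
    rw [hnx]
    exact_mod_cast congrArg (Subtype.val) h0
  refine ⟨x + (t : ℚ_[l]) • star y, ?_, ?_⟩
  · intro hzero
    have h1 : trd ((x + (t : ℚ_[l]) • star y) * y) = 0 := by rw [hzero, zero_mul, trd_zero]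
    rw [add_mul, trd_add, hxy, smul_mul_assoc, trd_smul] at h1
    have h2 : ‖(t : ℚ_[l]) * trd (star y * y)‖ < 1 := by
      rw [norm_mul]
      exact mul_lt_one_of_nonneg_of_lt_one_left (norm_nonneg _) ht
        (h.norm_trd_le (h.mul_mem _ (h.star_mem hy) _ hy))
    have h3 : (t : ℚ_[l]) * trd (star y * y) = -1 := by linear_combination h1
    rw [h3, norm_neg, norm_one] at h2
    exact lt_irrefl _ h2
  · rw [nrd_add, nrd_smul, QuaternionAlgebra.star_smul, star_star, mul_smul_comm, trd_smul, hxy]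
    have : nrd (star y) = nrd y := by simp [nrd_eq, quatNorm]
    rw [this]
    linear_combination h0'

/-- An order of unit discriminant contains a full system of matrix units. -/
theorem exists_matrixUnits (h : IsUnimodularOrder L E) (ha : a ≠ 0) (hb : b ≠ 0) :
    ∃ e ∈ L, ∃ s ∈ L, ∃ t ∈ L, ∃ e' ∈ L, MatrixUnits e s t e' := by
  have haF : (a : ℚ_[l]) ≠ 0 := by exact_mod_cast ha
  have hbF : (b : ℚ_[l]) ≠ 0 := by exact_mod_cast hb
  obtain ⟨x, hx, hx0⟩ := h.exists_nrd_eq_zero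
  obtain ⟨r, -, hrL, y, hy, hxy⟩ := h.exists_primitive_smul hx
  have heL := h.mul_mem _ hrL _ hy
  have hen : nrd ((r • x) * y) = 0 := by rw [nrd_mul, nrd_smul, hx0]; ring
  generalize (r • x) * y = e at hxy heL hen
  -- Norm 0 and trace 1 make `e` a root of $X^2-X$.
  have hee : e * e = e := by rw [mul_self_eq, hen, hxy, one_smul, zero_smul, sub_zero]
  have hsand := fun x => mul_mul_self_of_nrd_eq_zero hen x
  obtain ⟨e', he'⟩ : ∃ e', e' = 1 - e := ⟨_, rfl⟩
  have he'L : e' ∈ L := he' ▸ L.sub_mem h.one_mem heL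
  have hse' : star e = e' := by rw [star_eq, hxy, one_smul, he']
  have he'n : nrd e' = 0 := by rw [← hse']; simpa [nrd_eq, quatNorm] using hen
  have hsand' := fun x => mul_mul_self_of_nrd_eq_zero he'n x
  have hee' : e * e' = 0 := by rw [he', mul_sub, mul_one, hee, sub_self]
  have he'e : e' * e = 0 := by rw [he', sub_mul, one_mul, hee, sub_self]
  have he'e' : e' * e' = e' := by nth_rw 1 [he']; rw [sub_mul, one_mul, hee', sub_zero]
  -- Otherwise right multiplication by `i` and `j` would act on `e` by scalars, forcing `e = 0`.
  obtain ⟨w, hw⟩ : ∃ w, e * w * e' ≠ 0 := by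
    by_contra! hcon
    have key : ∀ w, e * w = trd (e * w) • e := fun w => by
      rw [← hsand w]
      have := hcon w
      rw [he', mul_sub, mul_one, sub_eq_zero] at this
      exact this
    have := eq_zero_of_mul_eq_smul haF hbF (key ⟨0, 1, 0, 0⟩) (key ⟨0, 0, 1, 0⟩)
    rw [this, trd_zero] at hxy
    exact zero_ne_one hxy
  obtain ⟨r', -, hsL, z, hz, hsz⟩ := h.exists_primitive_smul hw
  obtain ⟨s, hs⟩ : ∃ s, s = r' • (e * w * e') := ⟨_, rfl⟩
  rw [← hs] at hsL hsz
  have hes : e * s = s := by rw [hs, mul_smul_comm, ← mul_assoc, ← mul_assoc, hee]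
  have hse'' : s * e' = s := by rw [hs, smul_mul_assoc, mul_assoc _ e', he'e']
  have hs_e : s * e = 0 := by rw [← hse'', mul_assoc, he'e, mul_zero]
  -- With $\mathrm{trd}(sz)=1$, the compression $e'ze$ is the unit opposite to $s$; sandwiching by
  -- the null elements $e$ and $e'$ evaluates both products.
  refine ⟨e, heL, s, hsL, e' * z * e, h.mul_mem _ (h.mul_mem _ he'L _ hz) _ heL, e', he'L,
    ⟨by rw [he']; abel, hee, ?_, ?_, ?_, ?_, hxy⟩⟩
  · calc s * s = s * (e * s) := by rw [hes]
      _ = 0 := by rw [← mul_assoc, hs_e, zero_mul]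
  · calc e' * z * e * (e' * z * e) = e' * z * (e * e') * (z * e) := by noncomm_ring
      _ = 0 := by rw [hee', mul_zero, zero_mul]
  · calc s * (e' * z * e) = (s * e') * z * e := by noncomm_ring
      _ = e * (s * z) * e := by rw [hse'', ← mul_assoc, hes]
      _ = e := by rw [hsand, ← mul_assoc, hes, hsz, one_smul]
  · calc e' * z * e * s = e' * z * (e * s) := by noncomm_ring
      _ = e' * (z * s) * e' := by
        rw [hes, mul_assoc, mul_assoc e' (z * s), mul_assoc z, hse'']
      _ = e' := by
        rw [hsand', trd_mul_comm, mul_assoc, hse'', trd_mul_comm, hsz, one_smul]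

theorem isLocalEichler (h : IsUnimodularOrder L E) (ha : a ≠ 0) (hb : b ≠ 0) :
    IsLocalEichler L 0 := by
  obtain ⟨e, he, s, hs, t, ht, e', he', hU⟩ := h.exists_matrixUnits ha hb
  obtain ⟨φ, hφ⟩ := hU.exists_equiv
  refine ⟨φ, fun x => ?_⟩
  obtain ⟨h1, h2, h3, h4, h5⟩ := hφ x
  constructor
  · intro hx
    have hall : ∀ m n, ‖φ x m n‖ ≤ 1 := by
      intro m n
      fin_cases m <;> fin_cases n
      · exact h1 ▸ h.norm_trd_le (h.mul_mem _ he _ hx)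
      · exact h2 ▸ h.norm_trd_le (h.mul_mem _ ht _ hx)
      · exact h3 ▸ h.norm_trd_le (h.mul_mem _ hs _ hx)
      · exact h4 ▸ h.norm_trd_le (h.mul_mem _ he' _ hx)
    exact ⟨hall, by simpa using hall 1 0⟩
  · rintro ⟨hall, -⟩
    rw [h5]
    exact L.add_mem (L.add_mem (L.add_mem (h.smul_mem (hall 0 0) he) (h.smul_mem (hall 0 1) hs))
      (h.smul_mem (hall 1 0) ht)) (h.smul_mem (hall 1 1) he')

theorem not_isDivision (h : IsUnimodularOrder L E) : ¬ IsDivision (Quat ℚ_[l] a b) := by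
  intro hd
  obtain ⟨x, hx, h0⟩ := h.exists_nrd_eq_zero
  exact hx (isDivision_quat_iff.1 hd x (nrd_eq x ▸ h0))

end IsUnimodularOrder

end Quat

/-! ### Anisotropic p-adic forms without cancellation -/

section PadicForms

variable {p : ℕ} [Fact p.Prime]

/-- In valuations: $\alpha+2v(s)\ge V\ge\alpha+2m-1$, and parity rounds this up to $v(s)\ge m$. The
slack 1 in the hypothesis is this rounding. -/
theorem Padic.norm_le_norm_pow_of_sq_le {α V m : ℕ} (h : α + 2 * m ≤ V + 1) {s : ℚ_[p]}
    (hs : ‖(p : ℚ_[p])‖ ^ α * ‖s‖ ^ 2 ≤ ‖(p : ℚ_[p])‖ ^ V) : ‖s‖ ≤ ‖(p : ℚ_[p])‖ ^ m := by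
  have hp1 : (1 : ℝ) < p := by exact_mod_cast (Fact.out : p.Prime).one_lt
  have hp0 : (p : ℝ) ≠ 0 := by positivity
  by_cases h0 : s = 0
  · rw [h0, norm_zero]; positivity
  rw [Padic.norm_p, Padic.norm_eq_zpow_neg_valuation h0] at *
  rw [← zpow_natCast, ← zpow_natCast, ← zpow_natCast, inv_zpow', inv_zpow', ← zpow_mul,
    ← zpow_add₀ hp0, zpow_le_zpow_iff_right₀ hp1] at hs
  rw [← zpow_natCast, inv_zpow', zpow_le_zpow_iff_right₀ hp1]
  push_cast at hs
  omega

theorem Padic.norm_sq_eq_mul_norm_sq {s t : ℚ_[p]} (h : ‖s‖ ^ 2 = ‖(p : ℚ_[p])‖ * ‖t‖ ^ 2) :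
    s = 0 ∧ t = 0 := by
  have hp1 : (1 : ℝ) < p := by exact_mod_cast (Fact.out : p.Prime).one_lt
  have hp0 : (p : ℝ) ≠ 0 := by positivity
  by_cases ht : t = 0
  · subst ht; simpa using h
  by_cases hs : s = 0
  · subst hs
    have : ‖(p : ℚ_[p])‖ ≠ 0 := by rw [Padic.norm_p]; positivity
    simp [ht] at h
    exact absurd h (Fact.out : p.Prime).ne_zero
  exfalso
  rw [Padic.norm_p, Padic.norm_eq_zpow_neg_valuation hs, Padic.norm_eq_zpow_neg_valuation ht,
    ← zpow_natCast, ← zpow_natCast, ← zpow_neg_one, ← zpow_mul, ← zpow_mul, ← zpow_add₀ hp0] at h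
  have := zpow_right_injective₀ (by positivity) hp1.ne' h
  push_cast at this
  omega

/-- `q` is a unit, so only terms of equal norm could cancel. Then $s/t$ is a unit, and cancellation
would make $-q$ a square modulo $p$. -/
theorem Padic.norm_sq_add_mul_sq {q : ℤ} (hq : ¬ IsSquare (-(q : ZMod p))) (s t : ℚ_[p]) :
    ‖s ^ 2 + q * t ^ 2‖ = max (‖s‖ ^ 2) (‖t‖ ^ 2) := by
  have hq0 : (q : ZMod p) ≠ 0 := fun h => hq (by rw [h, neg_zero]; exact IsSquare.zero)
  have hqn : ‖(q : ℚ_[p])‖ = 1 := by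
    refine le_antisymm (Padic.norm_int_le_one q) (not_lt.1 fun h => hq0 ?_)
    rw [Padic.norm_intCast_lt_one_iff] at h
    exact (ZMod.intCast_zmod_eq_zero_iff_dvd q p).2 h
  have h2 : ‖(q : ℚ_[p]) * t ^ 2‖ = ‖t‖ ^ 2 := by rw [norm_mul, hqn, one_mul, norm_pow]
  by_cases hst : ‖s‖ = ‖t‖
  · by_cases ht : t = 0
    · subst ht
      have : s = 0 := by simpa using hst
      simp [this]
    have ht' : ‖t‖ ≠ 0 := norm_ne_zero_iff.2 ht
    let u : ℤ_[p] := ⟨s / t, by rw [norm_div, hst, div_self ht']⟩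
    have hu : ‖u ^ 2 + (q : ℤ_[p])‖ = 1 := by
      refine le_antisymm (PadicInt.norm_le_one _) (not_lt.1 fun h => hq ?_)
      rw [TernaryForm.norm_lt_one_iff_toZMod, map_add, map_pow, map_intCast] at h
      exact ⟨PadicInt.toZMod u, by linear_combination -h⟩
    have hu' : ‖(s / t) ^ 2 + (q : ℚ_[p])‖ = 1 := by
      rw [← hu]
      change _ = ‖((u ^ 2 + (q : ℤ_[p]) : ℤ_[p]) : ℚ_[p])‖
      push_cast
      rfl
    have : s ^ 2 + q * t ^ 2 = ((s / t) ^ 2 + q) * t ^ 2 := by field_simp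
    rw [this, norm_mul, hu', hst, max_self, one_mul, norm_pow]
  · have hne : ‖s ^ 2‖ ≠ ‖(q : ℚ_[p]) * t ^ 2‖ := by
      rw [h2, norm_pow]
      exact fun h => hst ((pow_left_inj₀ (norm_nonneg _) (norm_nonneg _) two_ne_zero).1 h)
    rw [Padic.add_eq_max_of_ne hne, h2, norm_pow]

/-- The two binary parts have valuations of opposite parity, so they have equal norm only if both
vanish. -/
theorem Padic.norm_quaternary {q : ℤ} (hq : ¬ IsSquare (-(q : ZMod p))) (s t u v : ℚ_[p]) :
    ‖s ^ 2 + q * t ^ 2 + p * (u ^ 2 + q * v ^ 2)‖ =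
      max (max (‖s‖ ^ 2) (‖t‖ ^ 2)) (‖(p : ℚ_[p])‖ * max (‖u‖ ^ 2) (‖v‖ ^ 2)) := by
  have hsq : ∀ s t : ℚ_[p], ∃ w : ℚ_[p], max (‖s‖ ^ 2) (‖t‖ ^ 2) = ‖w‖ ^ 2 := fun s t => by
    rcases max_choice (‖s‖ ^ 2) (‖t‖ ^ 2) with h | h
    · exact ⟨s, h⟩
    · exact ⟨t, h⟩
  have h1 := Padic.norm_sq_add_mul_sq hq s t
  have h2 : ‖(p : ℚ_[p]) * (u ^ 2 + q * v ^ 2)‖ = ‖(p : ℚ_[p])‖ * max (‖u‖ ^ 2) (‖v‖ ^ 2) := by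
    rw [norm_mul, Padic.norm_sq_add_mul_sq hq u v]
  by_cases hne : ‖s ^ 2 + q * t ^ 2‖ = ‖(p : ℚ_[p]) * (u ^ 2 + q * v ^ 2)‖
  · rw [h1, h2] at hne
    obtain ⟨w, hw⟩ := hsq s t
    obtain ⟨w', hw'⟩ := hsq u v
    rw [hw, hw'] at hne
    obtain ⟨rfl, rfl⟩ := Padic.norm_sq_eq_mul_norm_sq hne
    rw [hw] at h1
    rw [hw'] at h2
    simp only [norm_zero, ne_eq, OfNat.ofNat_ne_zero, not_false_eq_true, zero_pow, mul_zero,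
      norm_eq_zero] at h1 h2
    rw [h1, h2, hw, hw']
    simp
  · rw [Padic.add_eq_max_of_ne hne, h1, h2]

end PadicForms

/-! ### Residually inert orders in coordinates -/

namespace Quat

variable {p : ℕ} [Fact p.Prime] {a b : ℤ}

/-- The norm form of `(a, b / ℚ_p)` is strongly anisotropic: no cancellation occurs. -/
def HasDiagonalNorm (p : ℕ) [Fact p.Prime] (a b : ℤ) : Prop :=
  ∀ x : Quat ℚ_[p] a b, ‖nrd x‖ =
    max (max (‖x.re‖ ^ 2) (‖(a : ℚ_[p])‖ * ‖x.imI‖ ^ 2))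
      (max (‖(b : ℚ_[p])‖ * ‖x.imJ‖ ^ 2) (‖(a : ℚ_[p])‖ * ‖(b : ℚ_[p])‖ * ‖x.imK‖ ^ 2))

theorem hasDiagonalNorm_unramified_left {q : ℤ} (hq : ¬ IsSquare (-(q : ZMod p))) :
    HasDiagonalNorm p (-q) (-p) := fun x => by
  have hqn : ‖(q : ℚ_[p])‖ = 1 := by simpa using Padic.norm_sq_add_mul_sq hq 0 1
  have h : nrd x = x.re ^ 2 + q * x.imI ^ 2 + p * (x.imJ ^ 2 + q * x.imK ^ 2) := by
    rw [nrd_eq, quatNorm]; push_cast; ring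
  rw [h, Padic.norm_quaternary hq, mul_max_of_nonneg _ _ (norm_nonneg _)]
  simp [hqn]

/-- Here $k^2=-qp^2$, so $k/p$ generates the unramified extension and takes the part played by $i$
in the odd case. -/
theorem hasDiagonalNorm_unramified_neither {q : ℤ} (hq : ¬ IsSquare (-(q : ZMod p))) :
    HasDiagonalNorm p (-(q * p)) (-p) := fun x => by
  have hqn : ‖(q : ℚ_[p])‖ = 1 := by simpa using Padic.norm_sq_add_mul_sq hq 0 1
  have h : nrd x = x.re ^ 2 + q * (p * x.imK) ^ 2 + p * (x.imJ ^ 2 + q * x.imI ^ 2) := by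
    rw [nrd_eq, quatNorm]; push_cast; ring
  rw [h, Padic.norm_quaternary hq, mul_max_of_nonneg _ _ (norm_nonneg _)]
  push_cast
  simp only [norm_neg, norm_mul, hqn, one_mul, mul_pow]
  rw [max_assoc, max_assoc, ← pow_two]
  congr 1
  rw [max_comm, max_comm (_ * ‖x.imJ‖ ^ 2), max_assoc]

theorem hasDiagonalNorm_unramified_right {q : ℤ} (hq : ¬ IsSquare (-(q : ZMod p))) :
    HasDiagonalNorm p (-p) (-q) := fun x => by
  have hqn : ‖(q : ℚ_[p])‖ = 1 := by simpa using Padic.norm_sq_add_mul_sq hq 0 1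
  have h : nrd x = x.re ^ 2 + q * x.imJ ^ 2 + p * (x.imI ^ 2 + q * x.imK ^ 2) := by
    rw [nrd_eq, quatNorm]; push_cast; ring
  rw [h, Padic.norm_quaternary hq, mul_max_of_nonneg _ _ (norm_nonneg _)]
  push_cast
  simp only [norm_neg, hqn, one_mul, mul_one]
  rw [max_max_max_comm]

namespace HasDiagonalNorm

theorem re_le (h : HasDiagonalNorm p a b) (x : Quat ℚ_[p] a b) : ‖x.re‖ ^ 2 ≤ ‖nrd x‖ := by
  rw [h x]; exact le_max_of_le_left (le_max_left _ _)
theorem imI_le (h : HasDiagonalNorm p a b) (x : Quat ℚ_[p] a b) :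
    ‖(a : ℚ_[p])‖ * ‖x.imI‖ ^ 2 ≤ ‖nrd x‖ := by
  rw [h x]; exact le_max_of_le_left (le_max_right _ _)
theorem imJ_le (h : HasDiagonalNorm p a b) (x : Quat ℚ_[p] a b) :
    ‖(b : ℚ_[p])‖ * ‖x.imJ‖ ^ 2 ≤ ‖nrd x‖ := by
  rw [h x]; exact le_max_of_le_right (le_max_left _ _)
theorem imK_le (h : HasDiagonalNorm p a b) (x : Quat ℚ_[p] a b) :
    ‖(a : ℚ_[p])‖ * ‖(b : ℚ_[p])‖ * ‖x.imK‖ ^ 2 ≤ ‖nrd x‖ := by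
  rw [h x]; exact le_max_of_le_right (le_max_right _ _)

theorem isDivision (h : HasDiagonalNorm p a b) (ha : a ≠ 0) (hb : b ≠ 0) :
    IsDivision (Quat ℚ_[p] a b) := by
  rw [isDivision_quat_iff]
  intro x hx
  have ha' : 0 < ‖(a : ℚ_[p])‖ := norm_pos_iff.2 (by exact_mod_cast ha)
  have hb' : 0 < ‖(b : ℚ_[p])‖ := norm_pos_iff.2 (by exact_mod_cast hb)
  have hx' : ‖nrd x‖ = 0 := by rw [nrd_eq, hx, norm_zero]
  have key : ∀ {c : ℝ} {s : ℚ_[p]}, 0 < c → c * ‖s‖ ^ 2 ≤ 0 → s = 0 := fun {c s} hc hs => by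
    have h1 : ‖s‖ ^ 2 ≤ 0 := nonpos_of_mul_nonpos_right hs hc
    exact norm_eq_zero.1 (pow_eq_zero_iff two_ne_zero |>.1 (le_antisymm h1 (by positivity)))
  ext
  · exact key one_pos (by rw [one_mul, ← hx']; exact h.re_le x)
  · exact key ha' (by rw [← hx']; exact h.imI_le x)
  · exact key hb' (by rw [← hx']; exact h.imJ_le x)
  · exact key (mul_pos ha' hb') (by rw [← hx']; exact h.imK_le x)

theorem norm_nrd_add_le (h : HasDiagonalNorm p a b) {x y : Quat ℚ_[p] a b} {C : ℝ}
    (hx : ‖nrd x‖ ≤ C) (hy : ‖nrd y‖ ≤ C) : ‖nrd (x + y)‖ ≤ C := by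
  have key : ∀ {c : ℝ} {s t : ℚ_[p]}, 0 ≤ c → c * ‖s‖ ^ 2 ≤ C → c * ‖t‖ ^ 2 ≤ C →
      c * ‖s + t‖ ^ 2 ≤ C := fun {c s t} hc hs ht => by
    rcases le_max_iff.1 (Padic.nonarchimedean s t) with h | h
    · exact le_trans (by gcongr) hs
    · exact le_trans (by gcongr) ht
  rw [h (x + y)]
  refine max_le (max_le ?_ ?_) (max_le ?_ ?_)
  · simpa using key zero_le_one (by simpa using (h.re_le x).trans hx)
      (by simpa using (h.re_le y).trans hy)
  · exact key (norm_nonneg _) ((h.imI_le x).trans hx) ((h.imI_le y).trans hy)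
  · exact key (norm_nonneg _) ((h.imJ_le x).trans hx) ((h.imJ_le y).trans hy)
  · exact key (by positivity) ((h.imK_le x).trans hx) ((h.imK_le y).trans hy)

theorem norm_nrd_le_of_mem_span (h : HasDiagonalNorm p a b) {S : Set (Quat ℚ_[p] a b)} {C : ℝ}
    (hC : 0 ≤ C) (hS : ∀ x ∈ S, ‖nrd x‖ ≤ C) {x : Quat ℚ_[p] a b}
    (hx : x ∈ Submodule.span ℤ_[p] S) : ‖nrd x‖ ≤ C := by
  induction hx using Submodule.span_induction with
  | mem x hx => exact hS x hx
  | zero => simpa [nrd_eq, quatNorm] using hC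
  | add x y _ _ hx hy => exact h.norm_nrd_add_le hx hy
  | smul c x _ hx =>
    rw [padicInt_smul_eq, nrd_smul, norm_mul, norm_pow]
    exact (mul_le_of_le_one_left (norm_nonneg _)
      (pow_le_one₀ (norm_nonneg _) (PadicInt.norm_le_one c))).trans hx

theorem isIntegral_iff (h : HasDiagonalNorm p a b) (x : Quat ℚ_[p] a b) :
    IsIntegral ℤ_[p] x ↔ ‖nrd x‖ ≤ 1 := by
  constructor
  · intro hx
    obtain ⟨S, hS⟩ := hx.fg_adjoin_singleton
    -- The powers of an integral element lie in a finitely generated module, on which the norm is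
    -- bounded; multiplicativity then excludes a norm above 1.
    have hb : ∀ n : ℕ, ‖nrd x‖ ^ n ≤ ∑ y ∈ S, ‖nrd y‖ := fun n => by
      have hmem : x ^ n ∈ Submodule.span ℤ_[p] (S : Set (Quat ℚ_[p] a b)) := by
        rw [hS]
        exact Subalgebra.pow_mem _ (Algebra.self_mem_adjoin_singleton _ _) n
      have := h.norm_nrd_le_of_mem_span (Finset.sum_nonneg fun y _ => norm_nonneg (nrd y))
        (fun y hy => Finset.single_le_sum (f := fun y => ‖nrd y‖) (fun y _ => norm_nonneg _) hy)
        hmem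
      refine le_trans (le_of_eq ?_) this
      clear this hmem
      induction n with
      | zero => simp [nrd_eq, quatNorm]
      | succ n ih => rw [pow_succ, ih, pow_succ, nrd_mul, norm_mul]
    by_contra hcon
    obtain ⟨n, hn⟩ := pow_unbounded_of_one_lt (∑ y ∈ S, ‖nrd y‖) (not_le.1 hcon)
    exact absurd (hb n) (not_le.2 hn)
  · intro hx
    have hre : ‖trd x‖ ≤ 1 := by
      have h1 : ‖x.re‖ ≤ 1 := by
        have := (h.re_le x).trans hx
        exact (sq_le_one_iff₀ (norm_nonneg _)).1 this
      rw [trd_eq, two_mul]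
      exact (Padic.nonarchimedean _ _).trans (max_le h1 h1)
    let t : ℤ_[p] := ⟨trd x, hre⟩
    let n : ℤ_[p] := ⟨nrd x, hx⟩
    refine ⟨Polynomial.X ^ 2 - (Polynomial.C t * Polynomial.X - Polynomial.C n), ?_, ?_⟩
    · refine Polynomial.monic_X_pow_sub ?_
      have : Polynomial.C t * Polynomial.X - Polynomial.C n =
        Polynomial.C t * Polynomial.X + Polynomial.C (-n) := by rw [Polynomial.C_neg, sub_eq_add_neg]
      rw [this]
      exact Polynomial.degree_linear_lt
    · rw [← Polynomial.aeval_def]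
      simp only [map_sub, map_pow, map_mul, Polynomial.aeval_X, Polynomial.aeval_C]
      rw [← Algebra.smul_def, Algebra.algebraMap_eq_smul_one, padicInt_smul_eq, padicInt_smul_eq,
        pow_two, mul_self_eq]
      exact sub_self _

end HasDiagonalNorm

/-- The quadratic subalgebra generated by the pure quaternion `i + t k`. -/
def quadraticSubalgebra (t : ℚ_[p]) : Subalgebra ℚ_[p] (Quat ℚ_[p] a b) where
  carrier := {x | ∃ c d : ℚ_[p], x = ⟨c, d, 0, t * d⟩}
  mul_mem' := by
    rintro _ _ ⟨c, d, rfl⟩ ⟨c', d', rfl⟩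
    refine ⟨c * c' + a * (d * d') - a * b * (t * d * (t * d')), c * d' + d * c', ?_⟩
    ext <;> simp <;> ring
  add_mem' := by
    rintro _ _ ⟨c, d, rfl⟩ ⟨c', d', rfl⟩
    exact ⟨c + c', d + d', by ext <;> simp; ring⟩
  algebraMap_mem' c := ⟨c, 0, by ext <;> simp⟩

theorem finrank_quadraticSubalgebra (t : ℚ_[p]) :
    Module.finrank ℚ_[p] (quadraticSubalgebra (a := a) (b := b) t) = 2 := by
  let e : (Fin 2 → ℚ_[p]) ≃ₗ[ℚ_[p]] quadraticSubalgebra (a := a) (b := b) t :=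
    { toFun := fun c => ⟨⟨c 0, c 1, 0, t * c 1⟩, c 0, c 1, rfl⟩
      map_add' := fun c d => Subtype.ext (by ext <;> simp; ring)
      map_smul' := fun c d => Subtype.ext (by ext <;> simp; ring)
      invFun := fun x => ![x.1.re, x.1.imI]
      left_inv := fun c => by ext i; fin_cases i <;> rfl
      right_inv := by rintro ⟨_, c, d, rfl⟩; rfl }
  rw [← e.finrank_eq, Module.finrank_fin_fun]

/-- Put $\theta=i+tk$. Since $\alpha=v(a)\le1$ and nothing cancels, $\mathfrak o_K=\mathbb
Z_p+\mathbb Z_p\theta$, while $\mathfrak P^{v-1}$ is a box. The inequalities say that $\beta+2m$ and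
$\alpha+\beta+2n$ are $v-1$ or $v$, so $p^mj$ and $p^nk$ generate its $j$- and $k$-parts; the rest
is absorbed by $\mathfrak o_K$. If $\alpha=1$, then $\theta$ has uniformizing norm and $K$ is
ramified. -/
theorem HasDiagonalNorm.isLocalResiduallyInert (h : HasDiagonalNorm p a b) {α β m n v : ℕ}
    (ha : ‖(a : ℚ_[p])‖ = ‖(p : ℚ_[p])‖ ^ α) (hb : ‖(b : ℚ_[p])‖ = ‖(p : ℚ_[p])‖ ^ β) (hv : 1 ≤ v)
    (hα : α ≤ 1) (hodd : Odd v ∨ α = 1)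
    (hm : v ≤ β + 2 * m + 1) (hm' : β + 2 * m ≤ v) (hn : v ≤ α + β + 2 * n + 1)
    (hn' : α + β + 2 * n ≤ v)
    {L : Submodule ℤ_[p] (Quat ℚ_[p] a b)} (t : ℤ)
    (hL : ∀ x, x ∈ L ↔ ‖x.re‖ ≤ 1 ∧ ‖x.imI‖ ≤ 1 ∧ ‖x.imJ‖ ≤ ‖(p : ℚ_[p])‖ ^ m ∧
      ‖x.imK - t * x.imI‖ ≤ ‖(p : ℚ_[p])‖ ^ n) :
    IsLocalResiduallyInert L v := by
  have hp1 : ‖(p : ℚ_[p])‖ ≤ 1 := (Padic.norm_p_lt_one).le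
  have hp0 : 0 < ‖(p : ℚ_[p])‖ := norm_pos_iff.2 (by exact_mod_cast (Fact.out : p.Prime).ne_zero)
  have ha0 : a ≠ 0 := by rintro rfl; rw [Int.cast_zero, norm_zero] at ha; exact (pow_pos hp0 α).ne ha
  have hb0 : b ≠ 0 := by rintro rfl; rw [Int.cast_zero, norm_zero] at hb; exact (pow_pos hp0 β).ne hb
  have ht : ‖(t : ℚ_[p])‖ ≤ 1 := Padic.norm_int_le_one t
  have hbt : ‖(b : ℚ_[p])‖ ≤ 1 := Padic.norm_int_le_one b
  refine ⟨h.isDivision ha0 hb0, hv, quadraticSubalgebra (t : ℚ_[p]),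
    finrank_quadraticSubalgebra _, hodd.imp_right fun hα1 => ⟨⟨0, 1, 0, t * 1⟩, ⟨0, 1, rfl⟩, ?_⟩,
    fun x => ?_⟩
  · rw [h, ha, hα1]
    have h3 : ‖(p : ℚ_[p])‖ * ‖(b : ℚ_[p])‖ * ‖(t : ℚ_[p])‖ ^ 2 ≤ ‖(p : ℚ_[p])‖ := by
      rw [mul_assoc]
      exact mul_le_of_le_one_right hp0.le (mul_le_one₀ hbt (by positivity)
        (pow_le_one₀ (norm_nonneg _) ht))
    have h4 : 0 ≤ ‖(p : ℚ_[p])‖ * ‖(b : ℚ_[p])‖ * ‖(t : ℚ_[p])‖ ^ 2 := by positivity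
    simp only [norm_zero, norm_one, pow_one, one_pow, mul_one, mul_zero, ne_eq, OfNat.ofNat_ne_zero,
      not_false_eq_true, zero_pow]
    rw [max_eq_right hp0.le, max_eq_right h4, max_eq_left h3]
  · rw [hL]
    constructor
    · rintro ⟨h0, h1, h2, h3⟩
      have hz : ‖nrd (⟨0, 0, x.imJ, x.imK - t * x.imI⟩ : Quat ℚ_[p] a b)‖ ≤
          ‖(p : ℚ_[p])‖ ^ (v - 1) := by
        rw [h]
        simp only [norm_zero, ne_eq, OfNat.ofNat_ne_zero, not_false_eq_true, zero_pow, mul_zero,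
          max_self]
        refine max_le (by positivity) (max_le ?_ ?_)
        · calc ‖(b : ℚ_[p])‖ * ‖x.imJ‖ ^ 2 ≤ ‖(p : ℚ_[p])‖ ^ β * (‖(p : ℚ_[p])‖ ^ m) ^ 2 := by
                rw [hb]; gcongr
            _ = ‖(p : ℚ_[p])‖ ^ (β + 2 * m) := by ring
            _ ≤ _ := pow_le_pow_of_le_one hp0.le hp1 (by omega)
        · calc ‖(a : ℚ_[p])‖ * ‖(b : ℚ_[p])‖ * ‖x.imK - t * x.imI‖ ^ 2
              ≤ ‖(p : ℚ_[p])‖ ^ α * ‖(p : ℚ_[p])‖ ^ β * (‖(p : ℚ_[p])‖ ^ n) ^ 2 := by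
                rw [ha, hb]; gcongr
            _ = ‖(p : ℚ_[p])‖ ^ (α + β + 2 * n) := by ring
            _ ≤ _ := pow_le_pow_of_le_one hp0.le hp1 (by omega)
      refine ⟨⟨x.re, x.imI, 0, t * x.imI⟩, ⟨0, 0, x.imJ, x.imK - t * x.imI⟩, ⟨_, _, rfl⟩,
        (h.isIntegral_iff _).2 ?_,
        (h.isIntegral_iff _).2 (hz.trans (pow_le_one₀ hp0.le hp1)), by rwa [norm_pow], ?_⟩
      · rw [h]
        have hx1 : ‖x.imI‖ ^ 2 ≤ 1 := pow_le_one₀ (norm_nonneg _) h1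
        have hat : ‖(a : ℚ_[p])‖ ≤ 1 := Padic.norm_int_le_one a
        refine max_le (max_le (pow_le_one₀ (norm_nonneg _) h0)
          (mul_le_one₀ hat (by positivity) hx1)) (max_le (by simp)
          (mul_le_one₀ (mul_le_one₀ hat (norm_nonneg _) hbt) (by positivity) ?_))
        rw [norm_mul]
        exact pow_le_one₀ (by positivity) (mul_le_one₀ ht (norm_nonneg _) h1)
      · ext <;> simp
    · rintro ⟨y, z, ⟨c, d, rfl⟩, hy, -, hz, rfl⟩
      rw [h.isIntegral_iff] at hy
      rw [norm_pow] at hz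
      have hy0 := (h.re_le _).trans hy
      have hy1 := (h.imI_le _).trans hy
      have hz0 := (h.re_le _).trans hz
      have hz1 := (h.imI_le _).trans hz
      have hz2 := (h.imJ_le _).trans hz
      have hz3 := (h.imK_le _).trans hz
      rw [ha] at hy1 hz1
      rw [hb] at hz2
      rw [ha, hb, ← pow_add] at hz3
      have hz0' := Padic.norm_le_norm_pow_of_sq_le (s := z.re) (α := 0) (V := v - 1) (m := 0) (by omega)
        (by rwa [pow_zero, one_mul])
      -- The `i`-coordinate of `z` must be bounded by $p^n$, not merely by 1: rewriting $i$ as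
      -- $\theta-tk$ moves it into the `k`-coordinate.
      have hz1' := Padic.norm_le_norm_pow_of_sq_le (m := n) (by omega) hz1
      have hz2' := Padic.norm_le_norm_pow_of_sq_le (m := m) (by omega) hz2
      have hz3' := Padic.norm_le_norm_pow_of_sq_le (m := n) (by omega) hz3
      have hy0' := Padic.norm_le_norm_pow_of_sq_le (s := c) (α := 0) (V := 0) (m := 0) (by omega)
        (by rwa [pow_zero, one_mul])
      have hy1' := Padic.norm_le_norm_pow_of_sq_le (V := 0) (m := 0) (by omega)
        (by rwa [pow_zero])
      rw [pow_zero] at hz0' hy0' hy1'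
      refine ⟨(Padic.nonarchimedean _ _).trans (max_le hy0' hz0'),
        (Padic.nonarchimedean _ _).trans (max_le hy1' (hz1'.trans (pow_le_one₀ hp0.le hp1))),
        ?_, ?_⟩
      · simpa using hz2'
      · have e : ((⟨c, d, 0, t * d⟩ : Quat ℚ_[p] a b) + z).imK -
            t * ((⟨c, d, 0, t * d⟩ : Quat ℚ_[p] a b) + z).imI = z.imK + -(t * z.imI) := by
          simp; ring
        rw [e]
        refine (Padic.nonarchimedean _ _).trans (max_le hz3' ?_)
        rw [norm_neg, norm_mul]
        exact (mul_le_of_le_one_left (norm_nonneg _) ht).trans hz1'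

end Quat

/-! ### Global orders from a basis, and their completions -/

namespace Quat

section Gram

variable {F : Type*} [Field F] {a b : ℤ}

theorem det_trd_mul (e : Fin 4 → Quat F a b) :
    (Matrix.of fun m n => trd (e m * e n)).det = -16 * (a : F) ^ 2 * (b : F) ^ 2 *
      (Matrix.of fun m => ![(e m).re, (e m).imI, (e m).imJ, (e m).imK]).det ^ 2 := by
  have h : (Matrix.of fun m n => trd (e m * e n)) =
      (Matrix.of fun m => ![(e m).re, (e m).imI, (e m).imJ, (e m).imK]) *
        Matrix.diagonal ![2, 2 * (a : F), 2 * (b : F), -2 * (a : F) * b] *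
        (Matrix.of fun m => ![(e m).re, (e m).imI, (e m).imJ, (e m).imK]).transpose := by
    ext m n
    simp [Matrix.mul_apply, Fin.sum_univ_four, Matrix.diagonal, trd_eq]
    ring
  rw [h, Matrix.det_mul, Matrix.det_mul, Matrix.det_transpose, Matrix.det_diagonal,
    Fin.prod_univ_four]
  simp
  ring

end Gram

section ToLocal

variable {a b : ℤ} {l : ℕ} [Fact l.Prime]

theorem toLocal_one : toLocal l (1 : Quat ℚ a b) = 1 := by ext <;> simp [toLocal]
theorem toLocal_zero : toLocal l (0 : Quat ℚ a b) = 0 := by ext <;> simp [toLocal]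
theorem toLocal_add (x y : Quat ℚ a b) : toLocal l (x + y) = toLocal l x + toLocal l y := by
  ext <;> simp [toLocal]
theorem toLocal_zsmul (n : ℤ) (x : Quat ℚ a b) :
    toLocal l (n • x) = (n : ℤ_[l]) • toLocal l x := by
  rw [padicInt_smul_eq]; ext <;> simp [toLocal]
theorem toLocal_mul (x y : Quat ℚ a b) : toLocal l (x * y) = toLocal l x * toLocal l y := by
  ext <;> simp [toLocal]
theorem trd_toLocal (x : Quat ℚ a b) : trd (toLocal l x) = (trd x : ℚ) := by
  simp [toLocal, trd_eq]
theorem nrd_toLocal (x : Quat ℚ a b) : nrd (toLocal l x) = (nrd x : ℚ) := by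
  simp [toLocal, nrd_eq, quatNorm]

theorem localization_span {ι : Type*} (e : ι → Quat ℚ a b) :
    localization (Submodule.span ℤ (Set.range e)) l =
      Submodule.span ℤ_[l] (Set.range fun m => toLocal l (e m)) := by
  refine le_antisymm (Submodule.span_le.2 ?_) (Submodule.span_mono ?_)
  · rintro _ ⟨x, hx, rfl⟩
    induction hx using Submodule.span_induction with
    | mem x hx => obtain ⟨m, rfl⟩ := hx; exact Submodule.subset_span ⟨m, rfl⟩
    | zero => rw [toLocal_zero]; exact zero_mem _
    | add x y _ _ hx hy => rw [toLocal_add]; exact add_mem hx hy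
    | smul c x _ hx => rw [toLocal_zsmul]; exact Submodule.smul_mem _ _ hx
  · rintro _ ⟨m, rfl⟩
    exact ⟨e m, Submodule.subset_span ⟨m, rfl⟩, rfl⟩

end ToLocal

variable {a b : ℤ}

theorem isBasisOfReducedDiscriminant_of_det {e : Fin 4 → Quat ℚ a b} {N : ℕ} (hN : N ≠ 0)
    (h : 4 * (a : ℚ) * b *
      (Matrix.of fun m => ![(e m).re, (e m).imI, (e m).imJ, (e m).imK]).det = N) :
    IsBasisOfReducedDiscriminant e N := by
  have hdet : (Matrix.of fun m n => trd (e m * e n)).det = -(N : ℚ) ^ 2 := by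
    rw [det_trd_mul, ← h]; ring
  have hN' : (N : ℚ) ≠ 0 := by exact_mod_cast hN
  refine ⟨?_, by rw [hdet, abs_neg, abs_of_nonneg (by positivity)]⟩
  exact (linearIndependent_of_det_ne_zero (by rw [hdet]; simpa using hN')).restrict_scalars' ℤ

/-- The family `1, g₁, g₂, g₃` is a basis of an order of reduced discriminant `N`. -/
structure IsOrderBasis (e : Fin 4 → Quat ℚ a b) (N : ℕ) : Prop where
  zero : e 0 = 1
  trd_int : ∀ m, ∃ t : ℤ, trd (e m) = t
  nrd_int : ∀ m, ∃ t : ℤ, nrd (e m) = t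
  mul_mem₁₂ : e 1 * e 2 ∈ Submodule.span ℤ (Set.range e)
  mul_mem₁₃ : e 1 * e 3 ∈ Submodule.span ℤ (Set.range e)
  mul_mem₂₃ : e 2 * e 3 ∈ Submodule.span ℤ (Set.range e)
  basis : IsBasisOfReducedDiscriminant e N
  ne_zero : N ≠ 0

namespace IsOrderBasis

variable {e : Fin 4 → Quat ℚ a b} {N : ℕ}

theorem mem (_h : IsOrderBasis e N) (m : Fin 4) : e m ∈ Submodule.span ℤ (Set.range e) :=
  Submodule.subset_span ⟨m, rfl⟩

theorem one_mem (h : IsOrderBasis e N) : 1 ∈ Submodule.span ℤ (Set.range e) := h.zero ▸ h.mem 0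

theorem intCast_smul_mem (_h : IsOrderBasis e N) (n : ℤ) {x : Quat ℚ a b}
    (hx : x ∈ Submodule.span ℤ (Set.range e)) : (n : ℚ) • x ∈ Submodule.span ℤ (Set.range e) := by
  rw [Int.cast_smul_eq_zsmul]; exact Submodule.smul_mem _ _ hx

theorem exists_trd_eq (h : IsOrderBasis e N) {x : Quat ℚ a b}
    (hx : x ∈ Submodule.span ℤ (Set.range e)) : ∃ t : ℤ, trd x = t := by
  induction hx using Submodule.span_induction with
  | mem x hx => obtain ⟨m, rfl⟩ := hx; exact h.trd_int m
  | zero => exact ⟨0, by simp [trd_zero]⟩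
  | add x y _ _ hx hy =>
    obtain ⟨s, hs⟩ := hx
    obtain ⟨t, ht⟩ := hy
    exact ⟨s + t, by rw [trd_add, hs, ht]; push_cast; rfl⟩
  | smul c x _ hx =>
    obtain ⟨t, ht⟩ := hx
    exact ⟨c * t, by rw [← Int.cast_smul_eq_zsmul ℚ, trd_smul, ht]; push_cast; rfl⟩

theorem mul_self_mem (h : IsOrderBasis e N) (m : Fin 4) :
    e m * e m ∈ Submodule.span ℤ (Set.range e) := by
  obtain ⟨s, hs⟩ := h.trd_int m
  obtain ⟨t, ht⟩ := h.nrd_int m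
  rw [mul_self_eq, hs, ht]
  exact sub_mem (h.intCast_smul_mem _ (h.mem m)) (h.intCast_smul_mem _ h.one_mem)

/-- Polarizing the quadratic equation writes $xy+yx$ as an integral combination of $x$, $y$ and 1.
Hence only three products have to be checked for an order basis. -/
theorem mul_mem_symm (h : IsOrderBasis e N) {m n : Fin 4}
    (hmn : e m * e n ∈ Submodule.span ℤ (Set.range e)) :
    e n * e m ∈ Submodule.span ℤ (Set.range e) := by
  obtain ⟨s, hs⟩ := h.trd_int m
  obtain ⟨t, ht⟩ := h.trd_int n
  obtain ⟨w, hw⟩ := h.exists_trd_eq hmn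
  have key : e n * e m = (s : ℚ) • e n + (t : ℚ) • e m -
      ((s * t - w : ℤ) : ℚ) • (1 : Quat ℚ a b) - e m * e n := by
    push_cast
    rw [← hs, ← ht, ← hw]
    ext <;> simp [trd_eq] <;> ring
  rw [key]
  exact sub_mem (sub_mem (add_mem (h.intCast_smul_mem _ (h.mem n)) (h.intCast_smul_mem _ (h.mem m)))
    (h.intCast_smul_mem _ h.one_mem)) hmn

theorem basis_mul_mem (h : IsOrderBasis e N) (m n : Fin 4) :
    e m * e n ∈ Submodule.span ℤ (Set.range e) := by
  have h0 : ∀ n, e 0 * e n ∈ Submodule.span ℤ (Set.range e) := fun n => by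
    rw [h.zero, one_mul]; exact h.mem n
  fin_cases m <;> fin_cases n
  · exact h0 0
  · exact h0 1
  · exact h0 2
  · exact h0 3
  · exact h.mul_mem_symm (h0 1)
  · exact h.mul_self_mem 1
  · exact h.mul_mem₁₂
  · exact h.mul_mem₁₃
  · exact h.mul_mem_symm (h0 2)
  · exact h.mul_mem_symm h.mul_mem₁₂
  · exact h.mul_self_mem 2
  · exact h.mul_mem₂₃
  · exact h.mul_mem_symm (h0 3)
  · exact h.mul_mem_symm h.mul_mem₁₃
  · exact h.mul_mem_symm h.mul_mem₂₃
  · exact h.mul_self_mem 3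

theorem isOrder (h : IsOrderBasis e N) : IsOrder (Submodule.span ℤ (Set.range e)) where
  one_mem := h.one_mem
  mul_mem x hx y hy := by
    have : Submodule.span ℤ (Set.range e) * Submodule.span ℤ (Set.range e) ≤
        Submodule.span ℤ (Set.range e) := by
      rw [Submodule.span_mul_span, Submodule.span_le]
      rintro _ ⟨_, ⟨m, rfl⟩, _, ⟨n, rfl⟩, rfl⟩
      exact h.basis_mul_mem m n
    exact this (Submodule.mul_mem_mul hx hy)
  fg := Submodule.fg_span (Set.finite_range e)
  span_eq_top := by
    have hdet : (Matrix.of fun m n => trd (e m * e n)).det ≠ 0 := fun h0 => by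
      have := h.basis.2
      rw [h0, abs_zero] at this
      exact h.ne_zero (by simpa using this.symm)
    rw [Submodule.span_span_of_tower]
    exact (linearIndependent_of_det_ne_zero hdet).span_eq_top_of_card_eq_finrank
      (by rw [QuaternionAlgebra.finrank_eq_four]; rfl)

theorem isUnimodularOrder (h : IsOrderBasis e N) {l : ℕ} [Fact l.Prime] (hl : ¬ l ∣ N) :
    IsUnimodularOrder (localization (Submodule.span ℤ (Set.range e)) l)
      (fun m => toLocal l (e m)) where
  span := (localization_span e).symm
  one_mem := Submodule.subset_span ⟨1, h.one_mem, toLocal_one⟩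
  mul_mem x hx y hy := by
    have : localization (Submodule.span ℤ (Set.range e)) l *
        localization (Submodule.span ℤ (Set.range e)) l ≤
        localization (Submodule.span ℤ (Set.range e)) l := by
      unfold localization
      rw [Submodule.span_mul_span, Submodule.span_le]
      rintro _ ⟨_, ⟨x, hx, rfl⟩, _, ⟨y, hy, rfl⟩, rfl⟩
      exact Submodule.subset_span ⟨x * y, h.isOrder.mul_mem x hx y hy, toLocal_mul x y⟩
    exact this (Submodule.mul_mem_mul hx hy)
  trd_le m := by
    obtain ⟨t, ht⟩ := h.trd_int m
    rw [trd_toLocal, ht, Rat.cast_intCast]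
    exact Padic.norm_int_le_one t
  nrd_le m := by
    obtain ⟨t, ht⟩ := h.nrd_int m
    rw [nrd_toLocal, ht, Rat.cast_intCast]
    exact Padic.norm_int_le_one t
  det := by
    have h1 : (Matrix.of fun m n => trd (toLocal l (e m) * toLocal l (e n))).det =
        (((Matrix.of fun m n => trd (e m * e n)).det : ℚ) : ℚ_[l]) := by
      have := RingHom.map_det (Rat.castHom ℚ_[l]) (Matrix.of fun m n => trd (e m * e n))
      rw [← Rat.coe_castHom, this]
      simp only [← toLocal_mul, trd_toLocal]
      rfl
    have h2 : ‖(N : ℚ_[l])‖ = 1 := by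
      refine le_antisymm (by simpa using Padic.norm_int_le_one (p := l) N) (not_lt.1 fun h => hl ?_)
      have := (Padic.norm_intCast_lt_one_iff (p := l) (k := N)).1 (by simpa using h)
      exact_mod_cast this
    rw [h1]
    rcases eq_or_eq_neg_of_abs_eq h.basis.2 with h3 | h3 <;> rw [h3] <;> simp [h2]

end IsOrderBasis

/-- The family `1, 1 / 2 + ρ (i + t k), σ j + τ k, φ k`. -/
def triangularFamily (ρ σ τ φ : ℚ) (t : ℤ) : Fin 4 → Quat ℚ a b :=
  ![1, ⟨1 / 2, ρ, 0, ρ * t⟩, ⟨0, 0, σ, τ⟩, ⟨0, 0, 0, φ⟩]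

theorem triangularFamily_isBasis {ρ σ τ φ : ℚ} {t : ℤ} {N : ℕ} (hN : N ≠ 0)
    (h : 4 * (a : ℚ) * b * (ρ * σ * φ) = N) :
    IsBasisOfReducedDiscriminant (triangularFamily (a := a) (b := b) ρ σ τ φ t) N := by
  refine isBasisOfReducedDiscriminant_of_det hN ?_
  rw [← h]
  congr 1
  simp [triangularFamily, Matrix.det_succ_row_zero, Fin.sum_univ_succ]
  ring

/-- At $p$ the numbers $2$ and $\rho$ are units, and $\tau k$ is absorbed by $\varphi k$, so the
triangular basis cuts out a box in $1,\ i+tk,\ j,\ k$. -/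
theorem mem_localization_triangularFamily {p : ℕ} [Fact p.Prime] (hp : p ≠ 2)
    {ρ σ τ φ : ℚ} {t : ℤ} {m n : ℕ}
    (hρ : ‖(ρ : ℚ_[p])‖ = 1) (hσ : ‖(σ : ℚ_[p])‖ = ‖(p : ℚ_[p])‖ ^ m)
    (hτ : ‖(τ : ℚ_[p])‖ ≤ ‖(p : ℚ_[p])‖ ^ n) (hφ : ‖(φ : ℚ_[p])‖ = ‖(p : ℚ_[p])‖ ^ n)
    (x : Quat ℚ_[p] a b) :
    x ∈ localization (Submodule.span ℤ (Set.range (triangularFamily ρ σ τ φ t))) p ↔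
      ‖x.re‖ ≤ 1 ∧ ‖x.imI‖ ≤ 1 ∧ ‖x.imJ‖ ≤ ‖(p : ℚ_[p])‖ ^ m ∧
      ‖x.imK - t * x.imI‖ ≤ ‖(p : ℚ_[p])‖ ^ n := by
  have hp0 : 0 < ‖(p : ℚ_[p])‖ := norm_pos_iff.2 (by exact_mod_cast (Fact.out : p.Prime).ne_zero)
  have h2 : ‖(2 : ℚ_[p])‖ = 1 := by
    refine le_antisymm (by simpa using Padic.norm_int_le_one (p := p) 2) (not_lt.1 fun h => ?_)
    have := (Padic.norm_intCast_lt_one_iff (p := p) (k := 2)).1 (by simpa using h)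
    exact hp ((Nat.prime_dvd_prime_iff_eq Fact.out Nat.prime_two).1 (by exact_mod_cast this))
  have add_le : ∀ {s t : ℚ_[p]} {C : ℝ}, ‖s‖ ≤ C → ‖t‖ ≤ C → ‖s + t‖ ≤ C := fun hs ht =>
    (Padic.nonarchimedean _ _).trans (max_le hs ht)
  have mul_le : ∀ {s t : ℚ_[p]} {C : ℝ}, ‖s‖ ≤ 1 → ‖t‖ ≤ C → ‖s * t‖ ≤ C := fun hs ht => by
    rw [norm_mul]; exact (mul_le_of_le_one_left (norm_nonneg _) hs).trans ht
  have h2' : ‖(2 : ℚ_[p])⁻¹‖ ≤ 1 := by rw [norm_inv, h2, inv_one]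
  rw [localization_span]
  constructor
  · intro hx
    induction hx using Submodule.span_induction with
    | mem x hx =>
      obtain ⟨k, rfl⟩ := hx
      fin_cases k
      · simp [triangularFamily, toLocal]
      · simp [triangularFamily, toLocal, hρ, h2, mul_comm]
      · simp [triangularFamily, toLocal, hσ]
        simpa using hτ
      · simp [triangularFamily, toLocal, hφ]
    | zero => simp
    | add x y _ _ hx hy =>
      refine ⟨add_le hx.1 hy.1, add_le hx.2.1 hy.2.1, add_le hx.2.2.1 hy.2.2.1, ?_⟩
      have : (x + y).imK - t * (x + y).imI = (x.imK - t * x.imI) + (y.imK - t * y.imI) := by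
        simp; ring
      rw [this]
      exact add_le hx.2.2.2 hy.2.2.2
    | smul c x _ hx =>
      rw [padicInt_smul_eq]
      have hc := PadicInt.norm_le_one c
      refine ⟨mul_le hc hx.1, mul_le hc hx.2.1, mul_le hc hx.2.2.1, ?_⟩
      have : ((c : ℚ_[p]) • x).imK - t * ((c : ℚ_[p]) • x).imI = c * (x.imK - t * x.imI) := by
        simp; ring
      rw [this]
      exact mul_le hc hx.2.2.2
  · rintro ⟨h0, h1, hJ, hK⟩
    have hρ0 : (ρ : ℚ_[p]) ≠ 0 := by rw [← norm_ne_zero_iff, hρ]; exact one_ne_zero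
    have hσ0 : (σ : ℚ_[p]) ≠ 0 := by rw [← norm_ne_zero_iff, hσ]; positivity
    have hφ0 : (φ : ℚ_[p]) ≠ 0 := by rw [← norm_ne_zero_iff, hφ]; positivity
    have hc1 : ‖x.imI / ρ‖ ≤ 1 := by rw [norm_div, hρ, div_one]; exact h1
    have hc0 : ‖x.re + -(2⁻¹ * (x.imI / ρ))‖ ≤ 1 :=
      add_le h0 (by rw [norm_neg]; exact mul_le h2' hc1)
    have hc2 : ‖x.imJ / σ‖ ≤ 1 := by
      rw [norm_div, hσ, div_le_one (by positivity)]; exact hJ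
    have hc3 : ‖((x.imK - t * x.imI) + -(x.imJ / σ * τ)) / φ‖ ≤ 1 := by
      rw [norm_div, hφ, div_le_one (by positivity)]
      exact add_le hK (by rw [norm_neg]; exact mul_le hc2 hτ)
    refine (Submodule.mem_span_range_iff_exists_fun _).2 ⟨![⟨_, hc0⟩, ⟨_, hc1⟩, ⟨_, hc2⟩, ⟨_, hc3⟩], ?_⟩
    simp only [padicInt_smul_eq]
    ext <;> simp [Fin.sum_univ_four, triangularFamily, toLocal] <;> field_simp <;> ring

theorem IsOrderBasis.hasLevel {p : ℕ} [Fact p.Prime] {r : ℕ} {e : Fin 4 → Quat ℚ a b}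
    (h : IsOrderBasis e (p ^ r)) (ha : a ≠ 0) (hb : b ≠ 0)
    (hp : IsLocalResiduallyInert (localization (Submodule.span ℤ (Set.range e)) p) r) :
    HasLevel (Submodule.span ℤ (Set.range e)) (p ^ r) := by
  refine ⟨h.isOrder, h.ne_zero, fun l _ => ?_⟩
  by_cases hl : l = p
  · subst hl
    rw [padicValNat.prime_pow]
    exact ⟨fun _ => hp, fun hd => absurd hp.1 hd⟩
  · have hdvd : ¬ l ∣ p ^ r := fun hd =>
      hl ((Nat.prime_dvd_prime_iff_eq Fact.out Fact.out).1 ((Fact.out : l.Prime).dvd_of_dvd_pow hd))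
    rw [padicValNat.eq_zero_of_not_dvd hdvd]
    exact ⟨fun hd => absurd hd (h.isUnimodularOrder hdvd).not_isDivision,
      fun _ => (h.isUnimodularOrder hdvd).isLocalEichler ha hb⟩

/-- An order of discriminant $p^r$ certifies splitting away from $p$: at such primes it is
unimodular and so contains a null vector. -/
theorem IsOrderBasis.isDefiniteRamifiedAt {p : ℕ} [Fact p.Prime] {r : ℕ} {e : Fin 4 → Quat ℚ a b}
    (h : IsOrderBasis e (p ^ r)) (ha : a < 0) (hb : b < 0) (hp : IsDivision (Quat ℚ_[p] a b)) :
    IsDefiniteRamifiedAt p a b where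
  neg_left := by exact_mod_cast ha
  neg_right := by exact_mod_cast hb
  ramified l _ := by
    rw [Rat.cast_intCast, Rat.cast_intCast]
    constructor
    · intro hd
      by_contra hl
      have hdvd : ¬ l ∣ p ^ r := fun hd => hl
        ((Nat.prime_dvd_prime_iff_eq Fact.out Fact.out).1 ((Fact.out : l.Prime).dvd_of_dvd_pow hd))
      exact (h.isUnimodularOrder hdvd).not_isDivision hd
    · intro hl
      subst hl
      exact hp

end Quat

/-! ### The explicit lattices -/

namespace Quat

theorem mem_span_range_of_eq {a b : ℤ} {e : Fin 4 → Quat ℚ a b} {x : Quat ℚ a b} (c : Fin 4 → ℤ)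
    (h : x = ∑ m, (c m : ℚ) • e m) : x ∈ Submodule.span ℤ (Set.range e) :=
  (Submodule.mem_span_range_iff_exists_fun ℤ).2 ⟨c, by simp only [h, Int.cast_smul_eq_zsmul]⟩

/-- An order in `(-qc, -p / ℚ)`. -/
theorem isOrderBasis_triangularFamily_one {a b p q c c' d M z f : ℤ} {N : ℕ} (ha : a = -(q * c))
    (hb : b = -p) (hq : q ≠ 0) (hc : c = 2 * c' + 1) (hd : q * c + 1 = 4 * d)
    (hM : q * c + 1 + 4 * p * z ^ 2 = 4 * q * M) (hN : N ≠ 0) (hN' : c * p * f ^ 2 = N) :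
    IsOrderBasis (triangularFamily (a := a) (b := b) (1 / (2 * q)) (f / 2) (f / 2) f (2 * z)) N := by
  have hq' : (q : ℚ) ≠ 0 := by exact_mod_cast hq
  have hd' : (q : ℚ) * c + 1 = 4 * d := by exact_mod_cast hd
  have hM' : (q : ℚ) * c + 1 + 4 * p * z ^ 2 = 4 * q * M := by exact_mod_cast hM
  have hc' : (c : ℚ) = 2 * c' + 1 := by exact_mod_cast hc
  have hN'' : (c : ℚ) * p * f ^ 2 = N := by exact_mod_cast hN'
  -- `M`, `d` and `c'` carry all the integrality. Written as rational expressions, they turn each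
  -- membership below into a polynomial identity for the listed coefficients.
  have hMq : (M : ℚ) = (q * c + 1 + 4 * p * z ^ 2) / (4 * q) := by rw [hM']; field_simp
  have hdq : (d : ℚ) = (q * c + 1) / 4 := by rw [hd']; ring
  have haq : (a : ℚ) = -(q * c) := by exact_mod_cast ha
  have hbq : (b : ℚ) = -p := by exact_mod_cast hb
  refine ⟨rfl, fun m => ?_, fun m => ?_, ?_, ?_, ?_, ?_, hN⟩
  · fin_cases m
    · exact ⟨2, by simp [triangularFamily, trd_eq]⟩
    · exact ⟨1, by simp [triangularFamily, trd_eq]⟩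
    · exact ⟨0, by simp [triangularFamily, trd_eq]⟩
    · exact ⟨0, by simp [triangularFamily, trd_eq]⟩
  · fin_cases m
    · exact ⟨1, by simp [triangularFamily, nrd_eq, quatNorm]⟩
    · refine ⟨c * M - c' * (c' + 1), ?_⟩
      simp only [triangularFamily, nrd_eq, quatNorm]
      simp
      rw [haq, hbq, hMq, hc']
      field_simp
      ring
    · refine ⟨f ^ 2 * p * d, ?_⟩
      simp only [triangularFamily, nrd_eq, quatNorm]
      simp
      rw [haq, hbq, hdq]
      field_simp
      ring
    · refine ⟨f ^ 2 * p * q * c, ?_⟩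
      simp only [triangularFamily, nrd_eq, quatNorm]
      simp
      rw [haq, hbq]
      ring
  · refine mem_span_range_of_eq ![-(z * f * p * c'), -(z * f * p), -c', M] ?_
    simp only [triangularFamily, Fin.sum_univ_four]
    ext <;> simp <;> (try simp only [haq, hbq, hMq, hc']) <;> field_simp <;> ring
  · refine mem_span_range_of_eq ![-(z * c * p * f), 0, -c, c' + 1] ?_
    simp only [triangularFamily, Fin.sum_univ_four]
    ext <;> simp [-mul_eq_mul_right_iff, -mul_eq_mul_left_iff] <;> (try simp only [haq, hbq, hc']) <;> field_simp <;> ring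
  · refine mem_span_range_of_eq ![-(f ^ 2 * p * q * (c' + 1)), f ^ 2 * p * q, 0, -(f * p * z)] ?_
    simp only [triangularFamily, Fin.sum_univ_four]
    ext <;> simp <;> (try simp only [haq, hbq, hc']) <;> field_simp <;> ring
  · refine triangularFamily_isBasis hN ?_
    rw [← hN'', haq, hbq]
    field_simp
    ring

/-- An order in `(-p, -q / ℚ)`. -/
theorem isOrderBasis_triangularFamily_two {a b p q u s d M h h' f : ℤ} {N : ℕ} (ha : a = -p)
    (hb : b = -q) (hq : q ≠ 0) (hs : u * p + 1 = 2 * s) (hd : p + 1 = 4 * d) (hh : h * h' = p)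
    (hM : 1 + p * u ^ 2 = 4 * q * M) (hN : N ≠ 0) (hN' : p * f ^ 2 * h = N) :
    IsOrderBasis (triangularFamily (a := a) (b := b) (1 / 2) (f * h / (2 * q))
      (f * h * u / (2 * q)) f 0) N := by
  have hq' : (q : ℚ) ≠ 0 := by exact_mod_cast hq
  have hd' : (p : ℚ) + 1 = 4 * d := by exact_mod_cast hd
  have hs' : (u : ℚ) * p + 1 = 2 * s := by exact_mod_cast hs
  have hM' : (1 : ℚ) + p * u ^ 2 = 4 * q * M := by exact_mod_cast hM
  have hN'' : (p : ℚ) * f ^ 2 * h = N := by exact_mod_cast hN'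
  have hMq : (M : ℚ) = (1 + p * u ^ 2) / (4 * q) := by rw [hM']; field_simp
  have hdq : (d : ℚ) = (p + 1) / 4 := by rw [hd']; ring
  have hsq : (s : ℚ) = (u * p + 1) / 2 := by rw [hs']; ring
  have hhq : (p : ℚ) = h * h' := by exact_mod_cast hh.symm
  have haq : (a : ℚ) = -p := by exact_mod_cast ha
  have hbq : (b : ℚ) = -q := by exact_mod_cast hb
  refine ⟨rfl, fun m => ?_, fun m => ?_, ?_, ?_, ?_, ?_, hN⟩
  · fin_cases m
    · exact ⟨2, by simp [triangularFamily, trd_eq]⟩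
    · exact ⟨1, by simp [triangularFamily, trd_eq]⟩
    · exact ⟨0, by simp [triangularFamily, trd_eq]⟩
    · exact ⟨0, by simp [triangularFamily, trd_eq]⟩
  · fin_cases m
    · exact ⟨1, by simp [triangularFamily, nrd_eq, quatNorm]⟩
    · refine ⟨d, ?_⟩
      simp only [triangularFamily, nrd_eq, quatNorm]
      simp
      rw [haq, hdq]
      ring
    · refine ⟨(f * h) ^ 2 * M, ?_⟩
      simp only [triangularFamily, nrd_eq, quatNorm]
      simp
      rw [haq, hbq, hMq]
      field_simp
      ring
    · refine ⟨f ^ 2 * p * q, ?_⟩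
      simp only [triangularFamily, nrd_eq, quatNorm]
      simp
      rw [haq, hbq]
      ring
  · refine mem_span_range_of_eq ![0, 0, 1 - s, h * M] ?_
    simp only [triangularFamily, Fin.sum_univ_four]
    ext <;> simp <;> (try simp only [haq, hsq, hMq]) <;> field_simp <;> ring
  · refine mem_span_range_of_eq ![0, 0, -(q * h'), s] ?_
    simp only [triangularFamily, Fin.sum_univ_four]
    ext <;> simp <;> (try simp only [haq, hsq, hhq]) <;> field_simp <;> ring
  · refine mem_span_range_of_eq ![-(f ^ 2 * h * s), f ^ 2 * h, 0, 0] ?_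
    simp only [triangularFamily, Fin.sum_univ_four]
    ext <;> simp <;> (try simp only [haq, hbq, hsq]) <;> field_simp <;> ring
  · refine triangularFamily_isBasis hN ?_
    rw [← hN'', haq, hbq]
    field_simp
    ring

/-- With $g$ the first listed element, the second is $2g-1+tfk$. So 1 lies in the span, and only the
class of $z'$ modulo $2qf$ matters. -/
theorem span_range_basisOne {a b : ℤ} {q f : ℕ} (hq : q ≠ 0) {z z' t : ℤ}
    (h : z' = 4 * z + 2 * q * f * t) :
    Submodule.span ℤ (Set.range (basisOne (a := a) (b := b) q f z z')) =
      Submodule.span ℤ (Set.range (triangularFamily (1 / (2 * (q : ℤ))) ((f : ℤ) / 2)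
        ((f : ℤ) / 2) (f : ℤ) (2 * z))) := by
  have hq' : (q : ℚ) ≠ 0 := by exact_mod_cast hq
  have h' : (z' : ℚ) = 4 * z + 2 * q * f * t := by exact_mod_cast h
  refine le_antisymm (Submodule.span_le.2 ?_) (Submodule.span_le.2 ?_) <;>
    rintro _ ⟨m, rfl⟩ <;> fin_cases m
  · refine mem_span_range_of_eq ![0, 1, 0, 0] ?_
    simp only [triangularFamily, basisOne, Fin.sum_univ_four]
    ext <;> simp <;> field_simp
  · refine mem_span_range_of_eq ![-1, 2, 0, t] ?_
    simp only [triangularFamily, basisOne, Fin.sum_univ_four]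
    ext <;> simp <;> (try rw [h']) <;> field_simp <;> ring
  · refine mem_span_range_of_eq ![0, 0, 1, 0] ?_
    simp only [triangularFamily, basisOne, Fin.sum_univ_four]
    ext <;> simp
  · refine mem_span_range_of_eq ![0, 0, 0, 1] ?_
    simp only [triangularFamily, basisOne, Fin.sum_univ_four]
    ext <;> simp
  · refine mem_span_range_of_eq ![2, -1, 0, t] ?_
    simp only [triangularFamily, basisOne, Fin.sum_univ_four]
    ext <;> simp <;> (try rw [h']) <;> field_simp <;> ring
  · refine mem_span_range_of_eq ![1, 0, 0, 0] ?_
    simp only [triangularFamily, basisOne, Fin.sum_univ_four]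
    ext <;> simp <;> field_simp
  · refine mem_span_range_of_eq ![0, 0, 1, 0] ?_
    simp only [triangularFamily, basisOne, Fin.sum_univ_four]
    ext <;> simp
  · refine mem_span_range_of_eq ![0, 0, 0, 1] ?_
    simp only [triangularFamily, basisOne, Fin.sum_univ_four]
    ext <;> simp

theorem isBasisOfReducedDiscriminant_basisOne {a b : ℤ} {q f N : ℕ} (hq : q ≠ 0) (z z' : ℤ)
    (hN : N ≠ 0) (h : (a : ℚ) * b * f ^ 2 / q = N) :
    IsBasisOfReducedDiscriminant (basisOne (a := a) (b := b) q f z z') N := by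
  have hq' : (q : ℚ) ≠ 0 := by exact_mod_cast hq
  refine isBasisOfReducedDiscriminant_of_det hN ?_
  rw [← h]
  simp [basisOne, Matrix.det_succ_row_zero, Fin.sum_univ_succ, -mul_eq_mul_right_iff]
  field_simp
  norm_num [-mul_eq_mul_right_iff]
  ring

theorem basisThree_eq {a b : ℤ} (q f h : ℕ) (u : ℤ) : basisThree (a := a) (b := b) q f h u =
    triangularFamily (1 / 2) ((f : ℤ) * (h : ℤ) / (2 * (q : ℤ)))
      ((f : ℤ) * (h : ℤ) * u / (2 * (q : ℤ))) (f : ℤ) 0 := by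
  funext m
  fin_cases m <;> ext <;> simp [basisThree, triangularFamily]

end Quat

/-! ### The auxiliary prime and its congruences -/

section NumberTheory

variable {p q : ℕ}

/-- Dirichlet's theorem: modulo $4p$ in a class that is 3 modulo 4 and a nonsquare modulo $p$, or
modulo $8p$ in the class of 1. -/
theorem exists_isAuxiliaryPrime (hp : p.Prime) (hp2 : p ≠ 2) : ∃ q : ℕ, IsAuxiliaryPrime p q := by
  have := Fact.mk hp
  have hodd : p % 2 = 1 := hp.eq_two_or_odd.resolve_left hp2
  have hcop : Nat.Coprime 2 p := (Nat.coprime_primes Nat.prime_two hp).2 hp2.symm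
  by_cases hp1 : p % 4 = 1
  · obtain ⟨n, hn⟩ := FiniteField.exists_nonsquare (F := ZMod p) (by rwa [ZMod.ringChar_zmod_n])
    have hn0 : n ≠ 0 := by rintro rfl; exact hn IsSquare.zero
    have h4 : Nat.Coprime 4 p := Nat.Coprime.pow_left 2 hcop
    obtain ⟨k, hk4, hkp⟩ := Nat.chineseRemainder h4 3 n.val
    have hkn : (k : ZMod p) = n := by
      rw [(ZMod.natCast_eq_natCast_iff _ _ _).2 hkp, ZMod.natCast_val, ZMod.cast_id]
    have hk : k.Coprime (4 * p) := by
      refine Nat.Coprime.mul_right ?_ ?_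
      · rw [Nat.Coprime, hk4.gcd_eq]; rfl
      · rw [Nat.coprime_comm, hp.coprime_iff_not_dvd, ← ZMod.natCast_eq_zero_iff, hkn]
        exact hn0
    obtain ⟨q, -, hq, hqk⟩ := Nat.forall_exists_prime_gt_and_modEq 0
      (mul_ne_zero four_ne_zero hp.ne_zero) hk
    refine ⟨q, hq, fun _ => ⟨?_, ?_⟩, fun h => by omega⟩
    · rwa [(ZMod.natCast_eq_natCast_iff _ _ _).2 (hqk.of_mul_left 4), hkn]
    · exact (hqk.of_mul_right p).trans hk4
  · have hc : Nat.Coprime 1 (8 * p) := Nat.coprime_one_left _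
    obtain ⟨q, -, hq, hqk⟩ := Nat.forall_exists_prime_gt_and_modEq 0
      (mul_ne_zero (by norm_num) hp.ne_zero) hc
    refine ⟨q, hq, fun h => absurd h hp1, fun _ => ⟨?_, ?_⟩⟩
    · rw [(ZMod.natCast_eq_natCast_iff _ _ _).2 (hqk.of_mul_left 8), Nat.cast_one]
      exact IsSquare.one
    · exact hqk.of_mul_right p

theorem IsAuxiliaryPrime.ne (hp : p.Prime) (hp2 : p ≠ 2) (hq : IsAuxiliaryPrime p q) : p ≠ q := by
  rintro rfl
  have hodd : p % 2 = 1 := hp.eq_two_or_odd.resolve_left hp2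
  obtain ⟨-, h1, h3⟩ := hq
  rcases (by omega : p % 4 = 1 ∨ p % 4 = 3) with h | h
  · have := (h1 h).2; omega
  · have := (h3 h).2; omega

theorem IsAuxiliaryPrime.odd (hp : p.Prime) (hp2 : p ≠ 2) (hq : IsAuxiliaryPrime p q) :
    q % 2 = 1 := by
  have hodd : p % 2 = 1 := hp.eq_two_or_odd.resolve_left hp2
  obtain ⟨-, h1, h3⟩ := hq
  rcases (by omega : p % 4 = 1 ∨ p % 4 = 3) with h | h
  · have := (h1 h).2; omega
  · have := (h3 h).2; omega

/-- In either case exactly one of $-1$ and $q$ is a nonsquare modulo $p$. -/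
theorem IsAuxiliaryPrime.not_isSquare_neg [Fact p.Prime] (hp2 : p ≠ 2)
    (hq : IsAuxiliaryPrime p q) : ¬ IsSquare (-((q : ℤ) : ZMod p)) := by
  have hp : p.Prime := Fact.out
  have hne := hq.ne hp hp2
  have hodd : p % 2 = 1 := hp.eq_two_or_odd.resolve_left hp2
  have hq0 : (q : ZMod p) ≠ 0 := by
    rw [Ne, ZMod.natCast_eq_zero_iff]
    exact fun h => hne ((Nat.prime_dvd_prime_iff_eq hp hq.1).1 h)
  obtain ⟨-, h1, h3⟩ := hq
  rw [Int.cast_natCast]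
  intro hs
  rcases (by omega : p % 4 = 1 ∨ p % 4 = 3) with h | h
  · have hm : IsSquare (-1 : ZMod p) := ZMod.exists_sq_eq_neg_one_iff.2 (by omega)
    exact (h1 h).1 (by simpa using hm.mul hs)
  · refine ZMod.exists_sq_eq_neg_one_iff.1 ?_ h
    have := hs.div (h3 h).1
    rwa [neg_div, div_self hq0] at this

/-- Quadratic reciprocity: modulo $q$, the numbers $-1$ and $p$ are both nonsquares if $p\equiv1$,
and both squares if $p\equiv3 \pmod 4$. -/
theorem IsAuxiliaryPrime.exists_sq_modEq (hp : p.Prime) (hp2 : p ≠ 2)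
    (hq : IsAuxiliaryPrime p q) : ∃ x : ℤ, x ^ 2 ≡ -(p : ℤ) [ZMOD q] := by
  have := Fact.mk hp
  have := Fact.mk hq.1
  have hne := hq.ne hp hp2
  have hodd : p % 2 = 1 := hp.eq_two_or_odd.resolve_left hp2
  have hqodd := hq.odd hp hp2
  have hp0 : (p : ZMod q) ≠ 0 := by
    rw [Ne, ZMod.natCast_eq_zero_iff]
    exact fun h => hne ((Nat.prime_dvd_prime_iff_eq hq.1 hp).1 h).symm
  have key : IsSquare (-(p : ZMod q)) := by
    obtain ⟨-, h1, h3⟩ := hq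
    rcases (by omega : p % 4 = 1 ∨ p % 4 = 3) with h | h
    · obtain ⟨hns, hq3⟩ := h1 h
      have e1 : legendreSym q (-1) = -1 := (legendreSym.eq_neg_one_iff q).2 (by
        push_cast
        rw [ZMod.exists_sq_eq_neg_one_iff]
        omega)
      have e2 : legendreSym q p = -1 := (legendreSym.eq_neg_one_iff q).2 (by
        rw [Int.cast_natCast, ← ZMod.exists_sq_eq_prime_iff_of_mod_four_eq_one h (by omega)]
        exact hns)
      have e3 : legendreSym q (-1 * p) = 1 := by rw [legendreSym.mul, e1, e2]; rfl
      rw [legendreSym.eq_one_iff q (by push_cast; simpa using hp0)] at e3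
      simpa using e3
    · obtain ⟨hs, hq1⟩ := h3 h
      have hm : IsSquare (-1 : ZMod q) := ZMod.exists_sq_eq_neg_one_iff.2 (by omega)
      have := (ZMod.exists_sq_eq_prime_iff_of_mod_four_eq_one (p := q) (q := p) (by omega) hp2).2 hs
      simpa using hm.mul this
  obtain ⟨w, hw⟩ := key
  obtain ⟨x, rfl⟩ := ZMod.intCast_surjective w
  refine ⟨x, (ZMod.intCast_eq_intCast_iff _ _ _).1 ?_⟩
  push_cast
  rw [hw, pow_two]

theorem IsAuxiliaryPrime.exists_bezout (hp : p.Prime) (hp2 : p ≠ 2)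
    (hq : IsAuxiliaryPrime p q) {x : ℤ} (hx : x ^ 2 ≡ -(p : ℤ) [ZMOD q]) :
    ∃ y z : ℤ, y * q + z * (2 * x) = 1 := by
  have hqp : Prime (q : ℤ) := Nat.prime_iff_prime_int.1 hq.1
  have hqodd := hq.odd hp hp2
  have : IsCoprime (q : ℤ) (2 * x) := by
    rw [hqp.irreducible.coprime_iff_not_dvd]
    intro h
    rcases hqp.dvd_or_dvd h with h | h
    · have := Int.le_of_dvd two_pos h
      have := hq.1.two_le
      omega
    · have h1 : (q : ℤ) ∣ -p := hx.dvd_iff.1 (dvd_pow h two_ne_zero)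
      rw [dvd_neg, Int.natCast_dvd_natCast] at h1
      exact hq.ne hp hp2 ((Nat.prime_dvd_prime_iff_eq hq.1 hp).1 h1).symm
  exact this

/-- Modulo $q$, $z$ is the inverse of $2x$, so $4z^2\equiv x^{-2}\equiv-1/p$. -/
theorem dvd_four_mul_sq_add_one {x y z : ℤ} (hx : x ^ 2 ≡ -(p : ℤ) [ZMOD q])
    (h : y * q + z * (2 * x) = 1) : (q : ℤ) ∣ 4 * p * z ^ 2 + 1 := by
  obtain ⟨k, hk⟩ := hx.dvd
  refine ⟨y ^ 2 * q + 4 * y * z * x - 4 * z ^ 2 * k, ?_⟩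
  have h2 : (y * q + z * (2 * x)) ^ 2 = 1 := by rw [h]; rfl
  linear_combination (-4 * z ^ 2) * hk - h2

end NumberTheory

/-! ### Verification for the given parameters -/

namespace Quat

variable {p q r : ℕ}

/-- Treats both parities of $r$ at once: $\alpha=v_p(a)$ is 0 for odd and 1 for even $r$. -/
theorem exists_params_one (hr : 1 ≤ r) (hp1 : p % 4 = 1) : ∃ n α : ℕ, α ≤ 1 ∧ (Odd r ∨ α = 1) ∧
    r = 2 * n + 1 + α ∧ coeffA p r q = -((q : ℤ) * p ^ α) ∧ conductorF p r = p ^ n := by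
  by_cases h : Odd r
  · obtain ⟨n, rfl⟩ := h
    exact ⟨n, 0, by omega, Or.inl ⟨n, rfl⟩, rfl, by simp [coeffA, hp1], by simp [conductorF]⟩
  · obtain ⟨n, rfl⟩ := Nat.not_odd_iff_even.1 h
    refine ⟨n - 1, 1, le_rfl, Or.inr rfl, by omega, by simp [coeffA, hp1], ?_⟩
    simp only [conductorF, h, if_false]
    congr 1
    omega

theorem exists_params_three (hr : 1 ≤ r) (hp3 : p % 4 = 3) (hpq : ¬ p ∣ q) : ∃ n ε : ℕ, ε ≤ 1 ∧
    r = 2 * n + 1 + ε ∧ conductorF p r = p ^ n ∧ conductorH p r q = p ^ ε := by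
  by_cases h : Odd r
  · obtain ⟨n, rfl⟩ := h
    exact ⟨n, 0, by omega, rfl, by simp [conductorF], by simp [conductorH]⟩
  · have hb : padicValInt p (coeffB p q) = 0 := by
      refine padicValInt.eq_zero_of_not_dvd ?_
      rw [coeffB, if_neg (by omega), dvd_neg, Int.natCast_dvd_natCast]
      exact hpq
    obtain ⟨n, rfl⟩ := Nat.not_odd_iff_even.1 h
    refine ⟨n - 1, 1, le_rfl, by omega, ?_, by simp [conductorH, h, hb]⟩
    simp only [conductorF, h, if_false]
    congr 1
    omega

theorem coeffA_neg (hp : p.Prime) (hq : q.Prime) : coeffA p r q < 0 := by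
  have h1 : (0 : ℤ) < p := by exact_mod_cast hp.pos
  have h2 : (0 : ℤ) < q := by exact_mod_cast hq.pos
  unfold coeffA
  split_ifs
  · omega
  · have := mul_pos h2 h1; omega
  · omega

theorem coeffB_neg (hp : p.Prime) (hq : q.Prime) : coeffB p q < 0 := by
  have h1 : (0 : ℤ) < p := by exact_mod_cast hp.pos
  have h2 : (0 : ℤ) < q := by exact_mod_cast hq.pos
  unfold coeffB
  split_ifs <;> omega

theorem isOrderBasis_one (hp : p.Prime) (hr : 1 ≤ r) (hq : IsAuxiliaryPrime p q) (hp1 : p % 4 = 1)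
    {z : ℤ} (hz : (q : ℤ) ∣ 4 * p * z ^ 2 + 1) :
    IsOrderBasis (triangularFamily (a := coeffA p r q) (b := coeffB p q) (1 / (2 * (q : ℤ)))
      ((conductorF p r : ℤ) / 2) ((conductorF p r : ℤ) / 2) (conductorF p r : ℤ) (2 * z))
      (p ^ r) := by
  obtain ⟨n, α, hα, -, hrn, ha, hf⟩ := exists_params_one (q := q) hr hp1
  have hq3 := (hq.2.1 hp1).2
  have hc4 : ((p : ℤ) ^ α) % 4 = 1 := by
    interval_cases α
    · rfl
    · rw [pow_one]; omega
  generalize hc : (p : ℤ) ^ α = c at hc4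
  have hqc : ((q : ℤ) * c) % 4 = 3 := by
    rw [Int.mul_emod, hc4]; omega
  -- Divisibility by 4 comes from $qc\equiv3 \pmod 4$, divisibility by $q$ from the choice of $z$.
  have hdvd : (4 * (q : ℤ)) ∣ q * c + 1 + 4 * p * z ^ 2 := by
    refine IsCoprime.mul_dvd ?_ ?_ ?_
    · rw [Int.isCoprime_iff_gcd_eq_one]
      have h2 : Nat.Coprime 2 q := (Nat.coprime_primes Nat.prime_two hq.1).2 (by omega)
      exact Nat.Coprime.pow_left 2 h2
    · refine dvd_add (Int.dvd_of_emod_eq_zero (by omega)) ⟨p * z ^ 2, by ring⟩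
    · rw [add_assoc, add_comm (1 : ℤ)]
      exact dvd_add (dvd_mul_right _ _) hz
  obtain ⟨M, hM⟩ := hdvd
  refine isOrderBasis_triangularFamily_one (p := p) (q := q) (c := c) (c' := c / 2)
    (d := (q * c + 1) / 4) (M := M) (hc ▸ ha) (by rw [coeffB, if_pos hp1])
    (by exact_mod_cast hq.1.ne_zero) (by omega) (by omega) hM (pow_ne_zero _ hp.ne_zero) ?_
  rw [hf, ← hc, hrn]
  push_cast
  ring

theorem isOrderBasis_three (hp : p.Prime) (hr : 1 ≤ r) (hq : IsAuxiliaryPrime p q)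
    (hp3 : p % 4 = 3) {u : ℤ} (hu : u % 2 = 1) (hqu : (q : ℤ) ∣ 1 + p * u ^ 2) :
    IsOrderBasis (basisThree (a := coeffA p r q) (b := coeffB p q) q (conductorF p r)
      (conductorH p r q) u) (p ^ r) := by
  have hpq : ¬ p ∣ q := fun h => hq.ne hp (by omega) ((Nat.prime_dvd_prime_iff_eq hp hq.1).1 h)
  obtain ⟨n, ε, hε, hrn, hf, hh⟩ := exists_params_three hr hp3 hpq
  have hq1 := (hq.2.2 hp3).2
  have hdvd : (4 * (q : ℤ)) ∣ 1 + p * u ^ 2 := by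
    refine IsCoprime.mul_dvd ?_ ?_ hqu
    · rw [Int.isCoprime_iff_gcd_eq_one]
      have h2 : Nat.Coprime 2 q := (Nat.coprime_primes Nat.prime_two hq.1).2 (by omega)
      exact Nat.Coprime.pow_left 2 h2
    -- An odd square is 1 modulo 4 and $p\equiv3$, so $4\mid1+pu^2$.
    · obtain ⟨k, rfl⟩ : ∃ k, u = 2 * k + 1 := ⟨u / 2, by omega⟩
      obtain ⟨m, hm⟩ : ∃ m : ℤ, (p : ℤ) = 4 * m + 3 := ⟨p / 4, by omega⟩
      exact ⟨(1 + m) + p * (k ^ 2 + k), by rw [hm]; ring⟩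
  obtain ⟨M, hM⟩ := hdvd
  have hup : (u * p) % 2 = 1 := by
    rw [Int.mul_emod, hu]; omega
  rw [basisThree_eq]
  refine isOrderBasis_triangularFamily_two (p := p) (q := q) (s := (u * p + 1) / 2)
    (d := (p + 1) / 4) (M := M) (h' := (p : ℤ) ^ (1 - ε)) (by rw [coeffA, if_neg (by omega)])
    (by rw [coeffB, if_neg (by omega)])
    (by exact_mod_cast hq.1.ne_zero) (by omega) (by omega) ?_ hM (pow_ne_zero _ hp.ne_zero) ?_
  · rw [hh]
    push_cast
    rw [← pow_add, Nat.add_sub_cancel' hε, pow_one]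
  · rw [hf, hh, hrn]
    push_cast
    ring

theorem hasDiagonalNorm_coeff [Fact p.Prime] (hp2 : p ≠ 2) (hq : IsAuxiliaryPrime p q) :
    HasDiagonalNorm p (coeffA p r q) (coeffB p q) := by
  have h := hq.not_isSquare_neg hp2
  unfold coeffA coeffB
  split_ifs
  · exact hasDiagonalNorm_unramified_left h
  · exact hasDiagonalNorm_unramified_neither h
  · exact hasDiagonalNorm_unramified_right h

theorem norm_two_padic [Fact p.Prime] (hp2 : p ≠ 2) : ‖(2 : ℚ_[p])‖ = 1 := by
  have := (Padic.norm_natCast_eq_one_iff (p := p) (n := 2)).2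
    ((Nat.coprime_primes Fact.out Nat.prime_two).2 hp2)
  simpa using this

theorem isLocalResiduallyInert_one [Fact p.Prime] (hp2 : p ≠ 2) (hr : 1 ≤ r)
    (hq : IsAuxiliaryPrime p q) (hp1 : p % 4 = 1) (z : ℤ) :
    IsLocalResiduallyInert (localization (Submodule.span ℤ (Set.range
      (triangularFamily (a := coeffA p r q) (b := coeffB p q) (1 / (2 * (q : ℤ)))
      ((conductorF p r : ℤ) / 2) ((conductorF p r : ℤ) / 2) (conductorF p r : ℤ) (2 * z)))) p) r := by
  obtain ⟨n, α, hα, hodd, hrn, ha, hf⟩ := exists_params_one (q := q) hr hp1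
  have hqn : ‖(q : ℚ_[p])‖ = 1 := Padic.norm_natCast_eq_one_iff.2
    ((Nat.coprime_primes Fact.out hq.1).2 (hq.ne Fact.out hp2))
  have h2 := norm_two_padic hp2
  -- Here $K=\mathbb Q_p(i+2zk)$ and $v_p(b)=1$; as $r=2n+1+\alpha$, the $j$- and $k$-parts both
  -- start at $p^n$.
  refine (hasDiagonalNorm_coeff hp2 hq).isLocalResiduallyInert (α := α) (β := 1) (m := n) (n := n)
    ?_ ?_ hr hα hodd (by omega) (by omega) (by omega) (by omega) (2 * z)
    (mem_localization_triangularFamily hp2 ?_ ?_ ?_ ?_)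
  · rw [ha]; push_cast; rw [norm_neg, norm_mul, hqn, one_mul, norm_pow]
  · rw [coeffB, if_pos hp1]; push_cast; rw [norm_neg, pow_one]
  · push_cast; rw [norm_div, norm_mul, h2, hqn]; simp
  · rw [hf]; push_cast; rw [norm_div, h2, norm_pow, div_one]
  · rw [hf]; push_cast; rw [norm_div, h2, norm_pow, div_one]
  · rw [hf]; push_cast; rw [norm_pow]

theorem isLocalResiduallyInert_three [Fact p.Prime] (hp2 : p ≠ 2) (hr : 1 ≤ r)
    (hq : IsAuxiliaryPrime p q) (hp3 : p % 4 = 3) (u : ℤ) :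
    IsLocalResiduallyInert (localization (Submodule.span ℤ (Set.range
      (basisThree (a := coeffA p r q) (b := coeffB p q) q (conductorF p r)
      (conductorH p r q) u))) p) r := by
  have hne := hq.ne Fact.out hp2
  have hpq : ¬ p ∣ q := fun h => hne ((Nat.prime_dvd_prime_iff_eq Fact.out hq.1).1 h)
  obtain ⟨n, ε, hε, hrn, hf, hh⟩ := exists_params_three hr hp3 hpq
  have hqn : ‖(q : ℚ_[p])‖ = 1 := Padic.norm_natCast_eq_one_iff.2
    ((Nat.coprime_primes Fact.out hq.1).2 hne)
  have h2 := norm_two_padic hp2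
  have hp1 : ‖(p : ℚ_[p])‖ ≤ 1 := Padic.norm_p_lt_one.le
  rw [basisThree_eq]
  have hσ : ‖((((conductorF p r : ℤ) : ℚ) * ((conductorH p r q : ℤ) : ℚ) / (2 * ((q : ℤ) : ℚ)) : ℚ) :
      ℚ_[p])‖ = ‖(p : ℚ_[p])‖ ^ (n + ε) := by
    rw [hf, hh]
    push_cast
    rw [norm_div, norm_mul, norm_mul, h2, hqn, norm_pow, norm_pow, pow_add, one_mul, div_one]
  -- Here $K=\mathbb Q_p(i)$ is ramified and $b$ is a unit; the factor $h=p^{\varepsilon}$ supplies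
  -- the extra power in the $j$-part for even $r$.
  refine (hasDiagonalNorm_coeff hp2 hq).isLocalResiduallyInert (α := 1) (β := 0) (m := n + ε)
    (n := n) ?_ ?_ hr le_rfl (Or.inr rfl) (by omega) (by omega) (by omega) (by omega) 0
    (mem_localization_triangularFamily hp2 ?_ hσ ?_ ?_)
  · rw [coeffA, if_neg (by omega)]; push_cast; rw [norm_neg, pow_one]
  · rw [coeffB, if_neg (by omega)]; push_cast; rw [norm_neg, hqn, pow_zero]
  · push_cast; rw [norm_div, h2]; simp
  · rw [mul_div_right_comm, Rat.cast_mul, norm_mul, hσ, pow_add, mul_assoc]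
    refine mul_le_of_le_one_right (by positivity) (mul_le_one₀ (pow_le_one₀ (norm_nonneg _) hp1)
      (norm_nonneg _) ?_)
    rw [Rat.cast_intCast]
    exact Padic.norm_int_le_one u
  · rw [hf]; push_cast; rw [norm_pow]

end Quat

theorem mainTheorem2 (p r : ℕ) (hp : p.Prime) (hp2 : p ≠ 2) (hr : 1 ≤ r) :
    (∃ q : ℕ, IsAuxiliaryPrime p q) ∧
    ∀ q : ℕ, IsAuxiliaryPrime p q →
      (IsQuaternionAlgebra (Quat ℚ (coeffA p r q) (coeffB p q)) ∧
        IsDefinite (Quat ℚ (coeffA p r q) (coeffB p q)) ∧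
        discriminant (Quat ℚ (coeffA p r q) (coeffB p q)) = p) ∧
      (∀ (B : Type*) [Ring B] [Algebra ℚ B], IsQuaternionAlgebra B → IsDefinite B →
        discriminant B = p →
        Nonempty (B ≃ₐ[ℚ] Quat ℚ (coeffA p r q) (coeffB p q))) ∧
      (∃ x : ℤ, x ^ 2 ≡ -(p : ℤ) [ZMOD q]) ∧
      ∀ x : ℤ, x ^ 2 ≡ -(p : ℤ) [ZMOD q] →
        (p % 4 = 1 →
          ∀ y z z' : ℤ, y * (-(q : ℤ)) + z * (2 * x) = 1 →
            0 ≤ z' → z' < 2 * q * conductorF p r →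
            z' ≡ 4 * z [ZMOD 2 * q * conductorF p r] →
            ∀ e : Fin 4 → Quat ℚ (coeffA p r q) (coeffB p q),
              e = basisOne q (conductorF p r) z z' →
              HasLevel (Submodule.span ℤ (Set.range e)) (p ^ r) ∧
              IsBasisOfReducedDiscriminant e (p ^ r)) ∧
        (p % 4 = 3 →
          ∀ v w u : ℤ, v * q + w * (2 * x) = 1 →
            0 ≤ u → u < 2 * q → u ≡ v * q + 2 * w [ZMOD 2 * q] →
            ∀ e : Fin 4 → Quat ℚ (coeffA p r q) (coeffB p q),
              e = basisThree q (conductorF p r) (conductorH p r q) u →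
              HasLevel (Submodule.span ℤ (Set.range e)) (p ^ r) ∧
              IsBasisOfReducedDiscriminant e (p ^ r)) := by
  have := Fact.mk hp
  refine ⟨exists_isAuxiliaryPrime hp hp2, fun q hq => ?_⟩
  have hodd : p % 2 = 1 := hp.eq_two_or_odd.resolve_left hp2
  have hA := Quat.coeffA_neg (r := r) hp hq.1
  have hB := Quat.coeffB_neg hp hq.1
  have hD := Quat.hasDiagonalNorm_coeff (r := r) hp2 hq
  have hdiv := hD.isDivision hA.ne hB.ne
  -- The term $vq$ is what makes $u$ odd, since $vq=1-2wx$; modulo $q$ only $2w$ remains, which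
  -- gives the divisibility in `hdvd_u`.
  have hodd_u : ∀ {v w x u : ℤ}, v * q + w * (2 * x) = 1 → u ≡ v * q + 2 * w [ZMOD 2 * q] →
      u % 2 = 1 := fun {v w x u} h hu => by
    have h1 : u % 2 = (v * q + 2 * w) % 2 := hu.of_mul_right (q : ℤ)
    have h2 : v * q = 1 - 2 * (w * x) := by linear_combination h
    omega
  have hdvd_u : ∀ {v w x u : ℤ}, x ^ 2 ≡ -(p : ℤ) [ZMOD q] → v * q + w * (2 * x) = 1 →
      u ≡ v * q + 2 * w [ZMOD 2 * q] → (q : ℤ) ∣ 1 + p * u ^ 2 := fun {v w x u} hx h hu => by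
    obtain ⟨k, hk⟩ := dvd_four_mul_sq_add_one hx h
    obtain ⟨m, hm⟩ := hu.dvd
    obtain ⟨s, hs⟩ : ∃ s, u = 2 * w + q * s := ⟨v - 2 * m, by linear_combination -hm⟩
    exact ⟨k + p * (4 * w * s + q * s ^ 2), by rw [hs]; linear_combination hk⟩
  have hX := hq.exists_sq_modEq hp hp2
  -- Ramification is read off one order of the family, built from any root $x$ and any Bézout pair.
  have hDR : IsDefiniteRamifiedAt p (coeffA p r q) (coeffB p q) := by
    obtain ⟨x, hx⟩ := hX
    obtain ⟨y, z, hyz⟩ := hq.exists_bezout hp hp2 hx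
    rcases (by omega : p % 4 = 1 ∨ p % 4 = 3) with h | h
    · exact (Quat.isOrderBasis_one hp hr hq h (dvd_four_mul_sq_add_one hx hyz)).isDefiniteRamifiedAt
        hA hB hdiv
    · exact (Quat.isOrderBasis_three hp hr hq h (hodd_u hyz (Int.ModEq.refl _))
        (hdvd_u hx hyz (Int.ModEq.refl _))).isDefiniteRamifiedAt hA hB hdiv
  have hQ : IsQuaternionAlgebra (Quat ℚ (coeffA p r q) (coeffB p q)) :=
    isQuaternionAlgebra_quat hDR.neg_left.ne hDR.isDivision
  refine ⟨⟨hQ, hDR.isDefinite, hDR.discriminant_eq hp⟩, fun B _ _ h1 h2 h3 =>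
    hDR.nonempty_equiv_of_discriminant hp2 h1 h2 h3, hX, fun x hx => ⟨?_, ?_⟩⟩
  · rintro h y z z' hyz - - hz' e rfl
    obtain ⟨t, ht⟩ := hz'.symm.dvd
    have hz := dvd_four_mul_sq_add_one (x := x) (y := -y) (z := z) hx (by linear_combination hyz)
    refine ⟨?_, ?_⟩
    · rw [Quat.span_range_basisOne hq.1.ne_zero (t := t) (by linear_combination ht)]
      exact (Quat.isOrderBasis_one hp hr hq h hz).hasLevel hA.ne hB.ne
        (Quat.isLocalResiduallyInert_one hp2 hr hq h z)
    · refine Quat.isBasisOfReducedDiscriminant_basisOne hq.1.ne_zero z z' (pow_ne_zero _ hp.ne_zero) ?_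
      obtain ⟨n, α, -, -, hrn, ha, hf⟩ := Quat.exists_params_one (q := q) hr h
      have hq0 : (q : ℚ) ≠ 0 := by exact_mod_cast hq.1.ne_zero
      rw [ha, hf, hrn, coeffB, if_pos h]
      push_cast
      field_simp
      ring
  · rintro h v w u hvw - - hu e rfl
    have hE := Quat.isOrderBasis_three hp hr hq h (hodd_u hvw hu) (hdvd_u hx hvw hu)
    exact ⟨hE.hasLevel hA.ne hB.ne (Quat.isLocalResiduallyInert_three hp2 hr hq h u), hE.basis⟩
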